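/- Let $\omega:[0,+\infty)\to[0,+\infty)$ be a non-quasianalytic weight function, i.e. a continuous increasing (not necessarily strictly) function such that - $(\alpha)$ there is $L\ge1$ with $\omega(2t)\le L(\omega(t)+1)$ for all $t\ge0$; - $(\beta)$ $\int_1^{+\infty}\omega(t)\,t^{-2}\,dt<+\infty$; - $(\gamma)$ there are $a\in\mathbb R$, $b>0$ with $\omega(t)\ge a+b\log(1+t)$ for all $t\ge0$; - $(\delta)$ $\varphi(t):=\omega(e^t)$ is convex on $\mathbb R$. Put $\omega(\zeta):=\omega(|\zeta|)$ for vectors $\zeta$ ($|\cdot|$ the Euclidean norm), and let $\varphi^*(s):=\sup_{t\ge0}\{ts-\varphi(t)\}\in(-\infty,+\infty]$, $s\ge0$, be the Young conjugate, with $e^{-\infty}:=0$. Write $D^\alpha=D_1^{\alpha_1}\cdots D_d^{\alpha_d}$, $D_j=-i\partial_{x_j}$, and $$\hat u(\xi)=\int_{\mathbb R^d}u(x)e^{-i\langle x,\xi\rangle}dx,\qquad V_\psi u(x,\xi)=\int_{\mathbb R^d}u(y)\overline{\psi(y-x)}e^{-i\langle y,\xi\rangle}dy .$$ Let $\mathcal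 S_\omega(\mathbb R^d)$ be the set of all $u\in L^1(\mathbb R^d)$ such that $u,\hat u\in C^\infty(\mathbb R^d)$ and, for all $\lambda>0$ and $\alpha\in\mathbb N_0^d$, $\sup_x e^{\lambda\omega(x)}|D^\alpha u(x)|<+\infty$ and $\sup_\xi e^{\lambda\omega(\xi)}|D^\alpha\hat u(\xi)|<+\infty$. For $F$ measurable on $\mathbb R^{2d}$ let $$\|F\|_{L^{p,q}}=\Big(\int_{\mathbb R^d}\Big(\int_{\mathbb R^d}|F(x,\xi)|^p\,dx\Big)^{q/p}d\xi\Big)^{1/q},$$ with the essential supremum in place of the corresponding norm if $p$ or $q$ is $\infty$. **Theorem.** Let $u\in\mathcal S(\mathbb R^d)$ and $1\le p,q\le+\infty$. Then $u\in\mathcal S_\omega(\mathbb R^d)$ is equivalent to each one of the following conditions $(a)'$–$(h)'$ separately: - $(a)'$ for all $\lambda>0$, $\alpha\in\mathbb N_0^d$ there is $C_{\alpha,\lambda}>0$ with $\|e^{\lambda\omega(x)}D^\alpha u(x)\|_{L^p}\le C_{\alpha,\lambda}$, and for all $\lambda>0$, $\alpha\in\mathbb N_0^d$ there is $C_{\alpha,\lambda}>0$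 with $\|e^{\lambda\omega(\xi)}D^\alpha\hat u(\xi)\|_{L^q}\le C_{\alpha,\lambda}$; - $(b)'$ for all $\lambda>0$, $\alpha\in\mathbb N_0^d$ there is $C_{\alpha,\lambda}>0$ with $\|e^{\lambda\omega(x)}x^\alpha u(x)\|_{L^p}\le C_{\alpha,\lambda}$, and for all $\lambda>0$, $\alpha\in\mathbb N_0^d$ there is $C_{\alpha,\lambda}>0$ with $\|e^{\lambda\omega(\xi)}\xi^\alpha\hat u(\xi)\|_{L^q}\le C_{\alpha,\lambda}$; - $(c)'$ for all $\lambda>0$ there is $C_\lambda>0$ with $\|e^{\lambda\omega(x)}u(x)\|_{L^p}\le C_\lambda$, and for all $\lambda>0$ there is $C_\lambda>0$ with $\|e^{\lambda\omega(\xi)}\hat u(\xi)\|_{L^q}\le C_\lambda$; - $(d)'$ for all $\lambda>0$, $\beta\in\mathbb N_0^d$ there is $C_{\beta,\lambda}>0$ with $\sup_{\alpha\in\mathbb N_0^d}\|x^\beta D^\alpha u(x)\|_{L^p}\,e^{-\lambda\varphi^*(|\alpha|/\lambda)}\le C_{\beta,\lambda}$, and for all $\mu>0$, $\alpha\in\mathbb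 N_0^d$ there is $C_{\alpha,\mu}>0$ with $\sup_{\beta\in\mathbb N_0^d}\|x^\beta D^\alpha u(x)\|_{L^q}\,e^{-\mu\varphi^*(|\beta|/\mu)}\le C_{\alpha,\mu}$; - $(e)'$ for all $\mu,\lambda>0$ there is $C_{\mu,\lambda}>0$ with $\sup_{\alpha,\beta\in\mathbb N_0^d}\|x^\beta D^\alpha u(x)\|_{L^p}\,e^{-\lambda\varphi^*(|\alpha|/\lambda)}e^{-\mu\varphi^*(|\beta|/\mu)}\le C_{\mu,\lambda}$; - $(f)'$ for all $\lambda>0$ there is $C_\lambda>0$ with $\sup_{\alpha,\beta\in\mathbb N_0^d}\|x^\beta D^\alpha u(x)\|_{L^p}\,e^{-\lambda\varphi^*(|\alpha+\beta|/\lambda)}\le C_\lambda$; - $(g)'$ for all $\mu,\lambda>0$ there is $C_{\mu,\lambda}>0$ with $\sup_{\alpha\in\mathbb N_0^d}\|e^{\mu\omega(x)}D^\alpha u(x)\|_{L^p}\,e^{-\lambda\varphi^*(|\alpha|/\lambda)}\le C_{\mu,\lambda}$; - $(h)'$ (for any given $\psi\in\mathcal S_\omega(\mathbb R^d)\setminus\{0\}$)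 for all $\lambda>0$ there is $C_\lambda>0$ with $\|V_\psi u(z)\,e^{\lambda\omega(z)}\|_{L^{p,q}}\le C_\lambda$, $z=(x,\xi)\in\mathbb R^{2d}$. -/

import Mathlib

open MeasureTheory
open scoped ENNReal SchwartzMap ComplexConjugate

noncomputable section

/-- A non-quasianalytic weight function `ω : [0, ∞) → [0, ∞)`: continuous, increasing (in the wide
sense), with the properties (α), (β), (γ), (δ). It is represented by a function on `ℝ` of which
only the values on `[0, ∞)` are ever used. -/
structure IsWeightFunction (ω : ℝ → ℝ) : Prop where
  continuousOn : ContinuousOn ω (Set.Ici 0)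
  monotoneOn : MonotoneOn ω (Set.Ici 0)
  nonneg : ∀ t : ℝ, 0 ≤ t → 0 ≤ ω t
  alpha : ∃ L : ℝ, 1 ≤ L ∧ ∀ t : ℝ, 0 ≤ t → ω (2 * t) ≤ L * (ω t + 1)
  beta : IntegrableOn (fun t : ℝ => ω t / t ^ 2) (Set.Ici 1)
  gamma : ∃ a b : ℝ, 0 < b ∧ ∀ t : ℝ, 0 ≤ t → a + b * Real.log (1 + t) ≤ ω t
  delta : ConvexOn ℝ Set.univ (fun t : ℝ => ω (Real.exp t))

/-- The Young conjugate `φ*(s) = sup_{t ≥ 0} (t s - φ(t))` of `φ(t) = ω(e^t)`. The supremum may be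
`+∞` (for instance for `ω(t) = log (1 + t)` and `s > 1`), so it is taken in `[-∞, ∞]`. -/
def youngConj (ω : ℝ → ℝ) (s : ℝ) : EReal :=
  ⨆ t : Set.Ici (0 : ℝ), (((t : ℝ) * s - ω (Real.exp t) : ℝ) : EReal)

/-- The factor `e^{-λ φ*(k/λ)}`, with `e^{-∞} = 0`. -/
def youngFactor (ω : ℝ → ℝ) (lam : ℝ) (k : ℕ) : ℝ≥0∞ :=
  EReal.exp (-((lam : EReal) * youngConj ω ((k : ℝ) / lam)))

variable {d : ℕ}

/-- The Fourier transform `û(ξ) = ∫ u(x) e^{-i⟨x,ξ⟩} dx`. -/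
def fourierHat (u : EuclideanSpace ℝ (Fin d) → ℂ) (ξ : EuclideanSpace ℝ (Fin d)) : ℂ :=
  ∫ x, u x * Complex.exp (-Complex.I * ((inner ℝ x ξ : ℝ) : ℂ))

/-- The Gabor transform `V_ψ u(x,ξ) = ∫ u(y) conj(ψ(y-x)) e^{-i⟨y,ξ⟩} dy`. -/
def gaborTransform (ψ u : EuclideanSpace ℝ (Fin d) → ℂ) (x ξ : EuclideanSpace ℝ (Fin d)) : ℂ :=
  ∫ y, u y * conj (ψ (y - x)) * Complex.exp (-Complex.I * ((inner ℝ y ξ : ℝ) : ℂ))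

/-- The operator `D_j = -i ∂/∂x_j`. -/
def coordD (j : Fin d) (f : EuclideanSpace ℝ (Fin d) → ℂ) : EuclideanSpace ℝ (Fin d) → ℂ :=
  fun x => -Complex.I * fderiv ℝ f x (EuclideanSpace.single j 1)

/-- The operator `D^α = D_1^{α_1} ⋯ D_d^{α_d}`. -/
def multiD (α : Fin d → ℕ) (f : EuclideanSpace ℝ (Fin d) → ℂ) : EuclideanSpace ℝ (Fin d) → ℂ :=
  (List.finRange d).foldr (fun j g => (coordD j)^[α j] g) f

/-- The monomial `x^β = x_1^{β_1} ⋯ x_d^{β_d}`. -/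
def monom (β : Fin d → ℕ) (x : EuclideanSpace ℝ (Fin d)) : ℝ := ∏ j, x j ^ β j

/-- The length `|α| = α_1 + ⋯ + α_d` of a multi-index. -/
def multiLength (α : Fin d → ℕ) : ℕ := ∑ j, α j

/-- Membership in `S_ω(ℝ^d)`. -/
structure MemSOmega (ω : ℝ → ℝ) (u : EuclideanSpace ℝ (Fin d) → ℂ) : Prop where
  integrable : Integrable u
  smooth : ContDiff ℝ (⊤ : ℕ∞) u
  smooth_hat : ContDiff ℝ (⊤ : ℕ∞) (fourierHat u)
  bound : ∀ lam : ℝ, 0 < lam → ∀ α : Fin d → ℕ,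
    ∃ C : ℝ, ∀ x, Real.exp (lam * ω ‖x‖) * ‖multiD α u x‖ ≤ C
  bound_hat : ∀ lam : ℝ, 0 < lam → ∀ α : Fin d → ℕ,
    ∃ C : ℝ, ∀ ξ, Real.exp (lam * ω ‖ξ‖) * ‖multiD α (fourierHat u) ξ‖ ≤ C

/-- The norm of `L^{p,q}(ℝ^{2d})`: the `L^p` norm in the first variable `x`, followed by the `L^q`
norm in the second variable `ξ` (essential suprema for infinite exponents). -/
def mixedNorm (p q : ℝ≥0∞)
    (F : EuclideanSpace ℝ (Fin d) → EuclideanSpace ℝ (Fin d) → ℂ) : ℝ≥0∞ :=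
  eLpNorm (fun ξ => eLpNorm (fun x => F x ξ) p volume) q volume

/-- `e^{λω} D^α u ∈ L^p` and `e^{λω} D^α û ∈ L^q` for all `λ > 0` and `α`, with bounds `C_{α,λ}`. -/
def CondA (ω : ℝ → ℝ) (p q : ℝ≥0∞) (u : EuclideanSpace ℝ (Fin d) → ℂ) : Prop :=
  (∀ lam : ℝ, 0 < lam → ∀ α : Fin d → ℕ, ∃ C : ℝ, 0 < C ∧
    eLpNorm (fun x => Real.exp (lam * ω ‖x‖) • multiD α u x) p volume ≤ ENNReal.ofReal C) ∧
  (∀ lam : ℝ, 0 < lam → ∀ α : Fin d → ℕ, ∃ C : ℝ, 0 < C ∧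
    eLpNorm (fun ξ => Real.exp (lam * ω ‖ξ‖) • multiD α (fourierHat u) ξ) q volume
      ≤ ENNReal.ofReal C)

/-- Weighted bounds on `x^α u` in `L^p` and on `ξ^α û` in `L^q`. -/
def CondB (ω : ℝ → ℝ) (p q : ℝ≥0∞) (u : EuclideanSpace ℝ (Fin d) → ℂ) : Prop :=
  (∀ lam : ℝ, 0 < lam → ∀ α : Fin d → ℕ, ∃ C : ℝ, 0 < C ∧
    eLpNorm (fun x => (Real.exp (lam * ω ‖x‖) * monom α x) • u x) p volume
      ≤ ENNReal.ofReal C) ∧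
  (∀ lam : ℝ, 0 < lam → ∀ α : Fin d → ℕ, ∃ C : ℝ, 0 < C ∧
    eLpNorm (fun ξ => (Real.exp (lam * ω ‖ξ‖) * monom α ξ) • fourierHat u ξ) q volume
      ≤ ENNReal.ofReal C)

/-- Weighted bounds on `u` in `L^p` and on `û` in `L^q`. -/
def CondC (ω : ℝ → ℝ) (p q : ℝ≥0∞) (u : EuclideanSpace ℝ (Fin d) → ℂ) : Prop :=
  (∀ lam : ℝ, 0 < lam → ∃ C : ℝ, 0 < C ∧
    eLpNorm (fun x => Real.exp (lam * ω ‖x‖) • u x) p volume ≤ ENNReal.ofReal C) ∧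
  (∀ lam : ℝ, 0 < lam → ∃ C : ℝ, 0 < C ∧
    eLpNorm (fun ξ => Real.exp (lam * ω ‖ξ‖) • fourierHat u ξ) q volume ≤ ENNReal.ofReal C)

/-- Separate bounds on `x^β D^α u`: uniform in `α` for the `L^p` norm, in `β` for the `L^q` norm. -/
def CondD (ω : ℝ → ℝ) (p q : ℝ≥0∞) (u : EuclideanSpace ℝ (Fin d) → ℂ) : Prop :=
  (∀ lam : ℝ, 0 < lam → ∀ β : Fin d → ℕ, ∃ C : ℝ, 0 < C ∧
    (⨆ α : Fin d → ℕ, eLpNorm (fun x => monom β x • multiD α u x) p volume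
      * youngFactor ω lam (multiLength α)) ≤ ENNReal.ofReal C) ∧
  (∀ mu : ℝ, 0 < mu → ∀ α : Fin d → ℕ, ∃ C : ℝ, 0 < C ∧
    (⨆ β : Fin d → ℕ, eLpNorm (fun x => monom β x • multiD α u x) q volume
      * youngFactor ω mu (multiLength β)) ≤ ENNReal.ofReal C)

/-- Joint bound on `x^β D^α u` in `L^p`, with separate Young-conjugate factors for `α` and `β`. -/
def CondE (ω : ℝ → ℝ) (p : ℝ≥0∞) (u : EuclideanSpace ℝ (Fin d) → ℂ) : Prop :=
  ∀ mu lam : ℝ, 0 < mu → 0 < lam → ∃ C : ℝ, 0 < C ∧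
    (⨆ (α : Fin d → ℕ) (β : Fin d → ℕ), eLpNorm (fun x => monom β x • multiD α u x) p volume
      * youngFactor ω lam (multiLength α) * youngFactor ω mu (multiLength β)) ≤ ENNReal.ofReal C

/-- Joint bound on `x^β D^α u` in `L^p`, with one Young-conjugate factor at `|α + β|`. -/
def CondF (ω : ℝ → ℝ) (p : ℝ≥0∞) (u : EuclideanSpace ℝ (Fin d) → ℂ) : Prop :=
  ∀ lam : ℝ, 0 < lam → ∃ C : ℝ, 0 < C ∧
    (⨆ (α : Fin d → ℕ) (β : Fin d → ℕ), eLpNorm (fun x => monom β x • multiD α u x) p volume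
      * youngFactor ω lam (multiLength (α + β))) ≤ ENNReal.ofReal C

/-- Bound on `e^{μω} D^α u` in `L^p`, uniform in `α` with the Young-conjugate factor. -/
def CondG (ω : ℝ → ℝ) (p : ℝ≥0∞) (u : EuclideanSpace ℝ (Fin d) → ℂ) : Prop :=
  ∀ mu lam : ℝ, 0 < mu → 0 < lam → ∃ C : ℝ, 0 < C ∧
    (⨆ α : Fin d → ℕ, eLpNorm (fun x => Real.exp (mu * ω ‖x‖) • multiD α u x) p volume
      * youngFactor ω lam (multiLength α)) ≤ ENNReal.ofReal C

/-- Weighted `L^{p,q}` bound on the Gabor transform with window `ψ`. The weight is evaluated at the Euclidean norm `(‖x‖² + ‖ξ‖²)^{1/2}` of `z = (x, ξ)`. -/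
def CondH (ω : ℝ → ℝ) (p q : ℝ≥0∞) (ψ u : EuclideanSpace ℝ (Fin d) → ℂ) : Prop :=
  ∀ lam : ℝ, 0 < lam → ∃ C : ℝ, 0 < C ∧
    mixedNorm p q (fun x ξ =>
      Real.exp (lam * ω (Real.sqrt (‖x‖ ^ 2 + ‖ξ‖ ^ 2))) • gaborTransform ψ u x ξ)
      ≤ ENNReal.ofReal C

end

/-! Every condition is compared with one hub: $\int e^{\lambda\omega}|u|$ and $\int
e^{\lambda\omega}|\hat u|$ are finite for all $\lambda>0$ (`WeightedL1` for `u` and `fourierHat u`).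
The hub says nothing about derivatives, does not mention $p$ or $q$, and is symmetric in $u$ and
$\hat u$.

From the hub to the conditions: a window splits the weight by quasi-subadditivity of $\omega$, so
$|V_\psi u(x,\xi)|\lesssim e^{-\lambda\omega(x)}$. The identity relating $V_\psi u(x,\xi)$ to
$V_{\hat\psi}\hat u(\xi,-x)$ gives the same decay in $\xi$, and a geometric mean gives both at once;
this is already $(h)'$. For the others take a Gaussian window $g$. Fourier inversion in $\xi$ bounds
the derivatives of $u\,\overline{g(\cdot-x)}$ by moments of $e^{-\lambda\omega}$, that is by
$e^{\lambda\varphi^*(k/\lambda)}$. Multiplying by the analytic function $1/g(\cdot-x)$ and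
differentiating at $x$ costs factors $A^j j!$, which are harmless because $\omega(t)=o(t)$ by
$(\beta)$. The result is `JointBound`, for $u$ and for $\hat u$, and $(a)'$–$(g)'$ follow from it by
spending a little of the weight on integrability.

From the conditions to the hub: for $(a)'$–$(c)'$ use a Hölder inequality with weight
$e^{-\kappa\omega}$, integrable by $(\gamma)$. For $(d)'$–$(f)'$, moment bounds are turned into
exponential weights by optimising over the order $k$; convexity $(\delta)$ makes the optimum reach
$e^{-\lambda\omega}$ up to one power of $|x|$ (`exists_growth_le`). Condition $(g)'$ uses Hölder for
$u$ and this optimisation for $\hat u$. For $(h)'$, Fourier inversion bounds $|u(y)\psi(y-x)|$ by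
$\int|V_\psi u(x,\xi)|\,d\xi$, which is then averaged over $x$.

The quantity $e^{\lambda\varphi^*(k/\lambda)}$ is handled as `growth` in $[0,\infty]$, since it may
be infinite. -/

/-- The supremum of `t ^ k * e^{-λ ω(t)}` over `t ≥ 1`, that is `e^{λ φ*(k/λ)}`. -/
noncomputable def growth (ω : ℝ → ℝ) (lam : ℝ) (k : ℕ) : ℝ≥0∞ :=
  ⨆ t : Set.Ici (1 : ℝ), ENNReal.ofReal ((t : ℝ) ^ k * Real.exp (-(lam * ω t)))

/-! ### Consequences of $(\alpha)$–$(\delta)$ for the weight. -/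

namespace IsWeightFunction

variable {ω : ℝ → ℝ}

/-- Since $r\le 2\max(s,t)$, monotonicity and one doubling suffice. This replaces subadditivity,
which is not assumed. -/
theorem add_le (hω : IsWeightFunction ω) :
    ∃ L : ℝ, 1 ≤ L ∧ ∀ r s t : ℝ, 0 ≤ r → 0 ≤ s → 0 ≤ t → r ≤ s + t →
      ω r ≤ L * (ω s + ω t + 1) := by
  obtain ⟨L, hL, h⟩ := hω.alpha
  refine ⟨L, hL, fun r s t hr hs ht hrst => ?_⟩
  have hs' := hω.nonneg s hs
  have ht' := hω.nonneg t ht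
  rcases le_total s t with hst | hst
  · have h1 : ω r ≤ ω (2 * t) := hω.monotoneOn hr (by simpa using ht) (by linarith)
    nlinarith [h t ht]
  · have h1 : ω r ≤ ω (2 * s) := hω.monotoneOn hr (by simpa using hs) (by linarith)
    nlinarith [h s hs]

/-- Iterate $(\alpha)$ $n$ times, with $A<2^n$. The second alternative saves a sign hypothesis:
nothing is known of `ω` at negative arguments. -/
theorem mul_le (hω : IsWeightFunction ω) (A : ℝ) :
    ∃ L : ℝ, 1 ≤ L ∧ ∀ t : ℝ, 0 ≤ t → ω (A * t) ≤ L * (ω t + 1) ∨ A < 0 := by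
  obtain ⟨L, hL, h⟩ := hω.alpha
  have key : ∀ n : ℕ, ∃ M : ℝ, 1 ≤ M ∧ ∀ t : ℝ, 0 ≤ t → ω (2 ^ n * t) ≤ M * (ω t + 1) := by
    intro n
    induction n with
    | zero => exact ⟨1, le_rfl, fun t _ => by simp⟩
    | succ n ih =>
      obtain ⟨M, hM, hMt⟩ := ih
      refine ⟨L * (M + 1), by nlinarith, fun t ht => ?_⟩
      have h1 := h (2 ^ n * t) (by positivity)
      have h2 := hMt t ht
      have h3 := hω.nonneg t ht
      rw [pow_succ, mul_comm _ (2 : ℝ), mul_assoc]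
      calc ω (2 * (2 ^ n * t)) ≤ L * (ω (2 ^ n * t) + 1) := h1
        _ ≤ L * (M * (ω t + 1) + (ω t + 1)) := by gcongr; linarith
        _ = L * (M + 1) * (ω t + 1) := by ring
  obtain ⟨n, hn⟩ := pow_unbounded_of_one_lt A (one_lt_two : (1 : ℝ) < 2)
  obtain ⟨M, hM, hMt⟩ := key n
  refine ⟨M, hM, fun t ht => ?_⟩
  by_cases hA : A < 0
  · exact Or.inr hA
  · left
    push Not at hA
    exact (hω.monotoneOn (by simpa using mul_nonneg hA ht)
      (by simpa using (by positivity : (0 : ℝ) ≤ 2 ^ n * t)) (by gcongr)).trans (hMt t ht)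

theorem pow_le (hω : IsWeightFunction ω) (N : ℕ) :
    ∃ κ : ℝ, 0 < κ ∧ ∃ C : ℝ, 0 < C ∧ ∀ t : ℝ, 0 ≤ t → (1 + t) ^ N ≤ C * Real.exp (κ * ω t) := by
  obtain ⟨a, b, hb, h⟩ := hω.gamma
  -- `N + 1` in place of `N` keeps `κ` positive when `N = 0`.
  refine ⟨(N + 1) / b, by positivity, Real.exp (-(N + 1) / b * a), by positivity, fun t ht => ?_⟩
  have h1 : (1 + t) ^ N ≤ (1 + t) ^ (N + 1) := pow_le_pow_right₀ (by linarith) (Nat.le_succ N)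
  refine h1.trans ?_
  rw [← Real.exp_add, ← Real.exp_log (show 0 < 1 + t by linarith), ← Real.exp_nat_mul]
  apply Real.exp_le_exp.2
  have h2 := h t ht
  push_cast
  rw [show -((N : ℝ) + 1) / b * a + (N + 1) / b * ω t = (N + 1) * ((ω t - a) / b) by
    field_simp; ring]
  gcongr
  rw [le_div_iff₀ hb]
  linarith

/-- By monotonicity $\omega(t)/t=\int_t^\infty\omega(t)s^{-2}ds\le\int_t^\infty\omega(s)s^{-2}ds$,
and the tail tends to $0$. Non-quasianalyticity enters the proof only here. -/
theorem le_linear (hω : IsWeightFunction ω) {ε : ℝ} (hε : 0 < ε) :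
    ∃ C : ℝ, 0 ≤ C ∧ ∀ t : ℝ, 0 ≤ t → ω t ≤ ε * t + C := by
  have hint := hω.beta
  have htail : Filter.Tendsto (fun t : ℝ => ∫ s in Set.Ici t, ω s / s ^ 2) Filter.atTop
      (nhds (∫ s in (⋂ t : ℝ, Set.Ici t), ω s / s ^ 2)) :=
    tendsto_setIntegral_of_antitone (fun t => measurableSet_Ici)
      (fun s t hst => Set.Ici_subset_Ici.2 hst) ⟨1, hint⟩
  have hempty : (⋂ t : ℝ, Set.Ici t) = ∅ := by
    ext x
    simp only [Set.mem_iInter, Set.mem_Ici, Set.mem_empty_iff_false, iff_false, not_forall]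
    exact ⟨x + 1, by linarith⟩
  rw [hempty, setIntegral_empty] at htail
  have hev := (htail.eventually (gt_mem_nhds hε)).and (Filter.eventually_ge_atTop (1 : ℝ))
  obtain ⟨T, hT⟩ := Filter.eventually_atTop.1 hev
  have hbound : ∀ t, T ≤ t → ω t ≤ ε * t := by
    intro t ht
    obtain ⟨h1, h2⟩ := hT t ht
    have ht0 : 0 < t := by linarith
    have h3 : ∫ s in Set.Ici t, ω t * (s ^ 2)⁻¹ = ω t / t := by
      rw [integral_const_mul, integral_Ici_eq_integral_Ioi]
      have := integral_Ioi_rpow_of_lt (a := -2) (by norm_num) ht0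
      have h4 : ∀ s : ℝ, (s ^ 2)⁻¹ = s ^ (-2 : ℝ) ∨ s < 0 := by
        intro s
        by_cases hs : s < 0
        · exact Or.inr hs
        · left
          rw [Real.rpow_neg (by linarith)]
          norm_num
      rw [setIntegral_congr_fun (g := fun s => s ^ (-2 : ℝ)) measurableSet_Ioi
        (fun s hs => (h4 s).resolve_right (by have : t < s := hs; linarith)), this]
      norm_num
      rw [Real.rpow_neg_one]
      rfl
    have hint' : IntegrableOn (fun s : ℝ => (s ^ 2)⁻¹) (Set.Ici t) := by
      rw [integrableOn_Ici_iff_integrableOn_Ioi]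
      refine (integrableOn_Ioi_rpow_of_lt (a := -2) (by norm_num) ht0).congr_fun ?_
        measurableSet_Ioi
      intro s hs
      have : 0 < s := ht0.trans hs
      simp only
      rw [Real.rpow_neg this.le]
      norm_num
    have h5 : ∫ s in Set.Ici t, ω t * (s ^ 2)⁻¹ ≤ ∫ s in Set.Ici t, ω s / s ^ 2 := by
      refine setIntegral_mono_on (hint'.const_mul _)
        (hint.mono_set (Set.Ici_subset_Ici.2 h2)) measurableSet_Ici ?_
      intro s hs
      have hs' : t ≤ s := hs
      rw [div_eq_mul_inv]
      gcongr
      exact hω.monotoneOn ht0.le (ht0.le.trans hs') hs'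
    have h6 : ω t / t ≤ ε := by linarith
    rwa [div_le_iff₀ ht0] at h6
  have hT0 : 0 < T := by linarith [(hT T le_rfl).2]
  refine ⟨ω T, hω.nonneg T hT0.le, fun t ht => ?_⟩
  rcases le_total T t with h | h
  · have := hbound t h
    linarith [hω.nonneg T hT0.le]
  · have : ω t ≤ ω T := hω.monotoneOn ht hT0.le h
    nlinarith

/-- A supporting line of `φ(σ) = ω(e^σ)`, rewritten in the variable `t = e^τ`. -/
theorem exists_supporting_slope (hω : IsWeightFunction ω) (τ : ℝ) :
    ∃ s : ℝ, 0 ≤ s ∧ ∀ σ : ℝ, ω (Real.exp τ) + s * (σ - τ) ≤ ω (Real.exp σ) := by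
  have hconv := hω.delta
  have hmono : ∀ x y : ℝ, x ≤ y → ω (Real.exp x) ≤ ω (Real.exp y) := fun x y hxy =>
    hω.monotoneOn (Real.exp_pos x).le (Real.exp_pos y).le (Real.exp_le_exp.2 hxy)
  have hsl : ∀ x y : ℝ, x < τ → τ < y →
      (ω (Real.exp τ) - ω (Real.exp x)) / (τ - x) ≤ (ω (Real.exp y) - ω (Real.exp τ)) / (y - τ) :=
    fun x y hx hy => hconv.slope_mono_adjacent (Set.mem_univ x) (Set.mem_univ y) hx hy
  -- The slopes of the chords ending at `τ` from the left; their supremum is the left derivative of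
  -- $\varphi$ at `τ`.
  set S : Set ℝ := (fun x => (ω (Real.exp τ) - ω (Real.exp x)) / (τ - x)) '' Set.Iio τ with hS
  have hbdd : BddAbove S := by
    refine ⟨(ω (Real.exp (τ + 1)) - ω (Real.exp τ)) / (τ + 1 - τ), ?_⟩
    rintro _ ⟨x, hx, rfl⟩
    exact hsl x _ hx (by linarith)
  have hne : S.Nonempty := ⟨_, τ - 1, by simp, rfl⟩
  refine ⟨sSup S, ?_, fun σ => ?_⟩
  · refine le_trans ?_ (le_csSup hbdd ⟨τ - 1, by simp, rfl⟩)
    exact div_nonneg (by linarith [hmono (τ - 1) τ (by linarith)]) (by linarith)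
  · rcases lt_trichotomy σ τ with h | h | h
    · have := le_csSup hbdd ⟨σ, h, rfl⟩
      rw [div_le_iff₀ (by linarith)] at this
      linarith
    · subst h; simp
    · have : sSup S ≤ (ω (Real.exp σ) - ω (Real.exp τ)) / (σ - τ) := by
        refine csSup_le hne ?_
        rintro _ ⟨x, hx, rfl⟩
        exact hsl x σ hx h
      rw [le_div_iff₀ (by linarith)] at this
      linarith

end IsWeightFunction

/-! ### Calculus of the sequence $e^{\lambda\varphi^*(k/\lambda)}$. -/

theorem le_growth (ω : ℝ → ℝ) (lam : ℝ) (k : ℕ) {t : ℝ} (ht : 1 ≤ t) :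
    ENNReal.ofReal (t ^ k * Real.exp (-(lam * ω t))) ≤ growth ω lam k :=
  le_iSup (fun t : Set.Ici (1 : ℝ) => ENNReal.ofReal ((t : ℝ) ^ k * Real.exp (-(lam * ω t))))
    ⟨t, ht⟩

theorem one_le_growth (ω : ℝ → ℝ) (lam : ℝ) (k : ℕ) :
    1 ≤ ENNReal.ofReal (Real.exp (lam * ω 1)) * growth ω lam k := by
  calc (1 : ℝ≥0∞) = ENNReal.ofReal (Real.exp (lam * ω 1)) *
        ENNReal.ofReal (1 ^ k * Real.exp (-(lam * ω 1))) := by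
        rw [← ENNReal.ofReal_mul (by positivity), one_pow, one_mul, ← Real.exp_add]
        simp
    _ ≤ _ := by gcongr; exact le_growth ω lam k le_rfl

theorem growth_ne_zero (ω : ℝ → ℝ) (lam : ℝ) (k : ℕ) : growth ω lam k ≠ 0 := by
  intro h
  have := one_le_growth ω lam k
  simp [h] at this

/-- Test the right side at $\max(s,t)$: both powers increase, and
$\omega(\max(s,t))\le\omega(s)+\omega(t)$ because the maximum is one of the two and $\omega\ge0$. -/
theorem growth_mul_le {ω : ℝ → ℝ} (hω : IsWeightFunction ω) {lam : ℝ} (hlam : 0 ≤ lam)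
    (j k : ℕ) : growth ω lam j * growth ω lam k ≤ growth ω lam (j + k) := by
  simp only [growth, ENNReal.iSup_mul, ENNReal.mul_iSup]
  refine iSup_le fun t => iSup_le fun s => ?_
  obtain ⟨s, hs⟩ := s
  obtain ⟨t, ht⟩ := t
  simp only [Set.mem_Ici] at hs ht
  have hs' := hω.nonneg s (by linarith)
  have ht' := hω.nonneg t (by linarith)
  rw [← ENNReal.ofReal_mul (by positivity)]
  refine le_trans ?_ (le_growth ω lam (j + k) (t := max s t) (by simp [hs]))
  apply ENNReal.ofReal_le_ofReal
  have h1 : ω (max s t) ≤ ω s + ω t := by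
    rcases le_total s t with h | h
    · simp [max_eq_right h]; linarith
    · simp [max_eq_left h]; linarith
  calc s ^ j * Real.exp (-(lam * ω s)) * (t ^ k * Real.exp (-(lam * ω t)))
      = s ^ j * t ^ k * Real.exp (-(lam * (ω s + ω t))) := by
        rw [show -(lam * (ω s + ω t)) = -(lam * ω s) + -(lam * ω t) by ring, Real.exp_add]; ring
    _ ≤ (max s t) ^ j * (max s t) ^ k * Real.exp (-(lam * ω (max s t))) := by
        gcongr
        · exact le_max_left _ _
        · exact le_max_right _ _
    _ = _ := by rw [pow_add]

/-- Geometric factors and index shifts are paid for by enlarging the parameter: substitute $At$ for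
$t$, using $\omega(At)\le L(\omega(t)+1)$, and bound $t^N$ by $Ce^{\kappa\omega(t)}$. Hence
$\mu=\kappa+\lambda L$. -/
theorem growth_absorb {ω : ℝ → ℝ} (hω : IsWeightFunction ω) {A : ℝ} (hA : 1 ≤ A) (N : ℕ)
    {lam : ℝ} (hlam : 0 < lam) :
    ∃ mu : ℝ, lam ≤ mu ∧ ∃ C : ℝ, 0 < C ∧ ∀ k : ℕ,
      ENNReal.ofReal A ^ k * growth ω mu (k + N) ≤ ENNReal.ofReal C * growth ω lam k := by
  obtain ⟨L, hL, hLt⟩ := hω.mul_le A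
  obtain ⟨κ, hκ, C, hC, hCt⟩ := hω.pow_le N
  refine ⟨κ + lam * L, by nlinarith, C * Real.exp (lam * L), by positivity, fun k => ?_⟩
  simp only [growth, ENNReal.mul_iSup]
  refine iSup_le fun t => ?_
  obtain ⟨t, ht⟩ := t
  simp only [Set.mem_Ici] at ht
  have h0 : 0 ≤ t := by linarith
  have hAt : 1 ≤ A * t := by nlinarith
  refine le_trans ?_ (le_iSup _ (⟨A * t, hAt⟩ : Set.Ici (1 : ℝ)))
  rw [← ENNReal.ofReal_pow (by linarith), ← ENNReal.ofReal_mul (by positivity),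
    ← ENNReal.ofReal_mul (by positivity)]
  apply ENNReal.ofReal_le_ofReal
  have h1 := (hLt t h0).resolve_right (by linarith)
  have h2 : t ^ N ≤ C * Real.exp (κ * ω t) :=
    (pow_le_pow_left₀ h0 (by linarith) N).trans (hCt t h0)
  calc A ^ k * (t ^ (k + N) * Real.exp (-((κ + lam * L) * ω t)))
      = (A * t) ^ k * t ^ N * Real.exp (-((κ + lam * L) * ω t)) := by
        rw [pow_add, mul_pow]; ring
    _ ≤ (A * t) ^ k * (C * Real.exp (κ * ω t)) * Real.exp (-((κ + lam * L) * ω t)) := by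
        gcongr
    _ = C * ((A * t) ^ k * Real.exp (-(lam * L * ω t))) := by
        rw [show -((κ + lam * L) * ω t) = -(κ * ω t) + -(lam * L * ω t) by ring, Real.exp_add,
          Real.exp_neg (κ * ω t)]
        field_simp
    _ ≤ C * ((A * t) ^ k * Real.exp (lam * L + -(lam * ω (A * t)))) := by
        gcongr
        nlinarith
    _ = _ := by rw [Real.exp_add]; ring

/-- The parameter has to depend on `k`: for $\omega(t)=\log(1+t)$ the supremum is finite only if
$\lambda\ge k$. -/
theorem exists_growth_lt_top {ω : ℝ → ℝ} (hω : IsWeightFunction ω) (k : ℕ) :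
    ∃ lam : ℝ, 0 < lam ∧ growth ω lam k < ⊤ := by
  obtain ⟨κ, hκ, C, hC, hCt⟩ := hω.pow_le k
  refine ⟨κ, hκ, lt_of_le_of_lt (iSup_le fun t => ?_) (ENNReal.ofReal_lt_top (r := C))⟩
  obtain ⟨t, ht⟩ := t
  simp only [Set.mem_Ici] at ht
  apply ENNReal.ofReal_le_ofReal
  have h2 : t ^ k ≤ C * Real.exp (κ * ω t) :=
    (pow_le_pow_left₀ (by linarith) (by linarith) k).trans (hCt t (by linarith))
  rw [Real.exp_neg, ← div_eq_mul_inv, div_le_iff₀ (Real.exp_pos _)]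
  exact h2

/-- Test the supremum at $t=Bj$ with $B\ge Ae$. Sublinearity with $\varepsilon=1/(\lambda B)$ gives
$\lambda\omega(Bj)\le j+\lambda C$, and $(Bj)^je^{-j}\ge(Aj)^j\ge A^jj!$. The second summand of the
constant serves $j=0$, where $Bj\ge1$ fails. -/
theorem factorial_le_growth {ω : ℝ → ℝ} (hω : IsWeightFunction ω) {A lam : ℝ} (hA : 0 < A)
    (hlam : 0 < lam) :
    ∃ C : ℝ, 0 < C ∧ ∀ j : ℕ,
      ENNReal.ofReal (A ^ j * j.factorial) ≤ ENNReal.ofReal C * growth ω lam j := by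
  set B : ℝ := max 1 (A * Real.exp 1) with hB
  have hB1 : 1 ≤ B := le_max_left _ _
  have hBA : A * Real.exp 1 ≤ B := le_max_right _ _
  obtain ⟨C, hC, hCt⟩ := hω.le_linear (ε := 1 / (lam * B)) (by positivity)
  refine ⟨Real.exp (lam * C) + Real.exp (lam * ω 1), by positivity, fun j => ?_⟩
  rcases Nat.eq_zero_or_pos j with rfl | hj
  · have := one_le_growth ω lam 0
    simp only [pow_zero, Nat.factorial_zero, Nat.cast_one, mul_one, ENNReal.ofReal_one]
    refine this.trans ?_
    gcongr
    linarith [Real.exp_pos (lam * C)]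
  · have hj1 : (1 : ℝ) ≤ j := by exact_mod_cast hj
    have ht : 1 ≤ B * j := by nlinarith
    refine le_trans ?_ (mul_le_mul_right (le_growth ω lam j ht) _)
    rw [← ENNReal.ofReal_mul (by positivity)]
    apply ENNReal.ofReal_le_ofReal
    have h1 := hCt (B * j) (by linarith)
    have h2 : lam * ω (B * j) ≤ j + lam * C := by
      calc lam * ω (B * j) ≤ lam * (1 / (lam * B) * (B * j) + C) := by gcongr
        _ = j + lam * C := by field_simp
    have h3 : (j.factorial : ℝ) ≤ (j : ℝ) ^ j := by exact_mod_cast Nat.factorial_le_pow j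
    calc A ^ j * (j.factorial : ℝ) ≤ A ^ j * (j : ℝ) ^ j := by gcongr
      _ = Real.exp (lam * C) * ((A * Real.exp 1) ^ j * (j : ℝ) ^ j *
            Real.exp (-(j + lam * C))) := by
          rw [neg_add, Real.exp_add, mul_pow, Real.exp_neg (lam * C), Real.exp_neg,
            ← Real.exp_nat_mul, mul_one]
          field_simp
      _ ≤ Real.exp (lam * C) * (B ^ j * (j : ℝ) ^ j * Real.exp (-(lam * ω (B * j)))) := by
          gcongr
      _ = Real.exp (lam * C) * ((B * j) ^ j * Real.exp (-(lam * ω (B * j)))) := by rw [mul_pow]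
      _ ≤ _ := by
          gcongr
          linarith [Real.exp_pos (lam * ω 1)]

/-- Near-converse of `le_growth`. If $s$ is the slope of a supporting line of $\varphi$ at $\log t$,
then $r^{\lambda s}e^{-\lambda\omega(r)}$ is maximal at $r=t$. Rounding the exponent down to an
integer costs at most one factor `t`. -/
theorem exists_growth_le {ω : ℝ → ℝ} (hω : IsWeightFunction ω) {lam : ℝ} (hlam : 0 < lam)
    {t : ℝ} (ht : 1 ≤ t) :
    ∃ k : ℕ, growth ω lam k ≤ ENNReal.ofReal (t ^ (k + 1) * Real.exp (-(lam * ω t))) := by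
  have ht0 : 0 < t := by linarith
  obtain ⟨s, hs, hsup⟩ := hω.exists_supporting_slope (Real.log t)
  refine ⟨⌊lam * s⌋₊, iSup_le fun r => ENNReal.ofReal_le_ofReal ?_⟩
  obtain ⟨r, hr⟩ := r
  simp only [Set.mem_Ici] at hr
  have hr0 : 0 < r := by linarith
  have h1 := hsup (Real.log r)
  rw [Real.exp_log ht0, Real.exp_log hr0] at h1
  have h2 : (⌊lam * s⌋₊ : ℝ) ≤ lam * s := Nat.floor_le (by positivity)
  have h3 : lam * s ≤ ⌊lam * s⌋₊ + 1 := (Nat.lt_floor_add_one _).le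
  have hlr := Real.log_nonneg hr
  have hlt := Real.log_nonneg ht
  set k := ⌊lam * s⌋₊
  have e1 : r ^ k = Real.exp (k * Real.log r) := by
    rw [Real.exp_nat_mul, Real.exp_log hr0]
  have e2 : t ^ (k + 1) = Real.exp ((k + 1 : ℕ) * Real.log t) := by
    rw [Real.exp_nat_mul, Real.exp_log ht0]
  rw [e1, e2, ← Real.exp_add, ← Real.exp_add]
  apply Real.exp_le_exp.2
  push_cast
  nlinarith [mul_le_mul_of_nonneg_left h1 hlam.le, mul_le_mul_of_nonneg_right h2 hlr,
    mul_le_mul_of_nonneg_right h3 hlt]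

/-- The substitution $t=e^\tau$ in the supremum. The convention $e^{-\infty}=0$ becomes
$\infty^{-1}=0$ in $[0,\infty]$. -/
theorem youngFactor_eq (ω : ℝ → ℝ) {lam : ℝ} (hlam : 0 < lam) (k : ℕ) :
    youngFactor ω lam k = (growth ω lam k)⁻¹ := by
  rw [youngFactor, EReal.exp_neg]
  congr 1
  have hl : (0 : EReal) < lam := by exact_mod_cast hlam
  have key : ∀ t : ℝ, ENNReal.ofReal (Real.exp t ^ k * Real.exp (-(lam * ω (Real.exp t)))) =
      EReal.exp ((lam : EReal) * ((t * (k / lam) - ω (Real.exp t) : ℝ) : EReal)) := by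
    intro t
    rw [← EReal.coe_mul, EReal.exp_coe, ← Real.exp_nat_mul, ← Real.exp_add]
    congr 2
    field_simp
    ring
  apply le_antisymm
  · have h1 : (lam : EReal) * youngConj ω ((k : ℝ) / lam) ≤
        EReal.expOrderIso.symm (growth ω lam k) := by
      rw [mul_comm, ← EReal.le_div_iff_mul_le hl (EReal.coe_ne_top _)]
      refine iSup_le fun t => ?_
      rw [EReal.le_div_iff_mul_le hl (EReal.coe_ne_top _), mul_comm]
      rw [OrderIso.le_symm_apply]
      refine le_trans (le_of_eq ?_) (le_growth ω lam k (Real.one_le_exp t.2))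
      rw [key]
      rfl
    rw [OrderIso.le_symm_apply] at h1
    exact h1
  · refine iSup_le fun t => ?_
    obtain ⟨t, ht⟩ := t
    simp only [Set.mem_Ici] at ht
    have h2 := key (Real.log t)
    rw [Real.exp_log (by linarith)] at h2
    rw [h2]
    apply EReal.exp_monotone
    have h3 : ((Real.log t * (k / lam) - ω t : ℝ) : EReal) ≤ youngConj ω ((k : ℝ) / lam) := by
      have := le_iSup (fun t : Set.Ici (0 : ℝ) =>
        (((t : ℝ) * (k / lam) - ω (Real.exp t) : ℝ) : EReal)) ⟨Real.log t, Real.log_nonneg ht⟩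
      simp only [Real.exp_log (show 0 < t by linarith)] at this
      exact this
    gcongr

/-! ### Fourier inversion and the Gabor transform. -/

variable {d : ℕ}

local notation "𝔼" => EuclideanSpace ℝ (Fin d)

/-- The pairing `⟨x, ξ⟩ / 2π`, for which `fourierHat` is a vector Fourier integral. -/
noncomputable def hatPairing (d : ℕ) :
    EuclideanSpace ℝ (Fin d) →L[ℝ] EuclideanSpace ℝ (Fin d) →L[ℝ] ℝ :=
  (2 * Real.pi)⁻¹ • innerSL ℝ

theorem hatPairing_apply (x ξ : 𝔼) : hatPairing d x ξ = (2 * Real.pi)⁻¹ * inner ℝ x ξ := by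
  simp [hatPairing]
  rfl

theorem hatPairing_toLinearMap₁₂_apply (x ξ : 𝔼) :
    (hatPairing d).toLinearMap₁₂ x ξ = (2 * Real.pi)⁻¹ * inner ℝ x ξ := hatPairing_apply x ξ

/-- Each derivative of a `VectorFourier` integral brings a factor $2\pi\|L\|$, which this
normalisation makes harmless. Equality would fail for $d=0$. -/
theorem norm_hatPairing_le : 2 * Real.pi * ‖hatPairing d‖ ≤ 1 := by
  have h : ‖hatPairing d‖ ≤ (2 * Real.pi)⁻¹ := by
    refine ContinuousLinearMap.opNorm_le_bound₂ _ (by positivity) fun x y => ?_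
    rw [hatPairing_apply, norm_mul, Real.norm_of_nonneg (by positivity), mul_assoc]
    gcongr
    exact norm_inner_le_norm x y
  calc 2 * Real.pi * ‖hatPairing d‖ ≤ 2 * Real.pi * (2 * Real.pi)⁻¹ := by gcongr
    _ = 1 := by field_simp

theorem fourierHat_eq_vector (f : 𝔼 → ℂ) :
    fourierHat f =
      VectorFourier.fourierIntegral Real.fourierChar volume (hatPairing d).toLinearMap₁₂ f := by
  ext ξ
  simp only [fourierHat, VectorFourier.fourierIntegral]
  congr 1
  ext x
  rw [Circle.smul_def, Real.fourierChar_apply, smul_eq_mul, mul_comm]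
  congr 2
  simp only [hatPairing_toLinearMap₁₂_apply]
  push_cast
  field_simp

theorem fourierHat_eq_fourier (f : 𝔼 → ℂ) (ξ : 𝔼) :
    fourierHat f ξ = FourierTransform.fourier f ((2 * Real.pi)⁻¹ • ξ) := by
  rw [Real.fourier_eq, fourierHat]
  congr 1
  ext x
  rw [Circle.smul_def, Real.fourierChar_apply, smul_eq_mul, mul_comm, inner_smul_right]
  congr 2
  push_cast
  field_simp

theorem continuous_hatPairing :
    Continuous fun p : 𝔼 × 𝔼 => (hatPairing d).toLinearMap₁₂ p.1 p.2 := by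
  simp only [hatPairing_toLinearMap₁₂_apply]
  fun_prop

theorem continuous_fourierHat {f : 𝔼 → ℂ} (hf : Integrable f) : Continuous (fourierHat f) := by
  rw [fourierHat_eq_vector]
  exact VectorFourier.fourierIntegral_continuous Real.continuous_fourierChar
    continuous_hatPairing hf

theorem norm_exp_neg_I_mul (r : ℝ) : ‖Complex.exp (-Complex.I * (r : ℂ))‖ = 1 := by
  rw [Complex.norm_exp]
  simp

theorem enorm_fourierHat_le (f : 𝔼 → ℂ) (ξ : 𝔼) : ‖fourierHat f ξ‖ₑ ≤ ∫⁻ x, ‖f x‖ₑ := by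
  refine (enorm_integral_le_lintegral_enorm _).trans (le_of_eq ?_)
  congr 1
  ext x
  rw [enorm_mul, ← ofReal_norm (Complex.exp _), norm_exp_neg_I_mul]
  simp

theorem integral_fourierHat_mul {f g : 𝔼 → ℂ} (hf : Integrable f) (hg : Integrable g) :
    ∫ ξ, fourierHat f ξ * g ξ = ∫ x, f x * fourierHat g x := by
  have h := VectorFourier.integral_fourierIntegral_smul_eq_flip (μ := (volume : Measure 𝔼))
    (ν := (volume : Measure 𝔼)) (L := (hatPairing d).toLinearMap₁₂)
    Real.continuous_fourierChar continuous_hatPairing hf hg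
  have hflip : (hatPairing d).toLinearMap₁₂.flip = (hatPairing d).toLinearMap₁₂ := by
    ext x y
    rw [LinearMap.flip_apply, hatPairing_toLinearMap₁₂_apply, hatPairing_toLinearMap₁₂_apply,
      real_inner_comm]
  rw [hflip, ← fourierHat_eq_vector, ← fourierHat_eq_vector] at h
  simpa [smul_eq_mul] using h

theorem two_pi_pow_ne_zero : ((2 * Real.pi : ℝ) : ℂ) ^ d ≠ 0 := by
  apply pow_ne_zero
  exact_mod_cast (by positivity : (2 * Real.pi : ℝ) ≠ 0)

theorem integrable_fourier_of_fourierHat {f : 𝔼 → ℂ} (hf' : Integrable (fourierHat f)) :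
    Integrable (FourierTransform.fourier f : 𝔼 → ℂ) := by
  rw [← integrable_comp_smul_iff volume _ (inv_ne_zero Real.two_pi_pos.ne')]
  simpa only [← fourierHat_eq_fourier] using hf'

theorem fourierHat_fourierHat {f : 𝔼 → ℂ} (hc : Continuous f) (hf : Integrable f)
    (hf' : Integrable (fourierHat f)) (x : 𝔼) :
    fourierHat (fourierHat f) x = ((2 * Real.pi : ℝ) : ℂ) ^ d * f (-x) := by
  have h1 := congrFun (hc.fourierInv_fourier_eq hf (integrable_fourier_of_fourierHat hf')) (-x)
  rw [← h1, Real.fourierInv_eq, fourierHat]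
  have h2 := Measure.integral_comp_smul (volume : Measure 𝔼)
    (fun v => Real.fourierChar (inner ℝ v (-x)) • (FourierTransform.fourier f : 𝔼 → ℂ) v)
    (2 * Real.pi)⁻¹
  have h3 : |(((2 * Real.pi)⁻¹ : ℝ) ^ Module.finrank ℝ 𝔼)⁻¹| = (2 * Real.pi) ^ d := by
    rw [finrank_euclideanSpace_fin, inv_pow, inv_inv, abs_of_nonneg (by positivity)]
  rw [h3, Complex.real_smul] at h2
  rw [← Complex.ofReal_pow, ← h2]
  congr 1
  ext v
  rw [fourierHat_eq_fourier, Circle.smul_def, Real.fourierChar_apply, smul_eq_mul, mul_comm]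
  congr 2
  rw [inner_smul_left, inner_neg_right]
  simp only [map_inv₀]
  push_cast
  simp
  field_simp

/-- The Gabor transform is a Fourier transform. -/
theorem gaborTransform_eq_fourierHat (ψ u : 𝔼 → ℂ) (x ξ : 𝔼) :
    gaborTransform ψ u x ξ = fourierHat (fun y => u y * conj (ψ (y - x))) ξ := rfl

/-- The fundamental identity of time-frequency analysis. -/
theorem gaborTransform_eq_gaborTransform_hat {ψ u : 𝔼 → ℂ} (hu : Integrable u)
    (hψc : Continuous ψ) (hψ : Integrable ψ) (hψ' : Integrable (fourierHat ψ)) (x ξ : 𝔼) :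
    gaborTransform (fourierHat ψ) (fourierHat u) ξ (-x) =
      ((2 * Real.pi : ℝ) : ℂ) ^ d * Complex.exp (Complex.I * ((inner ℝ x ξ : ℝ) : ℂ)) *
        gaborTransform ψ u x ξ := by
  -- `h` is chosen so that the left side is $\int\hat u\,h$. The multiplication formula moves the
  -- hat onto `h`, and inversion for `ψ` computes $\hat h$.
  set h : 𝔼 → ℂ := fun η => conj (fourierHat ψ (η - ξ)) *
    Complex.exp (-Complex.I * ((inner ℝ η (-x) : ℝ) : ℂ)) with hh
  have hint : Integrable h := by
    have h1 : Integrable fun η => conj (fourierHat ψ (η - ξ)) := by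
      have := (hψ'.comp_sub_right ξ)
      exact (Complex.conjLIE.toContinuousLinearEquiv.toContinuousLinearMap.restrictScalars
        ℝ).integrable_comp this
    refine h1.mul_bdd (c := 1) ?_ ?_
    · exact (by fun_prop : Continuous fun η : 𝔼 =>
        Complex.exp (-Complex.I * ((inner ℝ η (-x) : ℝ) : ℂ))).aestronglyMeasurable
    · exact Filter.Eventually.of_forall fun η => (norm_exp_neg_I_mul _).le
  have key : ∀ y, fourierHat h y = ((2 * Real.pi : ℝ) : ℂ) ^ d *
      Complex.exp (Complex.I * ((inner ℝ (x - y) ξ : ℝ) : ℂ)) * conj (ψ (y - x)) := by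
    intro y
    have h1 : fourierHat h y = conj (∫ η, fourierHat ψ (η - ξ) *
        Complex.exp (-Complex.I * ((inner ℝ η (x - y) : ℝ) : ℂ))) := by
      rw [← integral_conj, fourierHat]
      congr 1
      ext η
      simp only [hh, map_mul, ← Complex.exp_conj, map_neg, Complex.conj_I, Complex.conj_ofReal]
      rw [mul_assoc, ← Complex.exp_add]
      congr 2
      rw [inner_sub_right, inner_neg_right]
      push_cast
      ring
    have h2 : ∫ η, fourierHat ψ (η - ξ) *
        Complex.exp (-Complex.I * ((inner ℝ η (x - y) : ℝ) : ℂ)) =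
        Complex.exp (-Complex.I * ((inner ℝ ξ (x - y) : ℝ) : ℂ)) *
          fourierHat (fourierHat ψ) (x - y) := by
      rw [← integral_add_right_eq_self _ ξ]
      rw [fourierHat, ← integral_const_mul]
      congr 1
      ext η
      rw [add_sub_cancel_right, inner_add_left]
      push_cast
      rw [mul_add, Complex.exp_add]
      ring
    rw [h1, h2, fourierHat_fourierHat hψc hψ hψ', neg_sub]
    simp only [map_mul, ← Complex.exp_conj, map_neg, Complex.conj_I, Complex.conj_ofReal, map_pow,
      neg_neg]
    rw [real_inner_comm]
    ring
  have hL : gaborTransform (fourierHat ψ) (fourierHat u) ξ (-x) = ∫ η, fourierHat u η * h η := by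
    simp only [gaborTransform, hh, mul_assoc]
  rw [hL, integral_fourierHat_mul hu hint, gaborTransform, ← integral_const_mul]
  congr 1
  ext y
  rw [key y, inner_sub_left]
  push_cast
  rw [mul_sub, sub_eq_add_neg, Complex.exp_add]
  ring_nf

theorem norm_gaborTransform_hat {ψ u : 𝔼 → ℂ} (hu : Integrable u)
    (hψc : Continuous ψ) (hψ : Integrable ψ) (hψ' : Integrable (fourierHat ψ)) (x ξ : 𝔼) :
    ‖gaborTransform (fourierHat ψ) (fourierHat u) ξ (-x)‖ₑ =
      ENNReal.ofReal ((2 * Real.pi) ^ d) * ‖gaborTransform ψ u x ξ‖ₑ := by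
  rw [gaborTransform_eq_gaborTransform_hat hu hψc hψ hψ', enorm_mul, enorm_mul]
  have h1 : ‖Complex.exp (Complex.I * ((inner ℝ x ξ : ℝ) : ℂ))‖ₑ = 1 := by
    rw [← ofReal_norm, Complex.norm_exp]
    simp
  rw [h1, mul_one, ← Complex.ofReal_pow, ← ofReal_norm, Complex.norm_real,
    Real.norm_of_nonneg (by positivity)]

/-- The derivatives of a function are bounded by the moments of its Fourier transform. -/
theorem norm_iteratedFDeriv_le_lintegral_fourierHat {w : 𝔼 → ℂ} (hc : Continuous w)
    (hw : Integrable w) (hw' : ∀ k : ℕ, Integrable fun ξ => ‖ξ‖ ^ k * ‖fourierHat w ξ‖)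
    (k : ℕ) (y : 𝔼) :
    ‖iteratedFDeriv ℝ k w y‖ ≤ ((2 * Real.pi) ^ d)⁻¹ * ∫ ξ, ‖ξ‖ ^ k * ‖fourierHat w ξ‖ := by
  have hcont := continuous_fourierHat hw
  have hint : Integrable (fourierHat w) := by
    rw [← integrable_norm_iff hcont.aestronglyMeasurable]
    simpa using hw' 0
  -- By inversion `w` is a reflected double transform, so its derivatives are those of a Fourier
  -- integral of $\hat w$.
  have hrep : w = fun y => (((2 * Real.pi) ^ d)⁻¹ : ℝ) •
      ((fourierHat (fourierHat w)) ∘ (LinearIsometryEquiv.neg ℝ (E := 𝔼))) y := by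
    ext y
    simp only [Function.comp_apply, LinearIsometryEquiv.coe_neg]
    rw [fourierHat_fourierHat hc hw hint, neg_neg, Complex.real_smul]
    push_cast
    rw [← mul_assoc, inv_mul_cancel₀, one_mul]
    simp
  have hL : iteratedFDeriv ℝ k (fourierHat (fourierHat w)) =
      VectorFourier.fourierIntegral Real.fourierChar volume (hatPairing d).toLinearMap₁₂
        (fun v => VectorFourier.fourierPowSMulRight (hatPairing d) (fourierHat w) v k) := by
    rw [fourierHat_eq_vector (fourierHat w)]
    exact VectorFourier.iteratedFDeriv_fourierIntegral (N := ⊤) _ (fun n _ => hw' n)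
      hcont.aestronglyMeasurable le_top
  have hsm : ContDiff ℝ k (fourierHat (fourierHat w)) := by
    rw [fourierHat_eq_vector (fourierHat w)]
    exact VectorFourier.contDiff_fourierIntegral _ (N := k) (fun n _ => hw' n)
  conv_lhs => rw [hrep]
  have hsm' : ContDiff ℝ k ((fourierHat (fourierHat w)) ∘ (LinearIsometryEquiv.neg ℝ (E := 𝔼))) :=
    hsm.comp (LinearIsometryEquiv.contDiff _)
  rw [iteratedFDeriv_const_smul_apply' hsm'.contDiffAt, norm_smul,
    LinearIsometryEquiv.norm_iteratedFDeriv_comp_right, Real.norm_of_nonneg (by positivity)]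
  gcongr
  rw [hL]
  refine (VectorFourier.norm_fourierIntegral_le_integral_norm _ _ _ _ _).trans ?_
  refine integral_mono_of_nonneg (Filter.Eventually.of_forall fun _ => norm_nonneg _) (hw' k)
    (Filter.Eventually.of_forall fun ξ => ?_)
  refine (VectorFourier.norm_fourierPowSMulRight_le _ _ _ _).trans ?_
  calc (2 * Real.pi * ‖hatPairing d‖) ^ k * ‖ξ‖ ^ k * ‖fourierHat w ξ‖
      ≤ 1 ^ k * ‖ξ‖ ^ k * ‖fourierHat w ξ‖ := by
        gcongr
        exact norm_hatPairing_le
    _ = _ := by rw [one_pow, one_mul]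

/-! ### Weighted classes and the decay of the Gabor transform. -/

/-- Integrability of `e^{λω} f` for all `λ > 0`. -/
def WeightedL1 (ω : ℝ → ℝ) (f : EuclideanSpace ℝ (Fin d) → ℂ) : Prop :=
  ∀ lam : ℝ, 0 < lam → ∫⁻ x, ENNReal.ofReal (Real.exp (lam * ω ‖x‖)) * ‖f x‖ₑ < ⊤

/-- Boundedness of `e^{λω} f` for all `λ > 0`. -/
def WeightedBdd (ω : ℝ → ℝ) (f : EuclideanSpace ℝ (Fin d) → ℂ) : Prop :=
  ∀ lam : ℝ, 0 < lam → ∃ C : ℝ, ∀ x, Real.exp (lam * ω ‖x‖) * ‖f x‖ ≤ C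

theorem IsWeightFunction.continuous_norm {ω : ℝ → ℝ} (hω : IsWeightFunction ω) :
    Continuous fun x : 𝔼 => ω ‖x‖ :=
  hω.continuousOn.comp_continuous _root_.continuous_norm fun x => norm_nonneg x

/-- By $(\gamma)$, $e^{\kappa\omega}$ dominates $(1+|x|)^{d+1}$. As $\lambda$ is arbitrary in all
conditions, a spare `κ` pays for each passage between sup and integral norms. -/
theorem IsWeightFunction.exists_integrable_exp {ω : ℝ → ℝ} (hω : IsWeightFunction ω) :
    ∃ κ : ℝ, 0 < κ ∧
      Integrable fun x : 𝔼 => Real.exp (-(κ * ω ‖x‖)) := by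
  obtain ⟨κ, hκ, C, hC, h⟩ := hω.pow_le (d + 1)
  refine ⟨κ, hκ, ?_⟩
  have h1 : Integrable fun x : 𝔼 => (1 + ‖x‖) ^ (-((d + 1 : ℕ) : ℝ)) :=
    integrable_one_add_norm (by simp)
  refine (h1.const_mul C).mono' ?_ (Filter.Eventually.of_forall fun x => ?_)
  · have := hω.continuous_norm (d := d)
    exact (Real.continuous_exp.comp (continuous_const.mul this).neg).aestronglyMeasurable
  · have h2 := h ‖x‖ (norm_nonneg x)
    have h3 : 0 < 1 + ‖x‖ := by positivity
    rw [Real.norm_of_nonneg (by positivity), Real.rpow_neg h3.le, Real.rpow_natCast, Real.exp_neg,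
      ← div_eq_mul_inv, le_div_iff₀ (by positivity), inv_mul_le_iff₀ (Real.exp_pos _), mul_comm]
    exact h2

theorem WeightedBdd.exists_le {ω : ℝ → ℝ} {f : 𝔼 → ℂ} (hf : WeightedBdd ω f) {lam : ℝ}
    (hlam : 0 < lam) : ∃ C : ℝ, 0 < C ∧ ∀ x, ‖f x‖ ≤ C * Real.exp (-(lam * ω ‖x‖)) := by
  obtain ⟨C, hC⟩ := hf lam hlam
  refine ⟨max C 1, by positivity, fun x => ?_⟩
  rw [Real.exp_neg, ← div_eq_mul_inv, le_div_iff₀ (Real.exp_pos _), mul_comm]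
  exact (hC x).trans (le_max_left _ _)

theorem WeightedBdd.integrable {ω : ℝ → ℝ} (hω : IsWeightFunction ω) {f : 𝔼 → ℂ}
    (hf : WeightedBdd ω f) (hc : Continuous f) : Integrable f := by
  obtain ⟨κ, hκ, hint⟩ := hω.exists_integrable_exp (d := d)
  obtain ⟨C, -, hC⟩ := hf.exists_le hκ
  exact (hint.const_mul C).mono' hc.aestronglyMeasurable (Filter.Eventually.of_forall hC)

theorem WeightedBdd.weightedL1 {ω : ℝ → ℝ} (hω : IsWeightFunction ω) {f : 𝔼 → ℂ}
    (hf : WeightedBdd ω f) : WeightedL1 ω f := by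
  obtain ⟨κ, hκ, hint⟩ := hω.exists_integrable_exp (d := d)
  intro lam hlam
  obtain ⟨C, hC0, hC⟩ := hf.exists_le (show 0 < lam + κ by positivity)
  refine lt_of_le_of_lt (lintegral_mono (fun x => ?_)) (hint.const_mul C).lintegral_lt_top
  rw [← ofReal_norm, ← ENNReal.ofReal_mul (by positivity)]
  apply ENNReal.ofReal_le_ofReal
  calc Real.exp (lam * ω ‖x‖) * ‖f x‖
      ≤ Real.exp (lam * ω ‖x‖) * (C * Real.exp (-((lam + κ) * ω ‖x‖))) := by gcongr; exact hC x
    _ = C * (Real.exp (lam * ω ‖x‖) * Real.exp (-((lam + κ) * ω ‖x‖))) := by ring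
    _ = _ := by rw [← Real.exp_add]; ring_nf

/-- The subadditivity of the weight, in exponential form. -/
theorem IsWeightFunction.exists_exp_le (hω : IsWeightFunction ω) :
    ∃ L : ℝ, 1 ≤ L ∧ ∀ lam : ℝ, 0 < lam → ∀ r s t : ℝ, 0 ≤ r → 0 ≤ s → 0 ≤ t → r ≤ s + t →
      Real.exp (lam * ω r) ≤
        Real.exp (lam * L) * Real.exp (lam * L * ω s) * Real.exp (lam * L * ω t) := by
  obtain ⟨L, hL, h⟩ := hω.add_le
  refine ⟨L, hL, fun lam hlam r s t hr hs ht hrst => ?_⟩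
  rw [← Real.exp_add, ← Real.exp_add]
  apply Real.exp_le_exp.2
  have := mul_le_mul_of_nonneg_left (h r s t hr hs ht hrst) hlam.le
  linarith

/-- From $|x|\le|y|+|y-x|$ the weight at `x` splits into one absorbed by `f` at `y` and one absorbed
by the window at `y - x`. -/
theorem exists_gaborTransform_le {ω : ℝ → ℝ} (hω : IsWeightFunction ω) {ψ f : 𝔼 → ℂ}
    (hf : WeightedL1 ω f) (hψ : WeightedBdd ω ψ) {lam : ℝ} (hlam : 0 < lam) :
    ∃ C : ℝ, 0 < C ∧ ∀ x ξ, Real.exp (lam * ω ‖x‖) * ‖gaborTransform ψ f x ξ‖ ≤ C := by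
  obtain ⟨L, hL, h⟩ := hω.exists_exp_le
  obtain ⟨C, hC0, hC⟩ := hψ.exists_le (show 0 < lam * L by positivity)
  have hI := hf (lam * L) (by positivity)
  set I := ∫⁻ x, ENNReal.ofReal (Real.exp (lam * L * ω ‖x‖)) * ‖f x‖ₑ with hIdef
  refine ⟨Real.exp (lam * L) * C * I.toReal + 1, by positivity, fun x ξ => ?_⟩
  have key : ENNReal.ofReal (Real.exp (lam * ω ‖x‖)) * ‖gaborTransform ψ f x ξ‖ₑ ≤
      ENNReal.ofReal (Real.exp (lam * L) * C) * I := by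
    calc ENNReal.ofReal (Real.exp (lam * ω ‖x‖)) * ‖gaborTransform ψ f x ξ‖ₑ
        ≤ ENNReal.ofReal (Real.exp (lam * ω ‖x‖)) * ∫⁻ y, ‖f y * conj (ψ (y - x))‖ₑ := by
          gcongr
          exact enorm_fourierHat_le _ _
      _ = ∫⁻ y, ENNReal.ofReal (Real.exp (lam * ω ‖x‖)) * ‖f y * conj (ψ (y - x))‖ₑ := by
          rw [lintegral_const_mul' _ _ ENNReal.ofReal_ne_top]
      _ ≤ ∫⁻ y, ENNReal.ofReal (Real.exp (lam * L) * C) *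
            (ENNReal.ofReal (Real.exp (lam * L * ω ‖y‖)) * ‖f y‖ₑ) := by
          refine lintegral_mono fun y => ?_
          simp only [← ofReal_norm]
          rw [← ENNReal.ofReal_mul (by positivity), ← ENNReal.ofReal_mul (by positivity),
            ← ENNReal.ofReal_mul (by positivity)]
          apply ENNReal.ofReal_le_ofReal
          rw [norm_mul, RCLike.norm_conj]
          have h1 := h lam hlam ‖x‖ ‖y‖ ‖y - x‖ (norm_nonneg _) (norm_nonneg _) (norm_nonneg _)
            (by simpa [norm_sub_rev] using norm_le_norm_add_norm_sub' x y)
          calc Real.exp (lam * ω ‖x‖) * (‖f y‖ * ‖ψ (y - x)‖)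
              ≤ (Real.exp (lam * L) * Real.exp (lam * L * ω ‖y‖) *
                  Real.exp (lam * L * ω ‖y - x‖)) *
                  (‖f y‖ * (C * Real.exp (-(lam * L * ω ‖y - x‖)))) := by
                gcongr
                exact hC _
            _ = _ := by
                rw [Real.exp_neg]
                field_simp
      _ = _ := by rw [lintegral_const_mul' _ _ ENNReal.ofReal_ne_top]
  have h2 : Real.exp (lam * ω ‖x‖) * ‖gaborTransform ψ f x ξ‖ =
      (ENNReal.ofReal (Real.exp (lam * ω ‖x‖)) * ‖gaborTransform ψ f x ξ‖ₑ).toReal := by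
    rw [ENNReal.toReal_mul, ENNReal.toReal_ofReal (by positivity), toReal_enorm]
  have h3 := ENNReal.toReal_mono (ENNReal.mul_ne_top ENNReal.ofReal_ne_top hI.ne) key
  rw [← h2, ENNReal.toReal_mul, ENNReal.toReal_ofReal (by positivity)] at h3
  linarith

/-- Decay of the Gabor transform in both variables. -/
theorem exists_gaborTransform_le_exp_mul_exp {ω : ℝ → ℝ} (hω : IsWeightFunction ω) {ψ u : 𝔼 → ℂ}
    (hu : Integrable u) (hu1 : WeightedL1 ω u) (hu2 : WeightedL1 ω (fourierHat u))
    (hψc : Continuous ψ) (hψ1 : WeightedBdd ω ψ) (hψ2 : WeightedBdd ω (fourierHat ψ))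
    {lam : ℝ} (hlam : 0 < lam) :
    ∃ C : ℝ, 0 < C ∧ ∀ x ξ, ‖gaborTransform ψ u x ξ‖ ≤
      C * Real.exp (-(lam * ω ‖x‖)) * Real.exp (-(lam * ω ‖ξ‖)) := by
  have hψi := hψ1.integrable hω hψc
  have hψi' := hψ2.integrable hω (continuous_fourierHat hψi)
  -- Decay with $2\lambda$ in each variable separately, so that the geometric mean has $\lambda$ in
  -- both.
  obtain ⟨C₁, hC₁, h₁⟩ := exists_gaborTransform_le hω hu1 hψ1 (show 0 < 2 * lam by positivity)
  obtain ⟨C₂, hC₂, h₂⟩ := exists_gaborTransform_le hω hu2 hψ2 (show 0 < 2 * lam by positivity)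
  set c : ℝ := (2 * Real.pi) ^ d with hc
  have hc0 : 0 < c := by positivity
  refine ⟨C₁ + C₂ / c, by positivity, fun x ξ => ?_⟩
  have h3 := h₁ x ξ
  have h4 := h₂ ξ (-x)
  have h5 : ‖gaborTransform (fourierHat ψ) (fourierHat u) ξ (-x)‖ =
      c * ‖gaborTransform ψ u x ξ‖ := by
    have := congrArg ENNReal.toReal (norm_gaborTransform_hat hu hψc hψi hψi' x ξ)
    rwa [ENNReal.toReal_mul, ENNReal.toReal_ofReal (by positivity), toReal_enorm,
      toReal_enorm] at this
  rw [h5] at h4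
  set V := ‖gaborTransform ψ u x ξ‖
  have hV : 0 ≤ V := norm_nonneg _
  have e1 : Real.exp (2 * lam * ω ‖x‖) = Real.exp (lam * ω ‖x‖) ^ 2 := by
    rw [← Real.exp_nat_mul]; push_cast; ring_nf
  have e2 : Real.exp (2 * lam * ω ‖ξ‖) = Real.exp (lam * ω ‖ξ‖) ^ 2 := by
    rw [← Real.exp_nat_mul]; push_cast; ring_nf
  rw [e1] at h3
  rw [e2] at h4
  rw [Real.exp_neg, Real.exp_neg]
  set a := Real.exp (lam * ω ‖x‖)
  set b := Real.exp (lam * ω ‖ξ‖)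
  have ha : 0 < a := Real.exp_pos _
  have hb : 0 < b := Real.exp_pos _
  have h6 : b ^ 2 * V ≤ C₂ / c := by
    rw [le_div_iff₀ hc0]; linarith
  rw [← div_eq_mul_inv, ← div_eq_mul_inv, le_div_iff₀ hb, le_div_iff₀ ha]
  -- $2ab\,V\le a^2V+b^2V$.
  nlinarith [mul_nonneg hV (sq_nonneg (a - b))]

/-! ### Gaussian window and estimates of derivatives. -/

theorem weightedBdd_gaussian {ω : ℝ → ℝ} (hω : IsWeightFunction ω) (c : ℂ) :
    WeightedBdd ω fun x : 𝔼 => c * Complex.exp (-(1 / 2 : ℂ) * (‖x‖ : ℂ) ^ 2) := by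
  intro lam hlam
  obtain ⟨B, hB, h⟩ := hω.le_linear (ε := 1 / lam) (by positivity)
  refine ⟨‖c‖ * Real.exp (lam * B + 1 / 2), fun x => ?_⟩
  have h1 := mul_le_mul_of_nonneg_left (h ‖x‖ (norm_nonneg x)) hlam.le
  have h2 : lam * (1 / lam * ‖x‖ + B) = ‖x‖ + lam * B := by field_simp
  have h3 : (-(1 / 2 : ℂ) * (‖x‖ : ℂ) ^ 2).re = -(1 / 2) * ‖x‖ ^ 2 := by
    rw [show (-(1 / 2 : ℂ) * (‖x‖ : ℂ) ^ 2) = ((-(1 / 2) * ‖x‖ ^ 2 : ℝ) : ℂ) by push_cast; ring,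
      Complex.ofReal_re]
  rw [norm_mul, Complex.norm_exp, h3, mul_left_comm, ← Real.exp_add]
  refine mul_le_mul_of_nonneg_left (Real.exp_le_exp.2 ?_) (norm_nonneg c)
  nlinarith [sq_nonneg (‖x‖ - 1)]

theorem fourierHat_gaussian (ξ : 𝔼) :
    fourierHat (fun x : 𝔼 => Complex.exp (-(1 / 2 : ℂ) * (‖x‖ : ℂ) ^ 2)) ξ =
      ((Real.pi : ℂ) / (1 / 2 : ℂ)) ^ ((d : ℂ) / 2) *
        Complex.exp (-(1 / 2 : ℂ) * (‖ξ‖ : ℂ) ^ 2) := by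
  rw [fourierHat_eq_fourier, fourier_gaussian_innerProductSpace (by norm_num),
    finrank_euclideanSpace_fin, norm_smul, Real.norm_of_nonneg (by positivity)]
  congr 2
  have : (Real.pi : ℂ) ≠ 0 := by exact_mod_cast Real.pi_ne_zero
  push_cast
  field_simp

/-- Derivatives of an analytic function grow at most geometrically against the factorial. -/
theorem AnalyticAt.exists_norm_iteratedFDeriv_le {E F : Type*} [NormedAddCommGroup E]
    [NormedSpace ℝ E] [NormedAddCommGroup F] [NormedSpace ℝ F] [CompleteSpace F] {h : E → F}
    {x : E} (hh : AnalyticAt ℝ h x) :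
    ∃ A C : ℝ, 0 < A ∧ 0 < C ∧ ∀ n : ℕ, ‖iteratedFDeriv ℝ n h x‖ ≤ C * (A ^ n * n.factorial) := by
  obtain ⟨p, r, hp⟩ := hh
  obtain ⟨s, hs0, hsr⟩ := ENNReal.lt_iff_exists_nnreal_btwn.1 hp.r_pos
  have hs0' : 0 < (s : ℝ) := by exact_mod_cast hs0
  obtain ⟨C, hC, hCn⟩ := p.norm_mul_pow_le_of_lt_radius (hsr.trans_le hp.r_le)
  refine ⟨(s : ℝ)⁻¹, C, by positivity, hC, fun n => ?_⟩
  have h1 : ‖p n‖ ≤ C * (s : ℝ)⁻¹ ^ n := by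
    rw [inv_pow, ← div_eq_mul_inv, le_div_iff₀ (by positivity)]
    exact hCn n
  refine ContinuousMultilinearMap.opNorm_le_bound (by positivity) fun v => ?_
  -- The factorial counts the permutations over which `p n` is symmetrised.
  rw [hp.iteratedFDeriv_eq_sum_of_completeSpace]
  refine (norm_sum_le _ _).trans ?_
  calc ∑ σ : Equiv.Perm (Fin n), ‖p n fun i => v (σ i)‖
      ≤ ∑ σ : Equiv.Perm (Fin n), C * (s : ℝ)⁻¹ ^ n * ∏ i, ‖v i‖ := by
        refine Finset.sum_le_sum fun σ _ => ?_
        refine ((p n).le_opNorm _).trans ?_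
        rw [Equiv.prod_comp σ fun i => ‖v i‖]
        gcongr
    _ = _ := by
        rw [Finset.sum_const, Finset.card_univ, Fintype.card_perm, Fintype.card_fin, nsmul_eq_mul]
        ring

theorem contDiff_exp_half_norm_sq (n : WithTop ℕ∞) :
    ContDiff ℝ n fun x : 𝔼 => Complex.exp ((1 / 2 : ℂ) * (‖x‖ : ℂ) ^ 2) := by
  have h1 : ContDiff ℝ n fun x : 𝔼 => ‖x‖ ^ 2 := contDiff_norm_sq ℝ
  have h2 : ContDiff ℝ n fun x : 𝔼 => ((‖x‖ ^ 2 : ℝ) : ℂ) :=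
    Complex.ofRealCLM.contDiff.comp h1
  have h3 : ContDiff ℝ n Complex.exp := Complex.contDiff_exp
  have := h3.comp (contDiff_const.mul h2 : ContDiff ℝ n fun x : 𝔼 =>
    (1 / 2 : ℂ) * ((‖x‖ ^ 2 : ℝ) : ℂ))
  simpa [Function.comp_def] using this

theorem le_exp_mul_growth {ω : ℝ → ℝ} (hω : IsWeightFunction ω) {lam : ℝ} (hlam : 0 < lam) (k : ℕ)
    {t : ℝ} (ht : 0 ≤ t) :
    ENNReal.ofReal (t ^ k * Real.exp (-(lam * ω t))) ≤
      ENNReal.ofReal (Real.exp (lam * ω 1)) * growth ω lam k := by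
  rcases le_total t 1 with h | h
  · refine le_trans ?_ (one_le_growth ω lam k)
    rw [← ENNReal.ofReal_one]
    apply ENNReal.ofReal_le_ofReal
    have h1 : t ^ k ≤ 1 := pow_le_one₀ ht h
    have h2 : Real.exp (-(lam * ω t)) ≤ 1 := by
      rw [Real.exp_le_one_iff]
      have := hω.nonneg t ht
      nlinarith
    calc t ^ k * Real.exp (-(lam * ω t)) ≤ 1 * 1 := by gcongr
      _ = 1 := one_mul 1
  · refine (le_growth ω lam k h).trans ?_
    have h1 : (1 : ℝ≥0∞) ≤ ENNReal.ofReal (Real.exp (lam * ω 1)) := by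
      rw [← ENNReal.ofReal_one]
      apply ENNReal.ofReal_le_ofReal
      apply Real.one_le_exp
      have := hω.nonneg 1 zero_le_one
      positivity
    calc growth ω lam k = 1 * growth ω lam k := (one_mul _).symm
      _ ≤ _ := by gcongr

/-- The Fourier transform of the windowed function is $V_\psi f(x,\cdot)$, so its derivatives are
bounded by the moments of the Gabor transform in `ξ`, uniformly in `y`. -/
theorem exists_iteratedFDeriv_window_le {ω : ℝ → ℝ} (hω : IsWeightFunction ω) {ψ f : 𝔼 → ℂ}
    (hfc : Continuous f) (hf : Integrable f) (hf1 : WeightedL1 ω f)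
    (hf2 : WeightedL1 ω (fourierHat f))
    (hψc : Continuous ψ) (hψ1 : WeightedBdd ω ψ) (hψ2 : WeightedBdd ω (fourierHat ψ))
    {mu lam : ℝ} (hmu : 0 < mu) (hlam : 0 < lam) :
    ∃ C : ℝ, 0 < C ∧ ∀ (k : ℕ) (x y : 𝔼), ENNReal.ofReal (Real.exp (mu * ω ‖x‖)) *
      ‖iteratedFDeriv ℝ k (fun y => f y * conj (ψ (y - x))) y‖ₑ ≤
        ENNReal.ofReal C * growth ω lam k := by
  obtain ⟨κ, hκ, hint⟩ := hω.exists_integrable_exp (d := d)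
  -- `mu` pays for the weight at `x`, `lam` for $|\xi|^k$, and `κ` for integrability in `ξ`.
  obtain ⟨C, hC, hV⟩ := exists_gaborTransform_le_exp_mul_exp hω hf hf1 hf2 hψc hψ1 hψ2
    (show 0 < mu + lam + κ by positivity)
  set K := ∫ ξ : 𝔼, Real.exp (-(κ * ω ‖ξ‖)) with hK
  have hK0 : 0 ≤ K := integral_nonneg fun _ => (Real.exp_pos _).le
  set c := ((2 * Real.pi) ^ d)⁻¹ with hc
  have hc0 : 0 < c := by positivity
  refine ⟨c * (C * Real.exp (lam * ω 1) * (K + 1)), by positivity, fun k x y => ?_⟩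
  obtain ⟨M, -, hM⟩ := hψ1.exists_le one_pos
  have hψb : ∀ z, ‖ψ z‖ ≤ M := fun z => by
    refine (hM z).trans ?_
    have := hω.nonneg ‖z‖ (norm_nonneg z)
    have h1 : Real.exp (-(1 * ω ‖z‖)) ≤ 1 := by rw [Real.exp_le_one_iff]; linarith
    nlinarith [norm_nonneg (ψ z), hM z, Real.exp_pos (-(1 * ω ‖z‖))]
  have hwc : Continuous fun y => f y * conj (ψ (y - x)) := by fun_prop
  have hwi : Integrable fun y => f y * conj (ψ (y - x)) :=
    hf.mul_bdd (c := M) (by fun_prop : Continuous fun y => conj (ψ (y - x))).aestronglyMeasurable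
      (Filter.Eventually.of_forall fun y => by rw [RCLike.norm_conj]; exact hψb _)
  have hVc : Continuous fun ξ => ‖gaborTransform ψ f x ξ‖ := (continuous_fourierHat hwi).norm
  have hmom : ∀ k : ℕ, Integrable fun ξ =>
      ‖ξ‖ ^ k * ‖fourierHat (fun y => f y * conj (ψ (y - x))) ξ‖ := by
    intro k
    obtain ⟨κ', hκ', C', hC', hp⟩ := hω.pow_le k
    obtain ⟨C₁, hC₁, hV₁⟩ := exists_gaborTransform_le_exp_mul_exp hω hf hf1 hf2 hψc hψ1 hψ2
      (show 0 < κ' + κ by positivity)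
    refine (hint.const_mul (C' * C₁)).mono'
      (((_root_.continuous_norm).pow k).mul hVc).aestronglyMeasurable
      (Filter.Eventually.of_forall fun ξ => ?_)
    rw [Real.norm_of_nonneg (by positivity), ← gaborTransform_eq_fourierHat]
    have h1 : ‖ξ‖ ^ k ≤ C' * Real.exp (κ' * ω ‖ξ‖) :=
      (pow_le_pow_left₀ (norm_nonneg _) (by linarith) k).trans (hp ‖ξ‖ (norm_nonneg _))
    have h2 : Real.exp (-((κ' + κ) * ω ‖x‖)) ≤ 1 := by
      have := hω.nonneg ‖x‖ (norm_nonneg x)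
      rw [Real.exp_le_one_iff]
      nlinarith
    calc ‖ξ‖ ^ k * ‖gaborTransform ψ f x ξ‖
        ≤ (C' * Real.exp (κ' * ω ‖ξ‖)) * (C₁ * 1 * Real.exp (-((κ' + κ) * ω ‖ξ‖))) := by
          gcongr
          refine (hV₁ x ξ).trans ?_
          gcongr
      _ = C' * C₁ * (Real.exp (κ' * ω ‖ξ‖) * Real.exp (-((κ' + κ) * ω ‖ξ‖))) := by ring
      _ = _ := by rw [← Real.exp_add]; ring_nf
  by_cases htop : growth ω lam k = ⊤
  · rw [htop, ENNReal.mul_top]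
    · exact le_top
    · simp only [ne_eq, ENNReal.ofReal_eq_zero, not_le]
      positivity
  · have hB : growth ω lam k = ENNReal.ofReal (growth ω lam k).toReal :=
      (ENNReal.ofReal_toReal htop).symm
    set B := (growth ω lam k).toReal with hBdef
    have hB0 : 0 ≤ B := ENNReal.toReal_nonneg
    have h0 := norm_iteratedFDeriv_le_lintegral_fourierHat hwc hwi hmom k y
    have hpt : ∀ ξ : 𝔼, ‖ξ‖ ^ k * ‖fourierHat (fun y => f y * conj (ψ (y - x))) ξ‖ ≤
        C * Real.exp (lam * ω 1) * B * Real.exp (-(mu * ω ‖x‖)) * Real.exp (-(κ * ω ‖ξ‖)) := by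
      intro ξ
      rw [← gaborTransform_eq_fourierHat]
      have h1 := le_exp_mul_growth hω hlam k (norm_nonneg ξ)
      rw [hB, ← ENNReal.ofReal_mul (by positivity),
        ENNReal.ofReal_le_ofReal_iff (by positivity)] at h1
      have h2 : Real.exp (-((mu + lam + κ) * ω ‖x‖)) ≤ Real.exp (-(mu * ω ‖x‖)) := by
        have := hω.nonneg ‖x‖ (norm_nonneg x)
        apply Real.exp_le_exp.2
        nlinarith
      have h3 : Real.exp (-((mu + lam + κ) * ω ‖ξ‖)) ≤
          Real.exp (-(lam * ω ‖ξ‖)) * Real.exp (-(κ * ω ‖ξ‖)) := by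
        have := hω.nonneg ‖ξ‖ (norm_nonneg ξ)
        rw [← Real.exp_add]
        apply Real.exp_le_exp.2
        nlinarith
      calc ‖ξ‖ ^ k * ‖gaborTransform ψ f x ξ‖
          ≤ ‖ξ‖ ^ k * (C * Real.exp (-(mu * ω ‖x‖)) *
              (Real.exp (-(lam * ω ‖ξ‖)) * Real.exp (-(κ * ω ‖ξ‖)))) := by
            gcongr
            refine (hV x ξ).trans ?_
            gcongr
        _ = (‖ξ‖ ^ k * Real.exp (-(lam * ω ‖ξ‖))) *
              (C * Real.exp (-(mu * ω ‖x‖)) * Real.exp (-(κ * ω ‖ξ‖))) := by ring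
        _ ≤ (Real.exp (lam * ω 1) * B) *
              (C * Real.exp (-(mu * ω ‖x‖)) * Real.exp (-(κ * ω ‖ξ‖))) := by gcongr
        _ = _ := by ring
    have h4 := integral_mono (hmom k) (hint.const_mul _) hpt
    rw [integral_const_mul] at h4
    rw [hB, ← ofReal_norm, ← ENNReal.ofReal_mul (by positivity),
      ← ENNReal.ofReal_mul (by positivity)]
    apply ENNReal.ofReal_le_ofReal
    calc Real.exp (mu * ω ‖x‖) * ‖iteratedFDeriv ℝ k (fun y => f y * conj (ψ (y - x))) y‖
        ≤ Real.exp (mu * ω ‖x‖) * (c *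
          (C * Real.exp (lam * ω 1) * B * Real.exp (-(mu * ω ‖x‖)) * (K + 1))) := by
          gcongr
          refine h0.trans ?_
          gcongr
          refine h4.trans ?_
          gcongr
          linarith
      _ = _ := by
          rw [Real.exp_neg]
          field_simp

/-- Joint estimate of the weighted derivatives of a function in terms of the Young conjugate. -/
theorem exists_iteratedFDeriv_le {ω : ℝ → ℝ} (hω : IsWeightFunction ω) {f : 𝔼 → ℂ}
    (hs : ContDiff ℝ (⊤ : ℕ∞) f) (hf : Integrable f) (hf1 : WeightedL1 ω f)
    (hf2 : WeightedL1 ω (fourierHat f)) {mu lam : ℝ} (hmu : 0 < mu) (hlam : 0 < lam) :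
    ∃ C : ℝ, 0 < C ∧ ∀ (k : ℕ) (x : 𝔼), ENNReal.ofReal (Real.exp (mu * ω ‖x‖)) *
      ‖iteratedFDeriv ℝ k f x‖ₑ ≤ ENNReal.ofReal C * growth ω lam k := by
  -- `g` is an admissible window, being its own Fourier transform up to a constant; `h` is its
  -- reciprocal, used to remove the window again.
  set g : 𝔼 → ℂ := fun x => Complex.exp (-(1 / 2 : ℂ) * (‖x‖ : ℂ) ^ 2) with hg
  set h : 𝔼 → ℂ := fun x => Complex.exp ((1 / 2 : ℂ) * (‖x‖ : ℂ) ^ 2) with hh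
  have hgc : ContDiff ℝ (⊤ : ℕ∞) g := by
    have : g = fun x => (h x)⁻¹ := by
      ext x
      simp only [hg, hh, ← Complex.exp_neg, neg_mul]
    rw [this]
    exact (contDiff_exp_half_norm_sq (d := d) (⊤ : ℕ∞)).inv fun x => Complex.exp_ne_zero _
  have hg1 : WeightedBdd ω g := by
    simpa only [one_mul] using weightedBdd_gaussian (d := d) hω 1
  have hg2 : WeightedBdd ω (fourierHat g) := by
    have : fourierHat g = fun ξ => _ := funext fourierHat_gaussian
    rw [this]
    exact weightedBdd_gaussian hω _
  -- `A = 2` will absorb the sum $2^n$ of the binomial coefficients in Leibniz' rule.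
  obtain ⟨lam₁, hlam₁, C₁, hC₁, h₁⟩ := growth_absorb hω (one_le_two) 0 hlam
  have hlam₁' : 0 < lam₁ := hlam.trans_le hlam₁
  obtain ⟨C₂, hC₂, h₂⟩ := exists_iteratedFDeriv_window_le hω hs.continuous hf hf1 hf2
    hgc.continuous hg1 hg2 hmu hlam₁'
  have hana : AnalyticAt ℝ h 0 := (contDiff_exp_half_norm_sq ⊤).contDiffAt.analyticAt
  obtain ⟨A, C₃, hA, hC₃, h₃⟩ := hana.exists_norm_iteratedFDeriv_le
  obtain ⟨C₄, hC₄, h₄⟩ := factorial_le_growth hω hA hlam₁'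
  refine ⟨C₂ * C₃ * C₄ * C₁, by positivity, fun n x => ?_⟩
  -- The window is centred at the point `x` of differentiation, so only the derivatives of `h` at
  -- `0` enter, and the bound is uniform in `x`.
  have hfac : f = fun y => (f y * conj (g (y - x))) * h (y - x) := by
    ext y
    have : conj (g (y - x)) * h (y - x) = 1 := by
      simp only [hg, hh, ← Complex.exp_conj, ← Complex.exp_add]
      rw [Complex.exp_eq_one_iff]
      exact ⟨0, by simp [Complex.conj_ofNat]⟩
    rw [mul_assoc, this, mul_one]
  have hconj : ContDiff ℝ (⊤ : ℕ∞) fun y => f y * conj (g (y - x)) := by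
    refine hs.mul ?_
    exact (Complex.conjCLE.contDiff.comp (hgc.comp (contDiff_id.sub contDiff_const)))
  have hhs : ContDiff ℝ (⊤ : ℕ∞) fun y => h (y - x) :=
    (contDiff_exp_half_norm_sq (⊤ : ℕ∞)).comp (contDiff_id.sub contDiff_const)
  have hleib := norm_iteratedFDeriv_mul_le hconj hhs x (n := n) (by exact_mod_cast le_top)
  rw [← hfac] at hleib
  have hleib' : ‖iteratedFDeriv ℝ n f x‖ₑ ≤ ∑ i ∈ Finset.range (n + 1), (n.choose i : ℝ≥0∞) *
      ‖iteratedFDeriv ℝ i (fun y => f y * conj (g (y - x))) x‖ₑ *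
      ‖iteratedFDeriv ℝ (n - i) (fun y => h (y - x)) x‖ₑ := by
    rw [← ofReal_norm]
    refine (ENNReal.ofReal_le_ofReal hleib).trans (le_of_eq ?_)
    rw [ENNReal.ofReal_sum_of_nonneg (fun i _ => by positivity)]
    refine Finset.sum_congr rfl fun i _ => ?_
    rw [ENNReal.ofReal_mul (by positivity), ENNReal.ofReal_mul (by positivity),
      ENNReal.ofReal_natCast, ofReal_norm, ofReal_norm]
  have hh' : ∀ j : ℕ, ‖iteratedFDeriv ℝ j (fun y => h (y - x)) x‖ₑ ≤
      ENNReal.ofReal (C₃ * C₄) * growth ω lam₁ j := by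
    intro j
    rw [iteratedFDeriv_comp_sub, sub_self, ← ofReal_norm, ENNReal.ofReal_mul hC₃.le, mul_assoc]
    refine (ENNReal.ofReal_le_ofReal (h₃ j)).trans ?_
    rw [ENNReal.ofReal_mul hC₃.le]
    gcongr
    exact h₄ j
  calc ENNReal.ofReal (Real.exp (mu * ω ‖x‖)) * ‖iteratedFDeriv ℝ n f x‖ₑ
      ≤ ENNReal.ofReal (Real.exp (mu * ω ‖x‖)) * ∑ i ∈ Finset.range (n + 1),
        (n.choose i : ℝ≥0∞) * ‖iteratedFDeriv ℝ i (fun y => f y * conj (g (y - x))) x‖ₑ *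
        ‖iteratedFDeriv ℝ (n - i) (fun y => h (y - x)) x‖ₑ := by gcongr
    _ = ∑ i ∈ Finset.range (n + 1), (n.choose i : ℝ≥0∞) *
        (ENNReal.ofReal (Real.exp (mu * ω ‖x‖)) *
          ‖iteratedFDeriv ℝ i (fun y => f y * conj (g (y - x))) x‖ₑ) *
        ‖iteratedFDeriv ℝ (n - i) (fun y => h (y - x)) x‖ₑ := by
        rw [Finset.mul_sum]
        exact Finset.sum_congr rfl fun i _ => by ring
    _ ≤ ∑ i ∈ Finset.range (n + 1), (n.choose i : ℝ≥0∞) *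
        (ENNReal.ofReal C₂ * growth ω lam₁ i) *
        (ENNReal.ofReal (C₃ * C₄) * growth ω lam₁ (n - i)) := by
        exact Finset.sum_le_sum fun i _ =>
          mul_le_mul' (mul_le_mul' le_rfl (h₂ i x x)) (hh' (n - i))
    _ = ∑ i ∈ Finset.range (n + 1), (n.choose i : ℝ≥0∞) *
        (ENNReal.ofReal (C₂ * C₃ * C₄) * (growth ω lam₁ i * growth ω lam₁ (n - i))) := by
        refine Finset.sum_congr rfl fun i _ => ?_
        rw [mul_assoc C₂, ENNReal.ofReal_mul hC₂.le]
        ring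
    _ ≤ ∑ i ∈ Finset.range (n + 1), (n.choose i : ℝ≥0∞) *
        (ENNReal.ofReal (C₂ * C₃ * C₄) * growth ω lam₁ n) := by
        refine Finset.sum_le_sum fun i hi => ?_
        gcongr
        have := growth_mul_le hω hlam₁'.le i (n - i)
        rwa [Nat.add_sub_cancel' (Nat.lt_succ_iff.1 (Finset.mem_range.1 hi))] at this
    _ = ENNReal.ofReal (C₂ * C₃ * C₄) * (ENNReal.ofReal 2 ^ n * growth ω lam₁ (n + 0)) := by
        rw [← Finset.sum_mul, ← Nat.cast_sum, Nat.sum_range_choose]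
        push_cast
        rw [ENNReal.ofReal_ofNat, add_zero]
        ring
    _ ≤ ENNReal.ofReal (C₂ * C₃ * C₄) * (ENNReal.ofReal C₁ * growth ω lam n) := by
        exact mul_le_mul' le_rfl (h₁ n)
    _ = _ := by
        rw [ENNReal.ofReal_mul (p := C₂ * C₃ * C₄) (by positivity), mul_assoc (ENNReal.ofReal _)]

/-! ### Multi-index derivatives, monomials and Schwartz functions. -/

theorem ContDiff.coordD {f : 𝔼 → ℂ} (hf : ContDiff ℝ (⊤ : ℕ∞) f) (j : Fin d) :
    ContDiff ℝ (⊤ : ℕ∞) (coordD j f) :=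
  contDiff_const.mul ((hf.fderiv_right (by simp)).clm_apply contDiff_const)

theorem norm_iteratedFDeriv_coordD_le {f : 𝔼 → ℂ} (hf : ContDiff ℝ (⊤ : ℕ∞) f) (j : Fin d)
    (m : ℕ) (x : 𝔼) :
    ‖iteratedFDeriv ℝ m (coordD j f) x‖ ≤ ‖iteratedFDeriv ℝ (m + 1) f x‖ := by
  set T : (𝔼 →L[ℝ] ℂ) →L[ℝ] ℂ :=
    (-Complex.I) • ContinuousLinearMap.apply ℝ ℂ (EuclideanSpace.single j (1 : ℝ)) with hT
  have hTn : ‖T‖ ≤ 1 := by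
    refine ContinuousLinearMap.opNorm_le_bound _ zero_le_one fun L => ?_
    simp only [hT, _root_.smul_apply, ContinuousLinearMap.apply_apply, norm_smul,
      norm_neg, Complex.norm_I, one_mul]
    refine (L.le_opNorm _).trans (le_of_eq ?_)
    simp
  have hcomp : coordD j f = T ∘ fderiv ℝ f := by
    ext x
    simp [coordD, hT]
  have hs : ContDiff ℝ (⊤ : ℕ∞) (fderiv ℝ f) := hf.fderiv_right (by simp)
  rw [hcomp, ← norm_iteratedFDeriv_fderiv]
  refine (T.norm_iteratedFDeriv_comp_left hs.contDiffAt (n := m)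
    (by exact_mod_cast le_top)).trans ?_
  exact mul_le_of_le_one_left (norm_nonneg _) hTn

theorem contDiff_iterate_coordD {f : 𝔼 → ℂ} (hf : ContDiff ℝ (⊤ : ℕ∞) f) (j : Fin d) (n : ℕ) :
    ContDiff ℝ (⊤ : ℕ∞) ((coordD j)^[n] f) ∧
      ∀ (m : ℕ) (x : 𝔼), ‖iteratedFDeriv ℝ m ((coordD j)^[n] f) x‖ ≤
        ‖iteratedFDeriv ℝ (m + n) f x‖ := by
  induction n with
  | zero => exact ⟨hf, fun m x => le_rfl⟩
  | succ n ih =>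
    rw [Function.iterate_succ_apply']
    refine ⟨ih.1.coordD j, fun m x => ?_⟩
    refine (norm_iteratedFDeriv_coordD_le ih.1 j m x).trans ((ih.2 (m + 1) x).trans (le_of_eq ?_))
    rw [add_right_comm, add_assoc]

theorem norm_multiD_le {f : 𝔼 → ℂ} (hf : ContDiff ℝ (⊤ : ℕ∞) f) (α : Fin d → ℕ) (x : 𝔼) :
    ‖multiD α f x‖ ≤ ‖iteratedFDeriv ℝ (multiLength α) f x‖ := by
  -- The induction follows the fold defining `multiD`. It needs all orders `m`, because further
  -- operators are applied to the result.
  have key : ∀ l : List (Fin d),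
      ContDiff ℝ (⊤ : ℕ∞) (l.foldr (fun j g => (coordD j)^[α j] g) f) ∧
      ∀ (m : ℕ) (x : 𝔼),
        ‖iteratedFDeriv ℝ m (l.foldr (fun j g => (coordD j)^[α j] g) f) x‖ ≤
          ‖iteratedFDeriv ℝ (m + (l.map α).sum) f x‖ := by
    intro l
    induction l with
    | nil => exact ⟨hf, fun m x => le_rfl⟩
    | cons j l ih =>
      simp only [List.foldr_cons]
      obtain ⟨h1, h2⟩ := contDiff_iterate_coordD ih.1 j (α j)
      refine ⟨h1, fun m x => (h2 m x).trans ((ih.2 _ x).trans (le_of_eq ?_))⟩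
      rw [List.map_cons, List.sum_cons, add_assoc]
  have h := (key (List.finRange d)).2 0 x
  rw [norm_iteratedFDeriv_zero, zero_add, ← Fin.sum_univ_def] at h
  exact h

theorem contDiff_multiD {f : 𝔼 → ℂ} (hf : ContDiff ℝ (⊤ : ℕ∞) f) (α : Fin d → ℕ) :
    ContDiff ℝ (⊤ : ℕ∞) (multiD α f) := by
  unfold multiD
  induction List.finRange d with
  | nil => exact hf
  | cons j l ih => exact (contDiff_iterate_coordD ih j (α j)).1

theorem multiD_zero (f : 𝔼 → ℂ) : multiD 0 f = f := by
  unfold multiD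
  induction List.finRange d with
  | nil => rfl
  | cons j l ih => simp

theorem multiLength_add (α β : Fin d → ℕ) :
    multiLength (α + β) = multiLength α + multiLength β := by
  simp [multiLength, Finset.sum_add_distrib]

theorem abs_monom_le (β : Fin d → ℕ) (x : 𝔼) : |monom β x| ≤ ‖x‖ ^ multiLength β := by
  rw [monom, Finset.abs_prod, multiLength, ← Finset.prod_pow_eq_pow_sum]
  refine Finset.prod_le_prod (fun _ _ => abs_nonneg _) fun j _ => ?_
  rw [abs_pow]
  exact pow_le_pow_left₀ (abs_nonneg _) (PiLp.norm_apply_le x j) _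

theorem continuous_monom (β : Fin d → ℕ) : Continuous (monom β : 𝔼 → ℝ) := by
  unfold monom
  fun_prop

theorem fourierHat_schwartz (u : 𝓢(𝔼, ℂ)) : ContDiff ℝ (⊤ : ℕ∞) (fourierHat u) ∧
    Integrable (fourierHat u) := by
  have h : fourierHat (u : 𝔼 → ℂ) = fun ξ => (FourierTransform.fourier u : 𝓢(𝔼, ℂ))
      ((2 * Real.pi)⁻¹ • ξ) := by
    ext ξ
    rw [fourierHat_eq_fourier, SchwartzMap.fourier_coe]
  rw [h]
  constructor
  · exact ((FourierTransform.fourier u : 𝓢(𝔼, ℂ)).smooth _).comp (contDiff_const_smul _)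
  · exact (integrable_comp_smul_iff volume _ (inv_ne_zero Real.two_pi_pos.ne')).2
      (SchwartzMap.integrable _)

theorem fourierHat_fourierHat_schwartz (u : 𝓢(𝔼, ℂ)) (x : 𝔼) :
    fourierHat (fourierHat u) x = ((2 * Real.pi : ℝ) : ℂ) ^ d * u (-x) :=
  fourierHat_fourierHat u.continuous u.integrable (fourierHat_schwartz u).2 x

/-- Makes the hub symmetric: the double transform is a multiple of a reflection, so the derivative
estimates for `u` apply to `fourierHat u` as well. -/
theorem WeightedL1.fourierHat_fourierHat {ω : ℝ → ℝ} {u : 𝓢(𝔼, ℂ)} (hu : WeightedL1 ω u) :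
    WeightedL1 ω (fourierHat (fourierHat (u : 𝔼 → ℂ))) := by
  intro lam hlam
  have h := hu lam hlam
  rw [← lintegral_neg_eq_self] at h
  have h2 : ∀ x : 𝔼, ENNReal.ofReal (Real.exp (lam * ω ‖x‖)) *
      ‖fourierHat (fourierHat (u : 𝔼 → ℂ)) x‖ₑ =
      ‖((2 * Real.pi : ℝ) : ℂ) ^ d‖ₑ *
        (ENNReal.ofReal (Real.exp (lam * ω ‖-x‖)) * ‖u (-x)‖ₑ) := by
    intro x
    rw [fourierHat_fourierHat_schwartz, enorm_mul, norm_neg]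
    ring
  simp only [h2]
  rw [lintegral_const_mul' _ _ enorm_ne_top]
  exact ENNReal.mul_lt_top enorm_lt_top h

/-! ### From the hub to the conditions. -/

/-- Weighted bounds for all derivatives of `f`, uniform relative to the Young conjugate. -/
def JointBound (ω : ℝ → ℝ) (f : EuclideanSpace ℝ (Fin d) → ℂ) : Prop :=
  ∀ mu lam : ℝ, 0 < mu → 0 < lam → ∃ C : ℝ, 0 < C ∧ ∀ (α : Fin d → ℕ) (x : EuclideanSpace ℝ (Fin d)),
    ENNReal.ofReal (Real.exp (mu * ω ‖x‖)) * ‖multiD α f x‖ₑ ≤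
      ENNReal.ofReal C * growth ω lam (multiLength α)

theorem jointBound_of_weightedL1 {ω : ℝ → ℝ} (hω : IsWeightFunction ω) {f : 𝔼 → ℂ}
    (hs : ContDiff ℝ (⊤ : ℕ∞) f) (hf : Integrable f) (hf1 : WeightedL1 ω f)
    (hf2 : WeightedL1 ω (fourierHat f)) : JointBound ω f := by
  intro mu lam hmu hlam
  obtain ⟨C, hC, h⟩ := exists_iteratedFDeriv_le hω hs hf hf1 hf2 hmu hlam
  refine ⟨C, hC, fun α x => le_trans ?_ (h (multiLength α) x)⟩
  refine mul_le_mul' le_rfl ?_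
  rw [← ofReal_norm, ← ofReal_norm]
  exact ENNReal.ofReal_le_ofReal (norm_multiD_le hs α x)

theorem JointBound.exists_le {ω : ℝ → ℝ} (hω : IsWeightFunction ω) {f : 𝔼 → ℂ}
    (hf : JointBound ω f) {mu : ℝ} (hmu : 0 < mu) (α : Fin d → ℕ) :
    ∃ C : ℝ, 0 < C ∧ ∀ x, Real.exp (mu * ω ‖x‖) * ‖multiD α f x‖ ≤ C := by
  obtain ⟨lam, hlam, hfin⟩ := exists_growth_lt_top hω (multiLength α)
  obtain ⟨C, hC, h⟩ := hf mu lam hmu hlam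
  refine ⟨C * (growth ω lam (multiLength α)).toReal + 1, by positivity, fun x => ?_⟩
  have h1 := ENNReal.toReal_mono (ENNReal.mul_ne_top ENNReal.ofReal_ne_top hfin.ne) (h α x)
  rw [ENNReal.toReal_mul, ENNReal.toReal_mul, ENNReal.toReal_ofReal (by positivity),
    ENNReal.toReal_ofReal (by positivity), toReal_enorm] at h1
  linarith

/-- Functions dominated by `e^{-κω}` are bounded in all `L^p` norms. -/
theorem IsWeightFunction.exists_eLpNorm_le {ω : ℝ → ℝ} (hω : IsWeightFunction ω) :
    ∃ κ : ℝ, 0 < κ ∧ ∀ p : ℝ≥0∞, 1 ≤ p → ∃ K : ℝ, 0 < K ∧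
      ∀ {ε : Type} [ENorm ε] (F : EuclideanSpace ℝ (Fin d) → ε) (B : ℝ≥0∞),
        (∀ x, ‖F x‖ₑ ≤ B * ENNReal.ofReal (Real.exp (-(κ * ω ‖x‖)))) →
          eLpNorm F p volume ≤ ENNReal.ofReal K * B := by
  obtain ⟨κ, hκ, hint⟩ := hω.exists_integrable_exp (d := d)
  refine ⟨κ, hκ, fun p hp => ?_⟩
  set g : 𝔼 → ℝ := fun x => Real.exp (-(κ * ω ‖x‖)) with hg
  have hg1 : ∀ x, ‖g x‖ ≤ 1 := fun x => by
    rw [Real.norm_of_nonneg (Real.exp_pos _).le, Real.exp_le_one_iff]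
    have := hω.nonneg ‖x‖ (norm_nonneg x)
    nlinarith
  have hfin : eLpNorm g p volume < ⊤ := by
    rcases eq_or_ne p ⊤ with rfl | hpt
    · rw [eLpNorm_exponent_top]
      exact (eLpNormEssSup_le_of_ae_bound (Filter.Eventually.of_forall hg1)).trans_lt
        ENNReal.ofReal_lt_top
    · have hp0 : p ≠ 0 := (zero_lt_one.trans_le hp).ne'
      rw [eLpNorm_lt_top_iff_lintegral_rpow_enorm_lt_top hp0 hpt]
      -- Since $e^{-\kappa\omega}\le1$ and $p\ge1$, its $p$-th power is at most itself.
      refine lt_of_le_of_lt (lintegral_mono fun x => ?_) hint.2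
      have h1 : ‖g x‖ₑ ≤ 1 := by
        rw [← ofReal_norm, ← ENNReal.ofReal_one]
        exact ENNReal.ofReal_le_ofReal (hg1 x)
      have h2 : 1 ≤ p.toReal := by
        rw [← ENNReal.toReal_one]
        exact ENNReal.toReal_mono hpt hp
      calc ‖g x‖ₑ ^ p.toReal ≤ ‖g x‖ₑ ^ (1 : ℝ) := ENNReal.rpow_le_rpow_of_exponent_ge h1 h2
        _ = ‖g x‖ₑ := ENNReal.rpow_one _
  -- `F` needs only an extended norm, so the estimate also covers the `ℝ≥0∞`-valued inner norm of
  -- `mixedNorm`. The case `B = ⊤` is allowed because `growth` may be infinite.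
  refine ⟨(eLpNorm g p volume).toReal + 1, by positivity, fun F B hF => ?_⟩
  rcases eq_or_ne B ⊤ with rfl | hB
  · rw [ENNReal.mul_top]
    · exact le_top
    · simp only [ne_eq, ENNReal.ofReal_eq_zero, not_le]
      positivity
  · calc eLpNorm F p volume ≤ eLpNorm (B.toReal • g) p volume := by
          refine eLpNorm_mono_enorm fun x => (hF x).trans (le_of_eq ?_)
          rw [Pi.smul_apply, enorm_smul, ← ofReal_norm B.toReal,
            Real.norm_of_nonneg ENNReal.toReal_nonneg, ENNReal.ofReal_toReal hB, ← ofReal_norm,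
            Real.norm_of_nonneg (Real.exp_pos _).le]
      _ = B * eLpNorm g p volume := by
          rw [eLpNorm_const_smul, ← ofReal_norm, Real.norm_of_nonneg ENNReal.toReal_nonneg,
            ENNReal.ofReal_toReal hB]
      _ ≤ B * ENNReal.ofReal ((eLpNorm g p volume).toReal + 1) := by
          gcongr
          refine ENNReal.le_ofReal_iff_toReal_le hfin.ne (by positivity) |>.2 ?_
          linarith
      _ = _ := mul_comm _ _

theorem le_mul_ofReal_exp_neg {a B : ℝ≥0∞} {t : ℝ} (h : ENNReal.ofReal (Real.exp t) * a ≤ B) :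
    a ≤ B * ENNReal.ofReal (Real.exp (-t)) := by
  calc a = (ENNReal.ofReal (Real.exp t) * a) * ENNReal.ofReal (Real.exp (-t)) := by
        rw [mul_right_comm, ← ENNReal.ofReal_mul (by positivity), ← Real.exp_add]
        simp
    _ ≤ _ := by gcongr

theorem ofReal_exp_add_mul (s t : ℝ) (a : ℝ≥0∞) : ENNReal.ofReal (Real.exp (s + t)) * a =
    ENNReal.ofReal (Real.exp s) * (ENNReal.ofReal (Real.exp t) * a) := by
  rw [Real.exp_add, ENNReal.ofReal_mul (by positivity), mul_assoc]

theorem enorm_exp_smul (t : ℝ) (z : ℂ) :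
    ‖Real.exp t • z‖ₑ = ENNReal.ofReal (Real.exp t) * ‖z‖ₑ := by
  rw [enorm_smul, ← ofReal_norm, Real.norm_of_nonneg (Real.exp_pos t).le]

section Consequences

variable {ω : ℝ → ℝ} {p q : ℝ≥0∞}

theorem JointBound.exists_eLpNorm_exp_smul_le (hω : IsWeightFunction ω) {f : 𝔼 → ℂ}
    (hf : JointBound ω f) (hp : 1 ≤ p) {mu lam : ℝ} (hmu : 0 < mu) (hlam : 0 < lam) :
    ∃ C : ℝ, 0 < C ∧ ∀ α : Fin d → ℕ,
      eLpNorm (fun x => Real.exp (mu * ω ‖x‖) • multiD α f x) p volume ≤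
        ENNReal.ofReal C * growth ω lam (multiLength α) := by
  obtain ⟨κ, hκ, hK⟩ := hω.exists_eLpNorm_le (d := d)
  obtain ⟨K, hK0, hKF⟩ := hK p hp
  obtain ⟨C, hC, h⟩ := hf (κ + mu) lam (by positivity) hlam
  refine ⟨K * C, by positivity, fun α => ?_⟩
  rw [ENNReal.ofReal_mul hK0.le, mul_assoc]
  refine hKF _ _ fun x => le_mul_ofReal_exp_neg ?_
  rw [enorm_exp_smul, ← ofReal_exp_add_mul, ← add_mul]
  exact h α x

theorem JointBound.condG (hω : IsWeightFunction ω) {f : 𝔼 → ℂ}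
    (hf : JointBound ω f) (hp : 1 ≤ p) : CondG ω p f := by
  intro mu lam hmu hlam
  obtain ⟨C, hC, h⟩ := hf.exists_eLpNorm_exp_smul_le hω hp hmu hlam
  refine ⟨C, hC, iSup_le fun α => ?_⟩
  rw [youngFactor_eq ω hlam]
  calc _ ≤ ENNReal.ofReal C * growth ω lam (multiLength α) *
        (growth ω lam (multiLength α))⁻¹ := by gcongr; exact h α
    -- Only $G\cdot G^{-1}\le1$ is used, which holds also for $G=\infty$, where the product is $0$.
    _ ≤ ENNReal.ofReal C * 1 := by
        rw [mul_assoc]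
        gcongr
        exact ENNReal.mul_inv_le_one _
    _ = _ := mul_one _

/-- The monomial is exchanged for the weight: $|x|^k\le e^{\mu\omega(1)}\,G\,e^{\mu\omega(x)}$,
where $G$ is `growth ω mu k`. -/
theorem JointBound.exists_eLpNorm_monom_smul_le (hω : IsWeightFunction ω) {f : 𝔼 → ℂ}
    (hf : JointBound ω f) (hp : 1 ≤ p) {mu lam : ℝ} (hmu : 0 < mu) (hlam : 0 < lam) :
    ∃ C : ℝ, 0 < C ∧ ∀ α β : Fin d → ℕ,
      eLpNorm (fun x => monom β x • multiD α f x) p volume ≤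
        ENNReal.ofReal C * (growth ω lam (multiLength α) * growth ω mu (multiLength β)) := by
  obtain ⟨C, hC, h⟩ := hf.exists_eLpNorm_exp_smul_le hω hp hmu hlam
  refine ⟨C * Real.exp (mu * ω 1), by positivity, fun α β => ?_⟩
  rcases eq_or_ne (growth ω mu (multiLength β)) ⊤ with htop | htop
  · rw [htop, ENNReal.mul_top (growth_ne_zero _ _ _), ENNReal.mul_top]
    · exact le_top
    · simp only [ne_eq, ENNReal.ofReal_eq_zero, not_le]
      positivity
  · set c : ℝ := Real.exp (mu * ω 1) * (growth ω mu (multiLength β)).toReal with hc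
    have hc0 : 0 ≤ c := by positivity
    have hce : ENNReal.ofReal c =
        ENNReal.ofReal (Real.exp (mu * ω 1)) * growth ω mu (multiLength β) := by
      rw [hc, ENNReal.ofReal_mul (by positivity), ENNReal.ofReal_toReal htop]
    have hpt : ∀ x : 𝔼, ‖monom β x • multiD α f x‖ ≤
        ‖(c • fun x => Real.exp (mu * ω ‖x‖) • multiD α f x) x‖ := by
      intro x
      have h1 := le_exp_mul_growth hω hmu (multiLength β) (norm_nonneg x)
      rw [← hce, ENNReal.ofReal_le_ofReal_iff hc0, Real.exp_neg, ← div_eq_mul_inv,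
        div_le_iff₀ (Real.exp_pos _)] at h1
      simp only [Pi.smul_apply, norm_smul, Real.norm_of_nonneg hc0,
        Real.norm_of_nonneg (Real.exp_pos _).le, ← mul_assoc]
      gcongr
      exact (abs_monom_le β x).trans h1
    refine (eLpNorm_mono hpt).trans ?_
    rw [eLpNorm_const_smul, ← ofReal_norm, Real.norm_of_nonneg hc0, hce,
      ENNReal.ofReal_mul hC.le]
    calc _ ≤ ENNReal.ofReal (Real.exp (mu * ω 1)) * growth ω mu (multiLength β) *
          (ENNReal.ofReal C * growth ω lam (multiLength α)) := by gcongr; exact h α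
      _ = _ := by ring

theorem JointBound.condE (hω : IsWeightFunction ω) {f : 𝔼 → ℂ}
    (hf : JointBound ω f) (hp : 1 ≤ p) : CondE ω p f := by
  intro mu lam hmu hlam
  obtain ⟨C, hC, h⟩ := hf.exists_eLpNorm_monom_smul_le hω hp hmu hlam
  refine ⟨C, hC, iSup_le fun α => iSup_le fun β => ?_⟩
  rw [youngFactor_eq ω hlam, youngFactor_eq ω hmu]
  calc _ ≤ ENNReal.ofReal C * (growth ω lam (multiLength α) * growth ω mu (multiLength β)) *
        (growth ω lam (multiLength α))⁻¹ * (growth ω mu (multiLength β))⁻¹ := by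
        gcongr; exact h α β
    _ = ENNReal.ofReal C * (growth ω lam (multiLength α) * (growth ω lam (multiLength α))⁻¹) *
        (growth ω mu (multiLength β) * (growth ω mu (multiLength β))⁻¹) := by ring
    _ ≤ ENNReal.ofReal C * 1 * 1 := by
        gcongr
        · exact ENNReal.mul_inv_le_one _
        · exact ENNReal.mul_inv_le_one _
    _ = _ := by rw [mul_one, mul_one]

theorem JointBound.condF (hω : IsWeightFunction ω) {f : 𝔼 → ℂ}
    (hf : JointBound ω f) (hp : 1 ≤ p) : CondF ω p f := by
  intro lam hlam
  obtain ⟨C, hC, h⟩ := hf.exists_eLpNorm_monom_smul_le hω hp hlam hlam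
  refine ⟨C, hC, iSup_le fun α => iSup_le fun β => ?_⟩
  rw [youngFactor_eq ω hlam]
  calc _ ≤ ENNReal.ofReal C * growth ω lam (multiLength (α + β)) *
        (growth ω lam (multiLength (α + β)))⁻¹ := by
        gcongr
        refine (h α β).trans ?_
        rw [multiLength_add]
        gcongr
        exact growth_mul_le hω hlam.le _ _
    _ ≤ ENNReal.ofReal C * 1 := by
        rw [mul_assoc]
        gcongr
        exact ENNReal.mul_inv_le_one _
    _ = _ := mul_one _

theorem JointBound.condD (hω : IsWeightFunction ω) {f : 𝔼 → ℂ}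
    (hf : JointBound ω f) (hp : 1 ≤ p) (hq : 1 ≤ q) : CondD ω p q f := by
  constructor
  · intro lam hlam β
    -- `β` is fixed here, so its factor can be made finite by the choice of `mu` and moved into the
    -- constant.
    obtain ⟨mu, hmu, hfin⟩ := exists_growth_lt_top hω (multiLength β)
    obtain ⟨C, hC, h⟩ := hf.exists_eLpNorm_monom_smul_le hω hp hmu hlam
    set G := growth ω mu (multiLength β)
    have hG : G = ENNReal.ofReal G.toReal := (ENNReal.ofReal_toReal hfin.ne).symm
    have hG0 : 0 < G.toReal := ENNReal.toReal_pos (growth_ne_zero _ _ _) hfin.ne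
    refine ⟨C * G.toReal, by positivity, iSup_le fun α => ?_⟩
    rw [youngFactor_eq ω hlam]
    calc _ ≤ ENNReal.ofReal C * (growth ω lam (multiLength α) * G) *
          (growth ω lam (multiLength α))⁻¹ := by
          gcongr; exact h α β
      _ = ENNReal.ofReal C * G *
          (growth ω lam (multiLength α) * (growth ω lam (multiLength α))⁻¹) := by ring
      _ ≤ ENNReal.ofReal C * G * 1 := by
          gcongr
          exact ENNReal.mul_inv_le_one _
      _ = _ := by rw [mul_one, ENNReal.ofReal_mul hC.le, ← hG]
  · intro mu hmu α
    obtain ⟨lam, hlam, hfin⟩ := exists_growth_lt_top hω (multiLength α)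
    obtain ⟨C, hC, h⟩ := hf.exists_eLpNorm_monom_smul_le hω hq hmu hlam
    set G := growth ω lam (multiLength α)
    have hG : G = ENNReal.ofReal G.toReal := (ENNReal.ofReal_toReal hfin.ne).symm
    have hG0 : 0 < G.toReal := ENNReal.toReal_pos (growth_ne_zero _ _ _) hfin.ne
    refine ⟨C * G.toReal, by positivity, iSup_le fun β => ?_⟩
    rw [youngFactor_eq ω hmu]
    calc _ ≤ ENNReal.ofReal C * (G * growth ω mu (multiLength β)) *
          (growth ω mu (multiLength β))⁻¹ := by
          gcongr; exact h α β
      _ = ENNReal.ofReal C * G *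
          (growth ω mu (multiLength β) * (growth ω mu (multiLength β))⁻¹) := by ring
      _ ≤ ENNReal.ofReal C * G * 1 := by
          gcongr
          exact ENNReal.mul_inv_le_one _
      _ = _ := by rw [mul_one, ENNReal.ofReal_mul hC.le, ← hG]

theorem JointBound.exists_eLpNorm_exp_smul_multiD_le (hω : IsWeightFunction ω) {f : 𝔼 → ℂ}
    (hf : JointBound ω f) (hp : 1 ≤ p) {lam : ℝ} (hlam : 0 < lam) (α : Fin d → ℕ) :
    ∃ C : ℝ, 0 < C ∧ eLpNorm (fun x => Real.exp (lam * ω ‖x‖) • multiD α f x) p volume ≤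
      ENNReal.ofReal C := by
  obtain ⟨κ, hκ, hK⟩ := hω.exists_eLpNorm_le (d := d)
  obtain ⟨K, hK0, hKF⟩ := hK p hp
  obtain ⟨C, hC, h⟩ := hf.exists_le hω (show 0 < κ + lam by positivity) α
  refine ⟨K * C, by positivity, ?_⟩
  rw [ENNReal.ofReal_mul hK0.le]
  refine hKF _ _ fun x => le_mul_ofReal_exp_neg ?_
  rw [enorm_exp_smul, ← ofReal_exp_add_mul, ← add_mul, ← ofReal_norm,
    ← ENNReal.ofReal_mul (by positivity)]
  exact ENNReal.ofReal_le_ofReal (h x)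

theorem JointBound.exists_eLpNorm_exp_monom_smul_le (hω : IsWeightFunction ω) {f : 𝔼 → ℂ}
    (hf : JointBound ω f) (hp : 1 ≤ p) {lam : ℝ} (hlam : 0 < lam) (α : Fin d → ℕ) :
    ∃ C : ℝ, 0 < C ∧ eLpNorm (fun x => (Real.exp (lam * ω ‖x‖) * monom α x) • f x) p volume ≤
      ENNReal.ofReal C := by
  obtain ⟨κ, hκ, c, hc, hp'⟩ := hω.pow_le (multiLength α)
  obtain ⟨C, hC, h⟩ := hf.exists_eLpNorm_exp_smul_multiD_le hω hp
    (show 0 < lam + κ by positivity) 0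
  rw [multiD_zero] at h
  refine ⟨c * C, by positivity, ?_⟩
  have hpt : ∀ x : 𝔼, ‖(Real.exp (lam * ω ‖x‖) * monom α x) • f x‖ ≤
      ‖(c • fun x => Real.exp ((lam + κ) * ω ‖x‖) • f x) x‖ := by
    intro x
    have h1 : |monom α x| ≤ c * Real.exp (κ * ω ‖x‖) :=
      (abs_monom_le α x).trans ((pow_le_pow_left₀ (norm_nonneg x) (by linarith) _).trans
        (hp' ‖x‖ (norm_nonneg x)))
    simp only [Pi.smul_apply, norm_smul, norm_mul, Real.norm_of_nonneg hc.le,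
      Real.norm_of_nonneg (Real.exp_pos _).le, ← mul_assoc, Real.norm_eq_abs]
    refine mul_le_mul_of_nonneg_right ?_ (norm_nonneg _)
    calc Real.exp (lam * ω ‖x‖) * |monom α x|
        ≤ Real.exp (lam * ω ‖x‖) * (c * Real.exp (κ * ω ‖x‖)) := by gcongr
      _ = c * Real.exp ((lam + κ) * ω ‖x‖) := by rw [add_mul, Real.exp_add]; ring
  refine (eLpNorm_mono hpt).trans ?_
  rw [eLpNorm_const_smul, ← ofReal_norm, Real.norm_of_nonneg hc.le, ENNReal.ofReal_mul hc.le]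
  gcongr

/-- Decay of the Gabor transform implies the weighted mixed norm bound. -/
theorem condH_of_weightedL1 (hω : IsWeightFunction ω) {ψ u : 𝔼 → ℂ}
    (hu : Integrable u) (hu1 : WeightedL1 ω u) (hu2 : WeightedL1 ω (fourierHat u))
    (hψc : Continuous ψ) (hψ1 : WeightedBdd ω ψ) (hψ2 : WeightedBdd ω (fourierHat ψ))
    (hp : 1 ≤ p) (hq : 1 ≤ q) : CondH ω p q ψ u := by
  intro lam hlam
  obtain ⟨κ, hκ, hK⟩ := hω.exists_eLpNorm_le (d := d)
  obtain ⟨K, hK0, hKF⟩ := hK p hp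
  obtain ⟨K', hK0', hKF'⟩ := hK q hq
  obtain ⟨L, hL, h⟩ := hω.exists_exp_le
  -- `lam * L` pays for the weight at $|z|\le|x|+|\xi|$, split between the variables; `κ` pays for
  -- the $L^p$ and the $L^q$ norm.
  obtain ⟨C, hC, hV⟩ := exists_gaborTransform_le_exp_mul_exp hω hu hu1 hu2 hψc hψ1 hψ2
    (show 0 < lam * L + κ by positivity)
  refine ⟨K' * (K * (C * Real.exp (lam * L))), by positivity, ?_⟩
  rw [ENNReal.ofReal_mul hK0'.le]
  refine hKF' _ _ fun ξ => ?_
  rw [enorm_eq_self, ENNReal.ofReal_mul hK0.le, mul_assoc]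
  refine hKF _ _ fun x => ?_
  rw [enorm_exp_smul, ← ofReal_norm, ← ENNReal.ofReal_mul (by positivity),
    ← ENNReal.ofReal_mul (by positivity), ← ENNReal.ofReal_mul (by positivity)]
  apply ENNReal.ofReal_le_ofReal
  have hz : Real.sqrt (‖x‖ ^ 2 + ‖ξ‖ ^ 2) ≤ ‖x‖ + ‖ξ‖ := by
    apply Real.sqrt_le_iff.2 ⟨by positivity, _⟩
    nlinarith [norm_nonneg x, norm_nonneg ξ, mul_nonneg (norm_nonneg x) (norm_nonneg ξ)]
  calc _ ≤ (Real.exp (lam * L) * Real.exp (lam * L * ω ‖x‖) * Real.exp (lam * L * ω ‖ξ‖)) *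
        (C * Real.exp (-((lam * L + κ) * ω ‖x‖)) * Real.exp (-((lam * L + κ) * ω ‖ξ‖))) := by
        gcongr
        · exact h lam hlam _ _ _ (Real.sqrt_nonneg _) (norm_nonneg _) (norm_nonneg _) hz
        · exact hV x ξ
    _ = C * Real.exp (lam * L) *
        (Real.exp (lam * L * ω ‖ξ‖) * Real.exp (-((lam * L + κ) * ω ‖ξ‖))) *
        (Real.exp (lam * L * ω ‖x‖) * Real.exp (-((lam * L + κ) * ω ‖x‖))) := by ring
    _ = _ := by rw [← Real.exp_add, ← Real.exp_add]; ring_nf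

end Consequences

/-! ### Comparison of $L^1$ with weighted $L^p$ norms. -/

/-- A form of Hölder's inequality with a bounded weight; no measurability of `F` is needed. -/
theorem lintegral_mul_enorm_le_eLpNorm {X ε : Type*} [MeasurableSpace X] {μ : Measure X} [ENorm ε]
    {g : X → ℝ≥0∞} (hg : AEMeasurable g μ) (hg1 : ∀ x, g x ≤ 1) (hgi : ∫⁻ x, g x ∂μ ≠ ⊤)
    (F : X → ε) {p : ℝ≥0∞} (hp : 1 ≤ p) :
    ∫⁻ x, g x * ‖F x‖ₑ ∂μ ≤ (∫⁻ x, g x ∂μ + 1) * eLpNorm F p μ := by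
  set G := ∫⁻ x, g x ∂μ with hG
  rcases eq_or_ne p ⊤ with rfl | hpt
  · calc ∫⁻ x, g x * ‖F x‖ₑ ∂μ ≤ ∫⁻ x, g x * eLpNorm F ⊤ μ ∂μ := by
          refine lintegral_mono_ae ?_
          rw [eLpNorm_exponent_top]
          filter_upwards [ae_le_eLpNormEssSup (f := F) (μ := μ)] with x hx
          gcongr
      _ = G * eLpNorm F ⊤ μ := lintegral_mul_const'' _ hg
      _ ≤ _ := by gcongr; exact le_self_add
  · have hp0 : p ≠ 0 := (zero_lt_one.trans_le hp).ne'
    have hp1 : 1 ≤ p.toReal := by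
      rw [← ENNReal.toReal_one]
      exact ENNReal.toReal_mono hpt hp
    have hG1 : G + 1 ≠ 0 := by simp
    have hG2 : G + 1 ≠ ⊤ := by simp [hgi]
    rw [mul_comm, ← ENNReal.div_le_iff hG1 hG2]
    -- Normalise by a number `S` strictly above the norm, which avoids dividing by zero. The
    -- pointwise inequality $gt\le g+t^p$ for $g\le1\le p$ then replaces Hölder, and no
    -- measurability of `F` is needed.
    refine le_of_forall_gt_imp_ge_of_dense fun S hS => ?_
    rw [ENNReal.div_le_iff hG1 hG2]
    rcases eq_or_ne S ⊤ with rfl | hSt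
    · rw [ENNReal.top_mul hG1]
      exact le_top
    have hS0 : S ≠ 0 := (bot_le.trans_lt hS).ne'
    have hSi0 : S⁻¹ ≠ ⊤ := ENNReal.inv_ne_top.2 hS0
    have hpt' : ∀ x, g x * ‖F x‖ₑ ≤ S * (g x + S⁻¹ ^ p.toReal * ‖F x‖ₑ ^ p.toReal) := by
      intro x
      have h1 : ∀ t : ℝ≥0∞, g x * t ≤ g x + t ^ p.toReal := by
        intro t
        rcases le_total t 1 with ht | ht
        · calc g x * t ≤ g x * 1 := by gcongr
            _ ≤ _ := by rw [mul_one]; exact le_self_add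
        · calc g x * t ≤ 1 * t ^ (1 : ℝ) := by
                rw [ENNReal.rpow_one]
                gcongr
                exact hg1 x
            _ ≤ t ^ p.toReal := by
                rw [one_mul]
                exact ENNReal.rpow_le_rpow_of_exponent_le ht hp1
            _ ≤ _ := le_add_self
      have h2 := h1 (S⁻¹ * ‖F x‖ₑ)
      rw [ENNReal.mul_rpow_of_nonneg _ _ (by positivity)] at h2
      calc g x * ‖F x‖ₑ = S * (g x * (S⁻¹ * ‖F x‖ₑ)) := by
            rw [mul_left_comm (g x), ← mul_assoc S, ENNReal.mul_inv_cancel hS0 hSt, one_mul]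
        _ ≤ _ := by gcongr
    have hle : S⁻¹ ^ p.toReal * ∫⁻ x, ‖F x‖ₑ ^ p.toReal ∂μ ≤ 1 := by
      have h3 : ∫⁻ x, ‖F x‖ₑ ^ p.toReal ∂μ = eLpNorm F p μ ^ p.toReal := by
        rw [eLpNorm_eq_lintegral_rpow_enorm_toReal hp0 hpt, ← ENNReal.rpow_mul, one_div,
          inv_mul_cancel₀ (by positivity), ENNReal.rpow_one]
      rw [h3, ← ENNReal.mul_rpow_of_nonneg _ _ (by positivity)]
      refine ENNReal.rpow_le_one ?_ (by positivity)
      calc S⁻¹ * eLpNorm F p μ ≤ S⁻¹ * S := by gcongr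
        _ ≤ 1 := by rw [mul_comm]; exact ENNReal.mul_inv_le_one _
    calc ∫⁻ x, g x * ‖F x‖ₑ ∂μ
        ≤ ∫⁻ x, S * (g x + S⁻¹ ^ p.toReal * ‖F x‖ₑ ^ p.toReal) ∂μ := lintegral_mono hpt'
      _ = S * (G + S⁻¹ ^ p.toReal * ∫⁻ x, ‖F x‖ₑ ^ p.toReal ∂μ) := by
          rw [lintegral_const_mul' _ _ hSt, lintegral_add_left' hg,
            lintegral_const_mul' _ _ (ENNReal.rpow_ne_top_of_nonneg (by positivity) hSi0)]
      _ ≤ S * (G + 1) := by gcongr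

/-- Neither `p` nor measurability of `F` enters the choice of `K`. It is applied twice to
`mixedNorm`, the second time to the inner norm as a function of $\xi$. -/
theorem IsWeightFunction.exists_lintegral_exp_neg_mul_le {ω : ℝ → ℝ} (hω : IsWeightFunction ω) :
    ∃ κ : ℝ, 0 < κ ∧ ∃ K : ℝ≥0∞, K ≠ ⊤ ∧
      ∀ {ε : Type} [ENorm ε] (F : EuclideanSpace ℝ (Fin d) → ε) (p : ℝ≥0∞), 1 ≤ p →
        ∫⁻ x, ENNReal.ofReal (Real.exp (-(κ * ω ‖x‖))) * ‖F x‖ₑ ≤ K * eLpNorm F p volume := by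
  obtain ⟨κ, hκ, hint⟩ := hω.exists_integrable_exp (d := d)
  refine ⟨κ, hκ, (∫⁻ x : 𝔼, ENNReal.ofReal (Real.exp (-(κ * ω ‖x‖)))) + 1, ?_, fun F p hp => ?_⟩
  · exact ENNReal.add_ne_top.2 ⟨hint.lintegral_lt_top.ne, ENNReal.one_ne_top⟩
  · refine lintegral_mul_enorm_le_eLpNorm hint.1.aemeasurable.ennreal_ofReal (fun x => ?_)
      hint.lintegral_lt_top.ne F hp
    rw [ENNReal.ofReal_le_one, Real.exp_le_one_iff]
    have := hω.nonneg ‖x‖ (norm_nonneg x)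
    nlinarith

theorem weightedL1_of_eLpNorm {ω : ℝ → ℝ} (hω : IsWeightFunction ω) {f : 𝔼 → ℂ} {p : ℝ≥0∞}
    (hp : 1 ≤ p) (h : ∀ lam : ℝ, 0 < lam → ∃ C : ℝ, 0 < C ∧
      eLpNorm (fun x => Real.exp (lam * ω ‖x‖) • f x) p volume ≤ ENNReal.ofReal C) :
    WeightedL1 ω f := by
  obtain ⟨κ, hκ, K, hK, hF⟩ := hω.exists_lintegral_exp_neg_mul_le (d := d)
  intro lam hlam
  obtain ⟨C, hC, hle⟩ := h (κ + lam) (by positivity)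
  have h1 := (hF (fun x => Real.exp ((κ + lam) * ω ‖x‖) • f x) p hp).trans
    (mul_le_mul' le_rfl hle)
  refine lt_of_le_of_lt (le_trans (le_of_eq ?_) h1)
    (ENNReal.mul_lt_top hK.lt_top ENNReal.ofReal_lt_top)
  refine lintegral_congr fun x => ?_
  rw [enorm_exp_smul, ← ofReal_exp_add_mul]
  ring_nf

theorem norm_le_sum_abs (x : 𝔼) : ‖x‖ ≤ ∑ j, |x j| := by
  rw [EuclideanSpace.norm_eq]
  apply Real.sqrt_le_iff.2 ⟨Finset.sum_nonneg fun _ _ => abs_nonneg _, _⟩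
  simpa using Finset.sum_sq_le_sq_sum_of_nonneg (s := Finset.univ) (f := fun j => |x j|)
    fun _ _ => abs_nonneg _

/-- The power mean inequality for the $d+1$ numbers $1,|x_1|,\dots,|x_d|$, indexed by `Option (Fin
d)`. -/
theorem one_add_norm_pow_le (N : ℕ) (x : 𝔼) :
    (1 + ‖x‖) ^ N ≤ ((d : ℝ) + 1) ^ N * (1 + ∑ j, |x j| ^ N) := by
  have hS : 0 ≤ ∑ j, |x j| ^ N := Finset.sum_nonneg fun _ _ => by positivity
  rcases N with _ | n
  · simp
  · have h2 := pow_sum_div_card_le_sum_pow (s := (Finset.univ : Finset (Option (Fin d))))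
      (f := fun o => o.elim 1 fun j => |x j|) (by
        intro o _
        cases o <;> simp) n
    rw [Fintype.sum_option, Fintype.sum_option] at h2
    simp only [Option.elim_none, Option.elim_some, one_pow, Finset.card_univ, Fintype.card_option,
      Fintype.card_fin] at h2
    rw [div_le_iff₀ (by positivity)] at h2
    push_cast at h2
    calc (1 + ‖x‖) ^ (n + 1) ≤ (1 + ∑ j, |x j|) ^ (n + 1) := by
          gcongr
          exact norm_le_sum_abs x
      _ ≤ (1 + ∑ j, |x j| ^ (n + 1)) * ((d : ℝ) + 1) ^ n := h2
      _ ≤ (1 + ∑ j, |x j| ^ (n + 1)) * ((d : ℝ) + 1) ^ (n + 1) := by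
          gcongr
          · linarith [(Nat.cast_nonneg d : (0 : ℝ) ≤ d)]
          · omega
      _ = _ := mul_comm _ _

theorem monom_single (j : Fin d) (N : ℕ) (x : 𝔼) : monom (Pi.single j N) x = x j ^ N := by
  rw [monom, Finset.prod_eq_single j]
  · simp
  · intro i _ hij
    simp [Pi.single_eq_of_ne hij]
  · simp

theorem multiLength_single (j : Fin d) (N : ℕ) : multiLength (Pi.single j N) = N := by
  simp [multiLength]

theorem monom_zero (x : 𝔼) : monom 0 x = 1 := by
  simp [monom]

theorem multiLength_zero : multiLength (0 : Fin d → ℕ) = 0 := by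
  simp [multiLength]

theorem monom_add (α β : Fin d → ℕ) (x : 𝔼) : monom (α + β) x = monom α x * monom β x := by
  simp [monom, pow_add, Finset.prod_mul_distrib]

/-- The `L¹` norm is controlled by polynomially weighted `L^p` norms. -/
theorem exists_lintegral_enorm_le (d : ℕ) {p : ℝ≥0∞} (hp : 1 ≤ p) :
    ∃ N : ℕ, ∃ K : ℝ, 0 < K ∧ ∀ F : EuclideanSpace ℝ (Fin d) → ℂ,
      AEStronglyMeasurable F volume →
      ∫⁻ x, ‖F x‖ₑ ≤ ENNReal.ofReal K * (eLpNorm F p volume +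
        ∑ j, eLpNorm (fun x => monom (Pi.single j N) x • F x) p volume) := by
  set E := EuclideanSpace ℝ (Fin d)
  have hint : Integrable fun x : E => (1 + ‖x‖) ^ (-((d + 1 : ℕ) : ℝ)) :=
    integrable_one_add_norm (by simp [E])
  -- The exponent makes $(1+|x|)^{-N}$ integrable; $(1+|x|)^N$ is then replaced by pure powers
  -- $x_j^N$, which are monomials as in the conditions.
  set N := d + 1 with hN
  have hgi := hint.lintegral_lt_top.ne
  set G := ∫⁻ x : E, ENNReal.ofReal ((1 + ‖x‖) ^ (-(N : ℝ))) with hG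
  set c : ℝ := ((d : ℝ) + 1) ^ N with hc
  have hc0 : 0 < c := by positivity
  refine ⟨N, (G.toReal + 1) * c, by positivity, fun F hF => ?_⟩
  have hGe : ENNReal.ofReal (G.toReal + 1) = G + 1 := by
    rw [ENNReal.ofReal_add (by positivity) zero_le_one, ENNReal.ofReal_toReal hgi,
      ENNReal.ofReal_one]
  have h1 := lintegral_mul_enorm_le_eLpNorm (g := fun x : E =>
    ENNReal.ofReal ((1 + ‖x‖) ^ (-(N : ℝ)))) hint.1.aemeasurable.ennreal_ofReal
    (fun x => by
      rw [ENNReal.ofReal_le_one]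
      exact Real.rpow_le_one_of_one_le_of_nonpos (by linarith [norm_nonneg x])
        (by simp)) hgi (fun x => ((1 + ‖x‖) ^ N : ℝ) • F x) hp
  have h2 : ∫⁻ x, ‖F x‖ₑ = ∫⁻ x : E, ENNReal.ofReal ((1 + ‖x‖) ^ (-(N : ℝ))) *
      ‖((1 + ‖x‖) ^ N : ℝ) • F x‖ₑ := by
    refine lintegral_congr fun x => ?_
    have hx : 0 < 1 + ‖x‖ := by positivity
    rw [enorm_smul, ← ofReal_norm ((1 + ‖x‖) ^ N), Real.norm_of_nonneg (by positivity),
      ← mul_assoc, ← ENNReal.ofReal_mul (by positivity), Real.rpow_neg hx.le, Real.rpow_natCast,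
      inv_mul_cancel₀ (by positivity), ENNReal.ofReal_one, one_mul]
  have hmeas : ∀ j, AEStronglyMeasurable (fun x => ‖monom (Pi.single j N) x • F x‖)
      (volume : Measure E) :=
    fun j => ((continuous_monom _).aestronglyMeasurable.smul hF).norm
  have h3 : eLpNorm (fun x => ((1 + ‖x‖) ^ N : ℝ) • F x) p volume ≤
      ENNReal.ofReal c * (eLpNorm F p volume +
        ∑ j, eLpNorm (fun x => monom (Pi.single j N) x • F x) p volume) := by
    calc _ ≤ eLpNorm (c • ((fun x => ‖F x‖) +
          ∑ j, fun x => ‖monom (Pi.single j N) x • F x‖)) p volume := by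
          refine eLpNorm_mono fun x => ?_
          have h4 : 0 ≤ ‖F x‖ + ∑ j, ‖monom (Pi.single j N) x • F x‖ := by positivity
          simp only [Pi.smul_apply, Pi.add_apply, Finset.sum_apply, smul_eq_mul]
          rw [Real.norm_of_nonneg (by positivity), norm_smul, Real.norm_of_nonneg (by positivity)]
          calc (1 + ‖x‖) ^ N * ‖F x‖ ≤ (c * (1 + ∑ j, |x j| ^ N)) * ‖F x‖ := by
                gcongr
                exact one_add_norm_pow_le N x
            _ = _ := by
                rw [mul_assoc, add_mul, one_mul, Finset.sum_mul]
                congr 2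
                refine Finset.sum_congr rfl fun j _ => ?_
                rw [norm_smul, monom_single, norm_pow, Real.norm_eq_abs]
      _ = ENNReal.ofReal c * eLpNorm ((fun x => ‖F x‖) +
          ∑ j, fun x => ‖monom (Pi.single j N) x • F x‖) p volume := by
          rw [eLpNorm_const_smul, ← ofReal_norm, Real.norm_of_nonneg hc0.le]
      _ ≤ _ := by
          gcongr
          refine (eLpNorm_add_le hF.norm
            (Finset.aestronglyMeasurable_sum _ fun j _ => hmeas j) hp).trans ?_
          rw [eLpNorm_norm]
          gcongr
          refine (eLpNorm_sum_le (fun j _ => hmeas j) hp).trans ?_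
          simp only [eLpNorm_norm]
          exact le_rfl
  rw [h2]
  refine h1.trans ?_
  rw [ENNReal.ofReal_mul (by positivity), hGe, mul_assoc]
  gcongr

/-! ### From moment bounds to exponential weights. -/

theorem growth_zero_le_one {ω : ℝ → ℝ} (hω : IsWeightFunction ω) {lam : ℝ} (hlam : 0 < lam) :
    growth ω lam 0 ≤ 1 := by
  refine iSup_le fun t => ?_
  obtain ⟨t, ht⟩ := t
  simp only [Set.mem_Ici] at ht
  rw [pow_zero, one_mul, ENNReal.ofReal_le_one, Real.exp_le_one_iff]
  have := hω.nonneg t (by linarith)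
  nlinarith

theorem growth_mono (ω : ℝ → ℝ) (lam : ℝ) {j k : ℕ} (h : j ≤ k) :
    growth ω lam j ≤ growth ω lam k := by
  refine iSup_mono fun t => ENNReal.ofReal_le_ofReal ?_
  have ht : (1 : ℝ) ≤ t := t.2
  gcongr

/-- If `growth` is infinite the hypothesis is empty; `B ≠ 0` then makes the right side infinite. -/
theorem le_mul_growth_of_mul_youngFactor_le {ω : ℝ → ℝ} {lam : ℝ} (hlam : 0 < lam) {k : ℕ}
    {X B : ℝ≥0∞} (hB : B ≠ 0) (h : X * youngFactor ω lam k ≤ B) : X ≤ B * growth ω lam k := by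
  rw [youngFactor_eq ω hlam, ← div_eq_mul_inv] at h
  rcases eq_or_ne (growth ω lam k) ⊤ with htop | htop
  · rw [htop, ENNReal.mul_top hB]
    exact le_top
  · rwa [ENNReal.div_le_iff (growth_ne_zero _ _ _) htop] at h

/-- Pointwise moment bounds imply weighted boundedness. -/
theorem weightedBdd_of_moments {ω : ℝ → ℝ} (hω : IsWeightFunction ω) {f : 𝔼 → ℂ}
    (h : ∀ lam : ℝ, 0 < lam → ∃ C : ℝ, 0 < C ∧ ∀ (k : ℕ) (x : 𝔼),
      ENNReal.ofReal (‖x‖ ^ k) * ‖f x‖ₑ ≤ ENNReal.ofReal C * growth ω lam k) :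
    WeightedBdd ω f := by
  intro lam hlam
  obtain ⟨κ, hκ, c, hc, hpow⟩ := hω.pow_le 1
  obtain ⟨C, hC, hCx⟩ := h (lam + κ) (by positivity)
  refine ⟨C * c + C * Real.exp (lam * ω 1), fun x => ?_⟩
  rcases le_total 1 ‖x‖ with hx | hx
  -- The order `k` is the optimal one for this `x`. The extra factor $|x|$ from rounding is absorbed
  -- by the spare `κ`.
  · obtain ⟨k, hk⟩ := exists_growth_le hω (show 0 < lam + κ by positivity) hx
    have h1 := (hCx k x).trans (mul_le_mul' le_rfl hk)
    rw [← ofReal_norm, ← ENNReal.ofReal_mul (by positivity), ← ENNReal.ofReal_mul (by positivity),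
      ENNReal.ofReal_le_ofReal_iff (by positivity)] at h1
    have hx0 : 0 < ‖x‖ := by linarith
    have h2 : ‖f x‖ ≤ C * (‖x‖ * Real.exp (-((lam + κ) * ω ‖x‖))) := by
      refine le_of_mul_le_mul_left (h1.trans (le_of_eq ?_)) (pow_pos hx0 k)
      rw [pow_succ]; ring
    have h3 : ‖x‖ ≤ c * Real.exp (κ * ω ‖x‖) := by
      have := hpow ‖x‖ hx0.le
      rw [pow_one] at this
      linarith
    calc Real.exp (lam * ω ‖x‖) * ‖f x‖
        ≤ Real.exp (lam * ω ‖x‖) *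
          (C * ((c * Real.exp (κ * ω ‖x‖)) * Real.exp (-((lam + κ) * ω ‖x‖)))) := by
          gcongr
          refine h2.trans ?_
          gcongr
      _ = C * c := by
          rw [Real.exp_neg, add_mul, Real.exp_add]
          field_simp
      _ ≤ _ := by
          have : 0 < C * Real.exp (lam * ω 1) := by positivity
          linarith
  · have h1 := (hCx 0 x).trans (mul_le_mul' le_rfl
      (growth_zero_le_one hω (show 0 < lam + κ by positivity)))
    rw [pow_zero, ENNReal.ofReal_one, one_mul, mul_one, ← ofReal_norm,
      ENNReal.ofReal_le_ofReal_iff hC.le] at h1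
    have h2 : ω ‖x‖ ≤ ω 1 := hω.monotoneOn (norm_nonneg x) (Set.mem_Ici.2 zero_le_one) hx
    calc Real.exp (lam * ω ‖x‖) * ‖f x‖ ≤ Real.exp (lam * ω 1) * C := by gcongr
      _ ≤ _ := by
          have : 0 < C * c := by positivity
          linarith

/-- Integrated moment bounds imply weighted integrability. -/
theorem weightedL1_of_moments {ω : ℝ → ℝ} (hω : IsWeightFunction ω) {f : 𝔼 → ℂ}
    (hf : AEStronglyMeasurable f volume)
    (h : ∀ lam : ℝ, 0 < lam → ∃ C : ℝ, 0 < C ∧ ∀ k : ℕ,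
      ∫⁻ x, ENNReal.ofReal (‖x‖ ^ k) * ‖f x‖ₑ ≤ ENNReal.ofReal C * growth ω lam k) :
    WeightedL1 ω f := by
  intro lam hlam
  -- `A = 2` produces the convergent factor $2^{-k}$ below; the shift `1` matches the exponent `k +
  -- 1` coming from rounding.
  obtain ⟨mu, hmu, C₁, hC₁, h₁⟩ := growth_absorb hω (one_le_two) 1 hlam
  have hmu0 : 0 < mu := hlam.trans_le hmu
  obtain ⟨C₂, hC₂, h₂⟩ := h mu hmu0
  -- The optimal order depends on `x` and cannot be fixed before integrating, so the weight is
  -- bounded by the sum over all orders.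
  have hpt : ∀ x : 𝔼, ENNReal.ofReal (Real.exp (lam * ω ‖x‖)) ≤
      ENNReal.ofReal (Real.exp (lam * ω 1)) +
        ∑' k : ℕ, (growth ω lam k)⁻¹ * ENNReal.ofReal (‖x‖ ^ (k + 1)) := by
    intro x
    rcases le_total 1 ‖x‖ with hx | hx
    · obtain ⟨k, hk⟩ := exists_growth_le hω hlam hx
      have hfin : growth ω lam k ≠ ⊤ := (hk.trans_lt ENNReal.ofReal_lt_top).ne
      refine le_trans ?_ (le_add_left (ENNReal.le_tsum k))
      rw [mul_comm (growth ω lam k)⁻¹, ← div_eq_mul_inv, ENNReal.le_div_iff_mul_le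
        (Or.inl (growth_ne_zero _ _ _)) (Or.inl hfin)]
      refine (mul_le_mul' le_rfl hk).trans ?_
      rw [← ENNReal.ofReal_mul (by positivity)]
      apply ENNReal.ofReal_le_ofReal
      rw [Real.exp_neg]
      field_simp
      exact le_rfl
    · refine le_add_right (ENNReal.ofReal_le_ofReal (Real.exp_le_exp.2 ?_))
      have : ω ‖x‖ ≤ ω 1 := hω.monotoneOn (norm_nonneg x) (Set.mem_Ici.2 zero_le_one) hx
      gcongr
  have hm : ∀ k : ℕ, AEMeasurable (fun x : 𝔼 => (growth ω lam k)⁻¹ *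
      (ENNReal.ofReal (‖x‖ ^ (k + 1)) * ‖f x‖ₑ)) volume := by
    intro k
    exact ((by fun_prop : Measurable fun x : 𝔼 =>
      ENNReal.ofReal (‖x‖ ^ (k + 1))).aemeasurable.mul hf.enorm).const_mul _
  have hterm : ∀ k : ℕ, ∫⁻ x : 𝔼, (growth ω lam k)⁻¹ *
      (ENNReal.ofReal (‖x‖ ^ (k + 1)) * ‖f x‖ₑ) ≤
        ENNReal.ofReal (C₂ * C₁) * (2⁻¹ : ℝ≥0∞) ^ k := by
    intro k
    rw [lintegral_const_mul' _ _ (ENNReal.inv_ne_top.2 (growth_ne_zero _ _ _))]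
    have h3 := h₁ k
    rw [ENNReal.ofReal_ofNat] at h3
    have h4 : growth ω mu (k + 1) ≤ (2⁻¹ : ℝ≥0∞) ^ k * (ENNReal.ofReal C₁ * growth ω lam k) := by
      calc growth ω mu (k + 1) = (2⁻¹ : ℝ≥0∞) ^ k * (2 ^ k * growth ω mu (k + 1)) := by
            rw [← mul_assoc, ← mul_pow, ENNReal.inv_mul_cancel two_ne_zero ENNReal.ofNat_ne_top,
              one_pow, one_mul]
        _ ≤ _ := by gcongr
    calc _ ≤ (growth ω lam k)⁻¹ * (ENNReal.ofReal C₂ *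
          ((2⁻¹ : ℝ≥0∞) ^ k * (ENNReal.ofReal C₁ * growth ω lam k))) := by
          gcongr
          exact (h₂ (k + 1)).trans (by gcongr)
      _ = ENNReal.ofReal C₂ * ENNReal.ofReal C₁ * (2⁻¹ : ℝ≥0∞) ^ k *
          (growth ω lam k * (growth ω lam k)⁻¹) := by ring
      _ ≤ ENNReal.ofReal C₂ * ENNReal.ofReal C₁ * (2⁻¹ : ℝ≥0∞) ^ k * 1 := by
          gcongr
          exact ENNReal.mul_inv_le_one _
      _ = _ := by rw [mul_one, ENNReal.ofReal_mul hC₂.le]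
  have hL1 : ∫⁻ x, ‖f x‖ₑ < ⊤ := by
    have h5 := (h₂ 0).trans (mul_le_mul' le_rfl (growth_zero_le_one hω hmu0))
    simp only [pow_zero, ENNReal.ofReal_one, one_mul, mul_one] at h5
    exact h5.trans_lt ENNReal.ofReal_lt_top
  calc ∫⁻ x, ENNReal.ofReal (Real.exp (lam * ω ‖x‖)) * ‖f x‖ₑ
      ≤ ∫⁻ x, (ENNReal.ofReal (Real.exp (lam * ω 1)) * ‖f x‖ₑ +
        ∑' k : ℕ, (growth ω lam k)⁻¹ * (ENNReal.ofReal (‖x‖ ^ (k + 1)) * ‖f x‖ₑ)) := by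
        refine lintegral_mono fun x => ?_
        refine (mul_le_mul' (hpt x) le_rfl).trans (le_of_eq ?_)
        rw [add_mul, ← ENNReal.tsum_mul_right]
        simp only [mul_assoc]
    _ = (ENNReal.ofReal (Real.exp (lam * ω 1)) * ∫⁻ x, ‖f x‖ₑ) +
        ∑' k : ℕ, ∫⁻ x : 𝔼, (growth ω lam k)⁻¹ *
          (ENNReal.ofReal (‖x‖ ^ (k + 1)) * ‖f x‖ₑ) := by
        rw [lintegral_add_left' (hf.enorm.const_mul _), lintegral_tsum hm,
          lintegral_const_mul' _ _ ENNReal.ofReal_ne_top]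
    _ ≤ (ENNReal.ofReal (Real.exp (lam * ω 1)) * ∫⁻ x, ‖f x‖ₑ) +
        ∑' k : ℕ, ENNReal.ofReal (C₂ * C₁) * (2⁻¹ : ℝ≥0∞) ^ k := by
        gcongr with k
        exact hterm k
    _ < ⊤ := by
        rw [ENNReal.tsum_mul_left, ENNReal.tsum_geometric]
        refine ENNReal.add_lt_top.2 ⟨ENNReal.mul_lt_top ENNReal.ofReal_lt_top hL1,
          ENNReal.mul_lt_top ENNReal.ofReal_lt_top ?_⟩
        rw [ENNReal.one_sub_inv_two, inv_inv]
        exact ENNReal.ofNat_lt_top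

/-! ### Derivatives of Schwartz functions on the Fourier side. -/

theorem exists_schwartz_coordD (u : 𝓢(𝔼, ℂ)) (j : Fin d) :
    ∃ v : 𝓢(𝔼, ℂ), (v : 𝔼 → ℂ) = coordD j u := by
  refine ⟨(-Complex.I) • LineDeriv.lineDerivOp (EuclideanSpace.single j (1 : ℝ)) u, ?_⟩
  ext x
  simp [coordD, SchwartzMap.lineDerivOp_apply_eq_fderiv]

theorem fourierHat_coordD (u : 𝓢(𝔼, ℂ)) (j : Fin d) (ξ : 𝔼) :
    fourierHat (coordD j u) ξ = (ξ j : ℂ) * fourierHat u ξ := by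
  have hi : Integrable (fderiv ℝ (u : 𝔼 → ℂ)) :=
    (SchwartzMap.fderivCLM ℝ 𝔼 ℂ u).integrable
  have h1 := congrFun (VectorFourier.fourierIntegral_fderiv (hatPairing d)
    (μ := (volume : Measure 𝔼)) u.integrable u.differentiable hi) ξ
  have h2 := DFunLike.congr_fun h1 (EuclideanSpace.single j (1 : ℝ))
  rw [Real.fourierIntegral_continuousLinearMap_apply' hi, VectorFourier.fourierSMulRight_apply,
    ← fourierHat_eq_vector, ← fourierHat_eq_vector] at h2
  have h3 : fourierHat (coordD j u) ξ =
      -Complex.I * fourierHat (fun x => fderiv ℝ u x (EuclideanSpace.single j (1 : ℝ))) ξ := by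
    simp only [fourierHat, coordD]
    rw [← integral_const_mul]
    simp only [mul_assoc]
  have h4 : (-(hatPairing d).flip) ξ (EuclideanSpace.single j (1 : ℝ)) =
      -((2 * Real.pi)⁻¹ * ξ j) := by
    rw [_root_.neg_apply, _root_.neg_apply, ContinuousLinearMap.flip_apply, hatPairing_apply,
      EuclideanSpace.inner_single_left]
    simp
  rw [h3, h2, h4]
  have hpi : (Real.pi : ℂ) ≠ 0 := by exact_mod_cast Real.pi_ne_zero
  simp only [smul_eq_mul, Complex.real_smul]
  push_cast
  field_simp
  linear_combination (-(ξ j : ℂ) * fourierHat u ξ) * Complex.I_sq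

theorem exists_schwartz_iterate_coordD (u : 𝓢(𝔼, ℂ)) (j : Fin d) (k : ℕ) :
    ∃ v : 𝓢(𝔼, ℂ), (v : 𝔼 → ℂ) = (coordD j)^[k] u ∧
      ∀ ξ, fourierHat v ξ = (ξ j : ℂ) ^ k * fourierHat u ξ := by
  induction k with
  | zero => exact ⟨u, rfl, fun ξ => by simp⟩
  | succ k ih =>
    obtain ⟨v, hv, hvξ⟩ := ih
    obtain ⟨w, hw⟩ := exists_schwartz_coordD v j
    refine ⟨w, by rw [hw, hv, Function.iterate_succ_apply'], fun ξ => ?_⟩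
    rw [hw, fourierHat_coordD, hvξ, pow_succ]
    ring

theorem multiD_single (f : 𝔼 → ℂ) (j : Fin d) (k : ℕ) :
    multiD (Pi.single j k) f = (coordD j)^[k] f := by
  have h0 : ∀ l : List (Fin d), j ∉ l →
      l.foldr (fun i g => (coordD i)^[(Pi.single j k : Fin d → ℕ) i] g) f = f := by
    intro l hl
    induction l with
    | nil => rfl
    | cons i l ih =>
      simp only [List.mem_cons, not_or] at hl
      rw [List.foldr_cons, ih hl.2, Pi.single_eq_of_ne (Ne.symm hl.1)]
      rfl
  have h1 : ∀ l : List (Fin d), l.Nodup → j ∈ l →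
      l.foldr (fun i g => (coordD i)^[(Pi.single j k : Fin d → ℕ) i] g) f = (coordD j)^[k] f := by
    intro l hn hl
    induction l with
    | nil => simp at hl
    | cons i l ih =>
      rw [List.nodup_cons] at hn
      rw [List.foldr_cons]
      rcases eq_or_ne j i with rfl | hij
      · rw [h0 l hn.1, Pi.single_eq_same]
      · rw [ih hn.2 (List.mem_of_ne_of_mem hij hl), Pi.single_eq_of_ne (Ne.symm hij)]
        rfl
  exact h1 _ (List.nodup_finRange d) (List.mem_finRange j)

theorem ofReal_norm_pow_le (k : ℕ) (x : 𝔼) :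
    ENNReal.ofReal (‖x‖ ^ k) ≤
      ENNReal.ofReal ((d : ℝ) + 1) ^ k * (1 + ∑ j, ENNReal.ofReal (|x j| ^ k)) := by
  have h1 : ‖x‖ ^ k ≤ ((d : ℝ) + 1) ^ k * (1 + ∑ j, |x j| ^ k) :=
    (pow_le_pow_left₀ (norm_nonneg x) (by linarith) k).trans (one_add_norm_pow_le k x)
  refine (ENNReal.ofReal_le_ofReal h1).trans (le_of_eq ?_)
  have hS : 0 ≤ ∑ j, |x j| ^ k := Finset.sum_nonneg fun _ _ => by positivity
  rw [ENNReal.ofReal_mul (by positivity), ENNReal.ofReal_pow (by positivity),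
    ENNReal.ofReal_add zero_le_one hS, ENNReal.ofReal_one,
    ENNReal.ofReal_sum_of_nonneg fun _ _ => by positivity]

/-! ### From $(a)'$–$(g)'$ to the hub. -/

section Converses

variable {ω : ℝ → ℝ} {p q : ℝ≥0∞}

/-- Bounds on the derivatives, uniform relative to the Young conjugate, give decay of the Fourier
transform. -/
theorem weightedBdd_fourierHat_of_derivative_bounds (hω : IsWeightFunction ω) {u : 𝓢(𝔼, ℂ)}
    (hp : 1 ≤ p) (h : ∀ lam : ℝ, 0 < lam → ∀ β : Fin d → ℕ, ∃ C : ℝ, 0 < C ∧ ∀ α : Fin d → ℕ,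
      eLpNorm (fun x => monom β x • multiD α u x) p volume ≤
        ENNReal.ofReal C * growth ω lam (multiLength α)) :
    WeightedBdd ω (fourierHat (u : 𝔼 → ℂ)) := by
  obtain ⟨N, K, hK, hN⟩ := exists_lintegral_enorm_le d hp
  refine weightedBdd_of_moments hω fun lam hlam => ?_
  -- `A = d + 1` absorbs the factor $(d+1)^k$ in passing from coordinate powers to $|\xi|^k$.
  obtain ⟨mu, hmu, C₁, hC₁, h₁⟩ := growth_absorb hω
    (show (1 : ℝ) ≤ (d : ℝ) + 1 by linarith [(Nat.cast_nonneg d : (0 : ℝ) ≤ d)]) 0 hlam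
  have hmu0 : 0 < mu := hlam.trans_le hmu
  obtain ⟨C₀, hC₀, h₀⟩ := h mu hmu0 0
  choose! C hC hCα using fun j : Fin d => h mu hmu0 (Pi.single j N)
  set B : ℝ := K * (C₀ + ∑ j, C j) with hB
  have hSC : 0 ≤ ∑ j, C j := Finset.sum_nonneg fun j _ => (hC j).le
  have hB0 : 0 < B := by positivity
  have hBe : ENNReal.ofReal B = ENNReal.ofReal K *
      (ENNReal.ofReal C₀ + ∑ j, ENNReal.ofReal (C j)) := by
    rw [hB, ENNReal.ofReal_mul hK.le, ENNReal.ofReal_add hC₀.le hSC,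
      ENNReal.ofReal_sum_of_nonneg fun j _ => (hC j).le]
  have hL1 : ∀ α : Fin d → ℕ, ∫⁻ x, ‖multiD α u x‖ₑ ≤
      ENNReal.ofReal B * growth ω mu (multiLength α) := by
    intro α
    refine (hN (multiD α u) (contDiff_multiD (u.smooth _) α).continuous.aestronglyMeasurable).trans
      ?_
    rw [hBe, mul_assoc, add_mul, Finset.sum_mul]
    gcongr with j
    · simpa only [monom_zero, one_smul] using h₀ α
    · exact hCα j α
  -- $\xi_j^k\hat u$ is the transform of $D_j^ku$, so it is bounded by an $L^1$ norm. Only pure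
  -- derivatives are needed.
  have hcoord : ∀ (j : Fin d) (k : ℕ) (ξ : 𝔼), ENNReal.ofReal (|ξ j| ^ k) * ‖fourierHat u ξ‖ₑ ≤
      ENNReal.ofReal B * growth ω mu k := by
    intro j k ξ
    obtain ⟨v, hv, hvξ⟩ := exists_schwartz_iterate_coordD u j k
    have h2 := (enorm_fourierHat_le (v : 𝔼 → ℂ) ξ).trans (le_of_eq (by rw [hv, ← multiD_single]))
    have h3 := h2.trans (hL1 (Pi.single j k))
    rw [multiLength_single, hvξ, enorm_mul] at h3
    refine le_trans (le_of_eq ?_) h3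
    congr 1
    rw [← ofReal_norm, norm_pow, Complex.norm_real, Real.norm_eq_abs]
  have hzero : ∀ ξ : 𝔼, ‖fourierHat u ξ‖ₑ ≤ ENNReal.ofReal B := by
    intro ξ
    have h2 := (enorm_fourierHat_le (u : 𝔼 → ℂ) ξ).trans
      (le_of_eq (by rw [← multiD_zero (u : 𝔼 → ℂ)]))
    refine (h2.trans (hL1 0)).trans ?_
    rw [multiLength_zero]
    exact mul_le_of_le_one_right zero_le (growth_zero_le_one hω hmu0)
  set M : ℝ := Real.exp (mu * ω 1) with hM
  refine ⟨(B * (M + d)) * C₁, by positivity, fun k ξ => ?_⟩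
  calc ENNReal.ofReal (‖ξ‖ ^ k) * ‖fourierHat u ξ‖ₑ
      ≤ (ENNReal.ofReal ((d : ℝ) + 1) ^ k * (1 + ∑ j, ENNReal.ofReal (|ξ j| ^ k))) *
          ‖fourierHat u ξ‖ₑ := by
        gcongr
        exact ofReal_norm_pow_le k ξ
    _ = ENNReal.ofReal ((d : ℝ) + 1) ^ k * (‖fourierHat u ξ‖ₑ * 1 +
          ∑ j, ENNReal.ofReal (|ξ j| ^ k) * ‖fourierHat u ξ‖ₑ) := by
        rw [mul_assoc, add_mul, one_mul, mul_one, Finset.sum_mul]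
    _ ≤ ENNReal.ofReal ((d : ℝ) + 1) ^ k * (ENNReal.ofReal B * (ENNReal.ofReal M * growth ω mu k) +
          ∑ _j : Fin d, ENNReal.ofReal B * growth ω mu k) := by
        exact mul_le_mul' le_rfl (add_le_add (mul_le_mul' (hzero ξ) (one_le_growth ω mu k))
          (Finset.sum_le_sum fun j _ => hcoord j k ξ))
    _ = ENNReal.ofReal (B * (M + d)) *
          (ENNReal.ofReal ((d : ℝ) + 1) ^ k * growth ω mu (k + 0)) := by
        rw [Finset.sum_const, Finset.card_univ, Fintype.card_fin, nsmul_eq_mul,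
          ENNReal.ofReal_mul hB0.le, ENNReal.ofReal_add (p := M) (by positivity) (by positivity),
          ENNReal.ofReal_natCast, add_zero]
        ring
    _ ≤ ENNReal.ofReal (B * (M + d)) * (ENNReal.ofReal C₁ * growth ω lam k) :=
        mul_le_mul' le_rfl (h₁ k)
    _ = _ := by rw [ENNReal.ofReal_mul (q := C₁) (by positivity), mul_assoc (ENNReal.ofReal _)]

/-- Moment bounds relative to the Young conjugate give weighted integrability. -/
theorem weightedL1_of_monom_bounds (hω : IsWeightFunction ω) {f : 𝔼 → ℂ}
    (hf : AEStronglyMeasurable f volume) (hq : 1 ≤ q)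
    (h : ∀ mu : ℝ, 0 < mu → ∃ C : ℝ, 0 < C ∧ ∀ β : Fin d → ℕ,
      eLpNorm (fun x => monom β x • f x) q volume ≤
        ENNReal.ofReal C * growth ω mu (multiLength β)) :
    WeightedL1 ω f := by
  obtain ⟨N, K, hK, hN⟩ := exists_lintegral_enorm_le d hq
  refine weightedL1_of_moments hω hf fun lam hlam => ?_
  -- Besides $(d+1)^k$, the shift `N` must be absorbed: passing from $L^q$ to $L^1$ multiplies by
  -- $x_j^N$.
  obtain ⟨mu, hmu, C₁, hC₁, h₁⟩ := growth_absorb hω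
    (show (1 : ℝ) ≤ (d : ℝ) + 1 by linarith [(Nat.cast_nonneg d : (0 : ℝ) ≤ d)]) N hlam
  have hmu0 : 0 < mu := hlam.trans_le hmu
  obtain ⟨C, hC, hCβ⟩ := h mu hmu0
  set B : ℝ := K * (C * (d + 1)) with hB
  have hB0 : 0 < B := by positivity
  have hBe : ENNReal.ofReal B = ENNReal.ofReal K * (ENNReal.ofReal C * (d + 1)) := by
    rw [hB, ENNReal.ofReal_mul hK.le, ENNReal.ofReal_mul hC.le,
      ENNReal.ofReal_add (by positivity) zero_le_one, ENNReal.ofReal_natCast, ENNReal.ofReal_one]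
  have hL1 : ∀ β : Fin d → ℕ, ∫⁻ x, ‖monom β x • f x‖ₑ ≤
      ENNReal.ofReal B * growth ω mu (multiLength β + N) := by
    intro β
    refine (hN (fun x => monom β x • f x)
      ((continuous_monom β).aestronglyMeasurable.smul hf)).trans ?_
    have h2 : eLpNorm (fun x => monom β x • f x) q volume ≤
        ENNReal.ofReal C * growth ω mu (multiLength β + N) :=
      (hCβ β).trans (mul_le_mul' le_rfl (growth_mono ω mu (Nat.le_add_right _ _)))
    have h3 : ∀ j, eLpNorm (fun x => monom (Pi.single j N) x • monom β x • f x) q volume ≤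
        ENNReal.ofReal C * growth ω mu (multiLength β + N) := by
      intro j
      have h4 := hCβ (Pi.single j N + β)
      simp only [monom_add, multiLength_add, multiLength_single, mul_smul] at h4
      rwa [add_comm N] at h4
    calc _ ≤ ENNReal.ofReal K * (ENNReal.ofReal C * growth ω mu (multiLength β + N) +
          ∑ _j : Fin d, ENNReal.ofReal C * growth ω mu (multiLength β + N)) := by
          gcongr with j
          exact h3 j
      _ = _ := by
          rw [Finset.sum_const, Finset.card_univ, Fintype.card_fin, nsmul_eq_mul, hBe]
          ring
  have hzero : ∀ k, ∫⁻ x, ‖f x‖ₑ ≤ ENNReal.ofReal B * growth ω mu (k + N) := by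
    intro k
    have h2 := hL1 0
    simp only [monom_zero, one_smul, multiLength_zero] at h2
    exact h2.trans (mul_le_mul' le_rfl (growth_mono ω mu (by omega)))
  have hcoord : ∀ (j : Fin d) (k : ℕ), ∫⁻ x, ENNReal.ofReal (|x j| ^ k) * ‖f x‖ₑ ≤
      ENNReal.ofReal B * growth ω mu (k + N) := by
    intro j k
    have h2 := hL1 (Pi.single j k)
    rw [multiLength_single] at h2
    refine le_trans (le_of_eq (lintegral_congr fun x => ?_)) h2
    rw [monom_single, enorm_smul, ← ofReal_norm (x j ^ k), norm_pow, Real.norm_eq_abs]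
  refine ⟨B * (d + 1) * C₁, by positivity, fun k => ?_⟩
  have hm : ∀ j : Fin d, AEMeasurable (fun x : 𝔼 => ENNReal.ofReal (|x j| ^ k) * ‖f x‖ₑ) volume :=
    fun j => (by fun_prop : Measurable fun x : 𝔼 =>
      ENNReal.ofReal (|x j| ^ k)).aemeasurable.mul hf.enorm
  calc ∫⁻ x, ENNReal.ofReal (‖x‖ ^ k) * ‖f x‖ₑ
      ≤ ∫⁻ x : 𝔼, ENNReal.ofReal ((d : ℝ) + 1) ^ k *
          (‖f x‖ₑ + ∑ j, ENNReal.ofReal (|x j| ^ k) * ‖f x‖ₑ) := by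
        refine lintegral_mono fun x => ?_
        refine (mul_le_mul' (ofReal_norm_pow_le k x) le_rfl).trans (le_of_eq ?_)
        rw [mul_assoc, add_mul, one_mul, Finset.sum_mul]
    _ = ENNReal.ofReal ((d : ℝ) + 1) ^ k * ((∫⁻ x, ‖f x‖ₑ) +
          ∑ j, ∫⁻ x : 𝔼, ENNReal.ofReal (|x j| ^ k) * ‖f x‖ₑ) := by
        rw [lintegral_const_mul' _ _ (ENNReal.pow_ne_top ENNReal.ofReal_ne_top),
          lintegral_add_left' hf.enorm, lintegral_finsetSum' _ fun j _ => hm j]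
    _ ≤ ENNReal.ofReal ((d : ℝ) + 1) ^ k * (ENNReal.ofReal B * growth ω mu (k + N) +
          ∑ _j : Fin d, ENNReal.ofReal B * growth ω mu (k + N)) := by
        gcongr with j
        · exact hzero k
        · exact hcoord j k
    _ = ENNReal.ofReal (B * (d + 1)) *
          (ENNReal.ofReal ((d : ℝ) + 1) ^ k * growth ω mu (k + N)) := by
        rw [Finset.sum_const, Finset.card_univ, Fintype.card_fin, nsmul_eq_mul,
          ENNReal.ofReal_mul hB0.le, ENNReal.ofReal_add (p := (d : ℝ)) (by positivity) zero_le_one,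
          ENNReal.ofReal_natCast, ENNReal.ofReal_one]
        ring
    _ ≤ ENNReal.ofReal (B * (d + 1)) * (ENNReal.ofReal C₁ * growth ω lam k) :=
        mul_le_mul' le_rfl (h₁ k)
    _ = _ := by rw [ENNReal.ofReal_mul (q := C₁) (by positivity), mul_assoc (ENNReal.ofReal _)]

theorem CondC.weightedL1 (hω : IsWeightFunction ω) {u : 𝔼 → ℂ} (hp : 1 ≤ p) (hq : 1 ≤ q)
    (h : CondC ω p q u) : WeightedL1 ω u ∧ WeightedL1 ω (fourierHat u) :=
  ⟨weightedL1_of_eLpNorm hω hp h.1, weightedL1_of_eLpNorm hω hq h.2⟩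

theorem CondA.condC {u : 𝔼 → ℂ} (h : CondA ω p q u) : CondC ω p q u :=
  ⟨fun lam hlam => by simpa only [multiD_zero] using h.1 lam hlam 0,
    fun lam hlam => by simpa only [multiD_zero] using h.2 lam hlam 0⟩

theorem CondB.condC {u : 𝔼 → ℂ} (h : CondB ω p q u) : CondC ω p q u :=
  ⟨fun lam hlam => by simpa only [monom_zero, mul_one] using h.1 lam hlam 0,
    fun lam hlam => by simpa only [monom_zero, mul_one] using h.2 lam hlam 0⟩

theorem ofReal_ne_zero_of_pos {C : ℝ} (hC : 0 < C) : ENNReal.ofReal C ≠ 0 := by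
  simpa using hC

/-- The $L^q$ half with $\alpha=0$ controls the moments of `u`; the $L^p$ half controls $\hat u$
through the derivatives. -/
theorem CondD.weightedL1 (hω : IsWeightFunction ω) {u : 𝓢(𝔼, ℂ)} (hp : 1 ≤ p) (hq : 1 ≤ q)
    (h : CondD ω p q u) : WeightedL1 ω u ∧ WeightedL1 ω (fourierHat (u : 𝔼 → ℂ)) := by
  constructor
  · refine weightedL1_of_monom_bounds hω u.continuous.aestronglyMeasurable hq fun mu hmu => ?_
    obtain ⟨C, hC, hle⟩ := h.2 mu hmu 0
    refine ⟨C, hC, fun β => ?_⟩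
    have h1 := (le_iSup _ β).trans hle
    rw [multiD_zero] at h1
    exact le_mul_growth_of_mul_youngFactor_le hmu (ofReal_ne_zero_of_pos hC) h1
  · refine (weightedBdd_fourierHat_of_derivative_bounds hω hp fun lam hlam β => ?_).weightedL1 hω
    obtain ⟨C, hC, hle⟩ := h.1 lam hlam β
    exact ⟨C, hC, fun α => le_mul_growth_of_mul_youngFactor_le hlam (ofReal_ne_zero_of_pos hC)
      ((le_iSup _ α).trans hle)⟩

theorem CondE.weightedL1 (hω : IsWeightFunction ω) {u : 𝓢(𝔼, ℂ)} (hp : 1 ≤ p)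
    (h : CondE ω p u) : WeightedL1 ω u ∧ WeightedL1 ω (fourierHat (u : 𝔼 → ℂ)) := by
  have key : ∀ mu lam : ℝ, 0 < mu → 0 < lam → ∃ C : ℝ, 0 < C ∧ ∀ α β : Fin d → ℕ,
      eLpNorm (fun x => monom β x • multiD α u x) p volume ≤
        ENNReal.ofReal C * growth ω mu (multiLength β) * growth ω lam (multiLength α) := by
    intro mu lam hmu hlam
    obtain ⟨C, hC, hle⟩ := h mu lam hmu hlam
    refine ⟨C, hC, fun α β => ?_⟩
    have h0 := ofReal_ne_zero_of_pos hC
    have h1 := (le_iSup₂_of_le α β le_rfl).trans hle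
    exact le_mul_growth_of_mul_youngFactor_le hlam (mul_ne_zero h0 (growth_ne_zero _ _ _))
      (le_mul_growth_of_mul_youngFactor_le hmu h0 h1)
  constructor
  · refine weightedL1_of_monom_bounds hω u.continuous.aestronglyMeasurable hp fun mu hmu => ?_
    -- Any second parameter would do, since the factor for $\alpha=0$ is at most `1`.
    obtain ⟨C, hC, hle⟩ := key mu 1 hmu one_pos
    refine ⟨C, hC, fun β => ?_⟩
    have h1 := hle 0 β
    rw [multiD_zero, multiLength_zero] at h1
    exact h1.trans (mul_le_of_le_one_right zero_le (growth_zero_le_one hω one_pos))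
  · refine (weightedBdd_fourierHat_of_derivative_bounds hω hp fun lam hlam β => ?_).weightedL1 hω
    obtain ⟨mu, hmu, hfin⟩ := exists_growth_lt_top hω (multiLength β)
    obtain ⟨C, hC, hle⟩ := key mu lam hmu hlam
    have hG0 := ENNReal.toReal_pos (growth_ne_zero ω mu (multiLength β)) hfin.ne
    refine ⟨C * (growth ω mu (multiLength β)).toReal, by positivity, fun α => ?_⟩
    rw [ENNReal.ofReal_mul hC.le, ENNReal.ofReal_toReal hfin.ne]
    exact hle α β

theorem CondF.weightedL1 (hω : IsWeightFunction ω) {u : 𝓢(𝔼, ℂ)} (hp : 1 ≤ p)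
    (h : CondF ω p u) : WeightedL1 ω u ∧ WeightedL1 ω (fourierHat (u : 𝔼 → ℂ)) := by
  have key : ∀ lam : ℝ, 0 < lam → ∃ C : ℝ, 0 < C ∧ ∀ α β : Fin d → ℕ,
      eLpNorm (fun x => monom β x • multiD α u x) p volume ≤
        ENNReal.ofReal C * growth ω lam (multiLength α + multiLength β) := by
    intro lam hlam
    obtain ⟨C, hC, hle⟩ := h lam hlam
    refine ⟨C, hC, fun α β => ?_⟩
    have h1 := (le_iSup₂_of_le α β le_rfl).trans hle
    rw [← multiLength_add]
    exact le_mul_growth_of_mul_youngFactor_le hlam (ofReal_ne_zero_of_pos hC) h1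
  constructor
  · refine weightedL1_of_monom_bounds hω u.continuous.aestronglyMeasurable hp fun mu hmu => ?_
    obtain ⟨C, hC, hle⟩ := key mu hmu
    refine ⟨C, hC, fun β => ?_⟩
    simpa only [multiD_zero, multiLength_zero, zero_add] using hle 0 β
  · refine (weightedBdd_fourierHat_of_derivative_bounds hω hp fun lam hlam β => ?_).weightedL1 hω
    -- With $A=1$ the fixed shift $|\beta|$ in the joint index $|\alpha+\beta|$ is absorbed.
    obtain ⟨mu, hmu, C₁, hC₁, h₁⟩ := growth_absorb hω le_rfl (multiLength β) hlam
    obtain ⟨C, hC, hle⟩ := key mu (hlam.trans_le hmu)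
    refine ⟨C * C₁, by positivity, fun α => (hle α β).trans ?_⟩
    rw [ENNReal.ofReal_mul hC.le, mul_assoc]
    refine mul_le_mul' le_rfl ?_
    simpa only [ENNReal.ofReal_one, one_pow, one_mul] using h₁ (multiLength α)

theorem CondG.weightedL1 (hω : IsWeightFunction ω) {u : 𝓢(𝔼, ℂ)} (hp : 1 ≤ p)
    (h : CondG ω p u) : WeightedL1 ω u ∧ WeightedL1 ω (fourierHat (u : 𝔼 → ℂ)) := by
  have key : ∀ mu lam : ℝ, 0 < mu → 0 < lam → ∃ C : ℝ, 0 < C ∧ ∀ α : Fin d → ℕ,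
      eLpNorm (fun x => Real.exp (mu * ω ‖x‖) • multiD α u x) p volume ≤
        ENNReal.ofReal C * growth ω lam (multiLength α) := by
    intro mu lam hmu hlam
    obtain ⟨C, hC, hle⟩ := h mu lam hmu hlam
    exact ⟨C, hC, fun α => le_mul_growth_of_mul_youngFactor_le hlam (ofReal_ne_zero_of_pos hC)
      ((le_iSup _ α).trans hle)⟩
  constructor
  · refine weightedL1_of_eLpNorm hω hp fun lam hlam => ?_
    obtain ⟨C, hC, hle⟩ := key lam 1 hlam one_pos
    have h1 := hle 0
    rw [multiD_zero, multiLength_zero] at h1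
    exact ⟨C, hC, h1.trans (mul_le_of_le_one_right zero_le (growth_zero_le_one hω one_pos))⟩
  · refine (weightedBdd_fourierHat_of_derivative_bounds hω hp fun lam hlam β => ?_).weightedL1 hω
    obtain ⟨κ, hκ, c, hc, hpow⟩ := hω.pow_le (multiLength β)
    obtain ⟨C, hC, hle⟩ := key κ lam hκ hlam
    refine ⟨c * C, by positivity, fun α => ?_⟩
    have hpt : ∀ x : 𝔼, ‖monom β x • multiD α u x‖ ≤
        ‖(c • fun x => Real.exp (κ * ω ‖x‖) • multiD α u x) x‖ := by
      intro x
      simp only [Pi.smul_apply, norm_smul, Real.norm_of_nonneg hc.le,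
        Real.norm_of_nonneg (Real.exp_pos _).le, ← mul_assoc, Real.norm_eq_abs]
      gcongr
      exact (abs_monom_le β x).trans ((pow_le_pow_left₀ (norm_nonneg x) (by linarith) _).trans
        (hpow ‖x‖ (norm_nonneg x)))
    refine (eLpNorm_mono hpt).trans ?_
    rw [eLpNorm_const_smul, ← ofReal_norm, Real.norm_of_nonneg hc.le, ENNReal.ofReal_mul hc.le,
      mul_assoc]
    gcongr
    exact hle α

end Converses

/-! ### From $(h)'$ to the hub. -/

theorem measurable_enorm_gaborTransform {ψ u : 𝔼 → ℂ} (hψ : Continuous ψ) (hu : Continuous u) :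
    Measurable fun z : 𝔼 × 𝔼 => ‖gaborTransform ψ u z.1 z.2‖ₑ := by
  have hF : StronglyMeasurable fun w : (𝔼 × 𝔼) × 𝔼 => u w.2 * conj (ψ (w.2 - w.1.1)) *
      Complex.exp (-Complex.I * ((inner ℝ w.2 w.1.2 : ℝ) : ℂ)) :=
    (by fun_prop : Continuous fun w : (𝔼 × 𝔼) × 𝔼 => u w.2 * conj (ψ (w.2 - w.1.1)) *
      Complex.exp (-Complex.I * ((inner ℝ w.2 w.1.2 : ℝ) : ℂ))).stronglyMeasurable
  exact (hF.integral_prod_right' (ν := (volume : Measure 𝔼))).enorm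

/-- The mixed norm bounds on the Gabor transform imply weighted integrability. -/
theorem CondH.lintegral_lt_top {ω : ℝ → ℝ} (hω : IsWeightFunction ω) {p q : ℝ≥0∞} (hp : 1 ≤ p)
    (hq : 1 ≤ q) {ψ u : 𝔼 → ℂ} (h : CondH ω p q ψ u) {lam : ℝ} (hlam : 0 < lam) :
    ∫⁻ ξ, ENNReal.ofReal (Real.exp (lam * ω ‖ξ‖)) *
      ∫⁻ x, ENNReal.ofReal (Real.exp (lam * ω ‖x‖)) * ‖gaborTransform ψ u x ξ‖ₑ < ⊤ := by
  obtain ⟨κ, hκ, K, hK, hF⟩ := hω.exists_lintegral_exp_neg_mul_le (d := d)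
  -- The factor `2` serves $\omega(x)+\omega(\xi)\le2\omega(z)$, and `κ` the two comparisons of
  -- norms.
  obtain ⟨C, hC, hle⟩ := h (2 * (lam + κ)) (by positivity)
  set f : 𝔼 → ℝ≥0∞ := fun ξ => eLpNorm (fun x =>
    Real.exp (2 * (lam + κ) * ω (Real.sqrt (‖x‖ ^ 2 + ‖ξ‖ ^ 2))) • gaborTransform ψ u x ξ)
      p volume with hf
  have hfq : eLpNorm f q volume ≤ ENNReal.ofReal C := hle
  have hm : ∀ ξ : 𝔼, ENNReal.ofReal (Real.exp ((lam + κ) * ω ‖ξ‖)) *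
      ∫⁻ x, ENNReal.ofReal (Real.exp (lam * ω ‖x‖)) * ‖gaborTransform ψ u x ξ‖ₑ ≤ K * f ξ := by
    intro ξ
    have h1 := hF (fun x => Real.exp ((lam + κ) * ω ‖ξ‖) •
      Real.exp ((lam + κ) * ω ‖x‖) • gaborTransform ψ u x ξ) p hp
    have h2 : eLpNorm (fun x => Real.exp ((lam + κ) * ω ‖ξ‖) •
        Real.exp ((lam + κ) * ω ‖x‖) • gaborTransform ψ u x ξ) p volume ≤ f ξ := by
      refine eLpNorm_mono fun x => ?_
      simp only [norm_smul, Real.norm_of_nonneg (Real.exp_pos _).le, ← mul_assoc]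
      refine mul_le_mul_of_nonneg_right ?_ (norm_nonneg _)
      rw [← Real.exp_add]
      apply Real.exp_le_exp.2
      have e1 : ω ‖x‖ ≤ ω (Real.sqrt (‖x‖ ^ 2 + ‖ξ‖ ^ 2)) :=
        hω.monotoneOn (norm_nonneg x) (Real.sqrt_nonneg _)
          (Real.le_sqrt_of_sq_le (by nlinarith [sq_nonneg ‖ξ‖]))
      have e2 : ω ‖ξ‖ ≤ ω (Real.sqrt (‖x‖ ^ 2 + ‖ξ‖ ^ 2)) :=
        hω.monotoneOn (norm_nonneg ξ) (Real.sqrt_nonneg _)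
          (Real.le_sqrt_of_sq_le (by nlinarith [sq_nonneg ‖x‖]))
      nlinarith
    refine le_trans (le_of_eq ?_) (h1.trans (mul_le_mul' le_rfl h2))
    rw [← lintegral_const_mul' _ _ ENNReal.ofReal_ne_top]
    refine lintegral_congr fun x => ?_
    rw [enorm_exp_smul, enorm_exp_smul, mul_left_comm (ENNReal.ofReal (Real.exp (-(κ * ω ‖x‖)))),
      ← ofReal_exp_add_mul (-(κ * ω ‖x‖)) ((lam + κ) * ω ‖x‖)]
    congr 4
    ring
  have h3 := (hF f q hq).trans (mul_le_mul' le_rfl hfq)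
  calc _ = ∫⁻ ξ, ENNReal.ofReal (Real.exp (-(κ * ω ‖ξ‖))) *
        (ENNReal.ofReal (Real.exp ((lam + κ) * ω ‖ξ‖)) *
          ∫⁻ x, ENNReal.ofReal (Real.exp (lam * ω ‖x‖)) * ‖gaborTransform ψ u x ξ‖ₑ) := by
        refine lintegral_congr fun ξ => ?_
        rw [← ofReal_exp_add_mul]
        ring_nf
    _ ≤ ∫⁻ ξ, K * (ENNReal.ofReal (Real.exp (-(κ * ω ‖ξ‖))) * ‖f ξ‖ₑ) := by
        refine lintegral_mono fun ξ => ?_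
        rw [mul_left_comm K, enorm_eq_self]
        exact mul_le_mul' le_rfl (hm ξ)
    _ = K * ∫⁻ ξ, ENNReal.ofReal (Real.exp (-(κ * ω ‖ξ‖))) * ‖f ξ‖ₑ :=
        lintegral_const_mul' _ _ hK
    _ ≤ K * (K * ENNReal.ofReal C) := by gcongr
    _ < ⊤ := ENNReal.mul_lt_top hK.lt_top (ENNReal.mul_lt_top hK.lt_top ENNReal.ofReal_lt_top)

/-- Pointwise recovery of a function from its Gabor transform. -/
theorem enorm_mul_enorm_le_lintegral_gaborTransform {ψ f : 𝔼 → ℂ} (hfc : Continuous f)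
    (hψc : Continuous ψ) {x : 𝔼} (hw : Integrable fun y => f y * conj (ψ (y - x))) (y : 𝔼) :
    ‖f y‖ₑ * ‖ψ (y - x)‖ₑ ≤ ∫⁻ ξ, ‖gaborTransform ψ f x ξ‖ₑ := by
  set w : 𝔼 → ℂ := fun y => f y * conj (ψ (y - x)) with hwdef
  have hwc : Continuous w := by fun_prop
  rcases eq_or_ne (∫⁻ ξ, ‖gaborTransform ψ f x ξ‖ₑ) ⊤ with htop | htop
  · rw [htop]
    exact le_top
  · have hint : Integrable (fourierHat w) :=
      ⟨(continuous_fourierHat hw).aestronglyMeasurable, lt_top_iff_ne_top.2 htop⟩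
    have h1 := enorm_fourierHat_le (fourierHat w) (-y)
    rw [fourierHat_fourierHat hwc hw hint, neg_neg, enorm_mul] at h1
    -- The inversion constant $(2\pi)^d$ is at least `1` and can be dropped.
    have h2 : (1 : ℝ≥0∞) ≤ ‖((2 * Real.pi : ℝ) : ℂ) ^ d‖ₑ := by
      rw [← ofReal_norm, ← ENNReal.ofReal_one, norm_pow, Complex.norm_real,
        Real.norm_of_nonneg (by positivity)]
      exact ENNReal.ofReal_le_ofReal (one_le_pow₀ (by linarith [Real.pi_gt_three]))
    have h3 : ‖w y‖ₑ = ‖f y‖ₑ * ‖ψ (y - x)‖ₑ := by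
      rw [hwdef, enorm_mul, ← ofReal_norm (conj _), RCLike.norm_conj, ofReal_norm]
    rw [← h3]
    calc ‖w y‖ₑ = 1 * ‖w y‖ₑ := (one_mul _).symm
      _ ≤ _ := mul_le_mul' h2 le_rfl
      _ ≤ _ := h1

/-- Multiply $|f(y)||\psi(y-x)|\le\int|V_\psi f(x,\xi)|d\xi$ by $e^{\lambda\omega(y)-\lambda
L\omega(y-x)}\le e^{\lambda L}e^{\lambda L\omega(x)}$ and integrate in $x$. The left side becomes
$e^{\lambda\omega(y)}|f(y)|$ times a constant $c_0$ independent of $y$, nonzero because $\psi\ne0$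
is continuous. -/
theorem weightedBdd_of_lintegral_gaborTransform {ω : ℝ → ℝ} (hω : IsWeightFunction ω)
    {ψ f : 𝔼 → ℂ} (hfc : Continuous f) (hf : Integrable f) (hψc : Continuous ψ)
    (hψ1 : WeightedBdd ω ψ) (hψ0 : ψ ≠ 0)
    (h : ∀ lam : ℝ, 0 < lam → ∫⁻ x, ENNReal.ofReal (Real.exp (lam * ω ‖x‖)) *
      ∫⁻ ξ, ‖gaborTransform ψ f x ξ‖ₑ < ⊤) : WeightedBdd ω f := by
  intro lam hlam
  obtain ⟨L, hL, hexp⟩ := hω.exists_exp_le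
  have hI := h (lam * L) (by positivity)
  set I := ∫⁻ x, ENNReal.ofReal (Real.exp (lam * L * ω ‖x‖)) *
      ∫⁻ ξ, ‖gaborTransform ψ f x ξ‖ₑ with hIdef
  obtain ⟨M, hM0, hM⟩ := hψ1.exists_le one_pos
  have hψb : ∀ z, ‖ψ z‖ ≤ M := fun z => by
    refine (hM z).trans (mul_le_of_le_one_right hM0.le ?_)
    have := hω.nonneg ‖z‖ (norm_nonneg z)
    rw [Real.exp_le_one_iff]
    linarith
  have hw : ∀ x, Integrable fun y => f y * conj (ψ (y - x)) := fun x =>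
    hf.mul_bdd (c := M) (by fun_prop : Continuous fun y => conj (ψ (y - x))).aestronglyMeasurable
      (Filter.Eventually.of_forall fun y => by rw [RCLike.norm_conj]; exact hψb _)
  set θ : 𝔼 → ℝ≥0∞ := fun z => ‖ψ z‖ₑ * ENNReal.ofReal (Real.exp (-(lam * L * ω ‖z‖))) with hθ
  have hθm : Measurable θ := by
    have := hω.continuous_norm (d := d)
    have h2 : Continuous fun z : 𝔼 => Real.exp (-(lam * L * ω ‖z‖)) :=
      Real.continuous_exp.comp (continuous_const.mul this).neg
    exact hψc.measurable.enorm.mul h2.measurable.ennreal_ofReal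
  set c₀ := ∫⁻ z, θ z with hc₀
  have hc₀0 : c₀ ≠ 0 := by
    intro h0
    rw [hc₀, lintegral_eq_zero_iff hθm] at h0
    have h1 : ψ =ᵐ[volume] 0 := by
      filter_upwards [h0] with z hz
      rcases mul_eq_zero.1 hz with h2 | h2
      · simpa using h2
      · rw [ENNReal.ofReal_eq_zero] at h2
        exact absurd h2 (not_le.2 (Real.exp_pos _))
    exact hψ0 ((hψc.ae_eq_iff_eq volume continuous_zero).1 h1)
  have hfin : ENNReal.ofReal (Real.exp (lam * L)) * I ≠ ⊤ :=
    ENNReal.mul_ne_top ENNReal.ofReal_ne_top hI.ne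
  have key : ∀ y, ENNReal.ofReal (Real.exp (lam * ω ‖y‖)) * ‖f y‖ₑ ≤
      ENNReal.ofReal (Real.exp (lam * L)) * I / c₀ := by
    intro y
    rw [ENNReal.le_div_iff_mul_le (Or.inl hc₀0) (Or.inr hfin), hc₀,
      ← lintegral_sub_left_eq_self _ y, hIdef,
      ← lintegral_const_mul' _ _ ENNReal.ofReal_ne_top,
      ← lintegral_const_mul' _ _ (ENNReal.mul_ne_top ENNReal.ofReal_ne_top enorm_ne_top)]
    refine lintegral_mono fun x => ?_
    have h1 := hexp lam hlam ‖y‖ ‖x‖ ‖y - x‖ (norm_nonneg _) (norm_nonneg _) (norm_nonneg _)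
      (norm_le_norm_add_norm_sub' y x)
    have h2 : Real.exp (lam * ω ‖y‖) * Real.exp (-(lam * L * ω ‖y - x‖)) ≤
        Real.exp (lam * L) * Real.exp (lam * L * ω ‖x‖) := by
      rw [Real.exp_neg, ← div_eq_mul_inv, div_le_iff₀ (Real.exp_pos _)]
      exact h1
    calc ENNReal.ofReal (Real.exp (lam * ω ‖y‖)) * ‖f y‖ₑ * θ (y - x)
        = ENNReal.ofReal (Real.exp (lam * ω ‖y‖) * Real.exp (-(lam * L * ω ‖y - x‖))) *
          (‖f y‖ₑ * ‖ψ (y - x)‖ₑ) := by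
          rw [hθ, ENNReal.ofReal_mul (by positivity)]
          ring
      _ ≤ ENNReal.ofReal (Real.exp (lam * L) * Real.exp (lam * L * ω ‖x‖)) *
          ∫⁻ ξ, ‖gaborTransform ψ f x ξ‖ₑ :=
          mul_le_mul' (ENNReal.ofReal_le_ofReal h2)
            (enorm_mul_enorm_le_lintegral_gaborTransform hfc hψc (hw x) y)
      _ = _ := by rw [ENNReal.ofReal_mul (by positivity), mul_assoc]
  refine ⟨(ENNReal.ofReal (Real.exp (lam * L)) * I / c₀).toReal, fun y => ?_⟩
  have h1 := ENNReal.toReal_mono (ENNReal.div_ne_top hfin hc₀0) (key y)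
  rwa [ENNReal.toReal_mul, ENNReal.toReal_ofReal (by positivity), toReal_enorm] at h1

theorem MemSOmega.weightedBdd {ω : ℝ → ℝ} {u : 𝔼 → ℂ} (h : MemSOmega ω u) :
    WeightedBdd ω u ∧ WeightedBdd ω (fourierHat u) :=
  ⟨fun lam hlam => by simpa only [multiD_zero] using h.bound lam hlam 0,
    fun lam hlam => by simpa only [multiD_zero] using h.bound_hat lam hlam 0⟩

theorem CondH.weightedL1 {ω : ℝ → ℝ} (hω : IsWeightFunction ω) {p q : ℝ≥0∞} (hp : 1 ≤ p)
    (hq : 1 ≤ q) {ψ : 𝔼 → ℂ} {u : 𝓢(𝔼, ℂ)} (hψ : MemSOmega ω ψ) (hψ0 : ψ ≠ 0)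
    (h : CondH ω p q ψ u) : WeightedL1 ω u ∧ WeightedL1 ω (fourierHat (u : 𝔼 → ℂ)) := by
  have hψc := hψ.smooth.continuous
  obtain ⟨hψ1, hψ2⟩ := hψ.weightedBdd
  have hψhc := hψ.smooth_hat.continuous
  have hψhi := hψ2.integrable hω hψhc
  obtain ⟨hus, hui⟩ := fourierHat_schwartz u
  have hV := measurable_enorm_gaborTransform hψc u.continuous
  have hωc := hω.continuous_norm (d := d)
  have hE : ∀ lam : ℝ, Measurable fun x : 𝔼 => ENNReal.ofReal (Real.exp (lam * ω ‖x‖)) :=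
    fun lam => (Real.continuous_exp.comp (continuous_const.mul hωc)).measurable.ennreal_ofReal
  have hone : ∀ lam : ℝ, 0 < lam → ∀ x : 𝔼,
      (1 : ℝ≥0∞) ≤ ENNReal.ofReal (Real.exp (lam * ω ‖x‖)) := by
    intro lam hlam x
    rw [ENNReal.one_le_ofReal]
    have := hω.nonneg ‖x‖ (norm_nonneg x)
    exact Real.one_le_exp (by positivity)
  constructor
  · refine (weightedBdd_of_lintegral_gaborTransform hω u.continuous u.integrable hψc hψ1 hψ0
      fun lam hlam => ?_).weightedL1 hω
    -- For `u` the weight in `ξ` is discarded and the integrals are exchanged by Tonelli.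
    refine lt_of_le_of_lt ?_ (h.lintegral_lt_top hω hp hq hlam)
    calc _ = ∫⁻ x, ∫⁻ ξ, ENNReal.ofReal (Real.exp (lam * ω ‖x‖)) *
          ‖gaborTransform ψ u x ξ‖ₑ := by
          refine lintegral_congr fun x => ?_
          rw [lintegral_const_mul' _ _ ENNReal.ofReal_ne_top]
      _ = ∫⁻ ξ, ∫⁻ x, ENNReal.ofReal (Real.exp (lam * ω ‖x‖)) * ‖gaborTransform ψ u x ξ‖ₑ :=
          lintegral_lintegral_swap (((hE lam).comp measurable_fst).mul hV).aemeasurable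
      _ ≤ _ := lintegral_mono fun ξ => le_mul_of_one_le_left zero_le (hone lam hlam ξ)
  · have hψh0 : fourierHat ψ ≠ 0 := by
      intro h0
      apply hψ0
      ext x
      have h1 := fourierHat_fourierHat hψc hψ.integrable hψhi (-x)
      rw [h0, neg_neg] at h1
      have h2 : fourierHat (0 : 𝔼 → ℂ) (-x) = 0 := by simp [fourierHat]
      rw [h2] at h1
      exact (mul_eq_zero.1 h1.symm).resolve_left two_pi_pow_ne_zero
    -- The same argument for $\hat u$ with window $\hat\psi$; the fundamental identity turns its
    -- transform back into $V_\psi u$, and the weight in `x` is discarded.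
    refine (weightedBdd_of_lintegral_gaborTransform hω hus.continuous hui hψhc hψ2 hψh0
      fun lam hlam => ?_).weightedL1 hω
    have h1 := h.lintegral_lt_top hω hp hq hlam
    have h2 : ∀ ξ : 𝔼, ∫⁻ x, ‖gaborTransform (fourierHat ψ) (fourierHat u) ξ x‖ₑ ≤
        ENNReal.ofReal ((2 * Real.pi) ^ d) *
          ∫⁻ x, ENNReal.ofReal (Real.exp (lam * ω ‖x‖)) * ‖gaborTransform ψ u x ξ‖ₑ := by
      intro ξ
      rw [← lintegral_neg_eq_self, ← lintegral_const_mul' _ _ ENNReal.ofReal_ne_top]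
      refine lintegral_mono fun x => ?_
      rw [norm_gaborTransform_hat u.integrable hψc hψ.integrable hψhi]
      exact mul_le_mul' le_rfl (le_mul_of_one_le_left zero_le (hone lam hlam x))
    calc _ ≤ ∫⁻ ξ, ENNReal.ofReal ((2 * Real.pi) ^ d) *
          (ENNReal.ofReal (Real.exp (lam * ω ‖ξ‖)) *
          ∫⁻ x, ENNReal.ofReal (Real.exp (lam * ω ‖x‖)) * ‖gaborTransform ψ u x ξ‖ₑ) := by
          refine lintegral_mono fun ξ => ?_
          rw [mul_left_comm]
          exact mul_le_mul' le_rfl (h2 ξ)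
      _ = ENNReal.ofReal ((2 * Real.pi) ^ d) *
          ∫⁻ ξ, ENNReal.ofReal (Real.exp (lam * ω ‖ξ‖)) *
          ∫⁻ x, ENNReal.ofReal (Real.exp (lam * ω ‖x‖)) * ‖gaborTransform ψ u x ξ‖ₑ :=
          lintegral_const_mul' _ _ ENNReal.ofReal_ne_top
      _ < ⊤ := ENNReal.mul_lt_top ENNReal.ofReal_lt_top h1

/-! ### The hub and the assembly of the equivalences. -/

theorem jointBound_schwartz {ω : ℝ → ℝ} (hω : IsWeightFunction ω) {u : 𝓢(𝔼, ℂ)}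
    (h : WeightedL1 ω u ∧ WeightedL1 ω (fourierHat (u : 𝔼 → ℂ))) :
    JointBound ω u ∧ JointBound ω (fourierHat (u : 𝔼 → ℂ)) :=
  ⟨jointBound_of_weightedL1 hω (u.smooth _) u.integrable h.1 h.2,
    jointBound_of_weightedL1 hω (fourierHat_schwartz u).1 (fourierHat_schwartz u).2 h.2
      h.1.fourierHat_fourierHat⟩

theorem memSOmega_iff_weightedL1 {ω : ℝ → ℝ} (hω : IsWeightFunction ω) (u : 𝓢(𝔼, ℂ)) :
    MemSOmega ω u ↔ WeightedL1 ω u ∧ WeightedL1 ω (fourierHat (u : 𝔼 → ℂ)) := by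
  constructor
  · exact fun h => ⟨h.weightedBdd.1.weightedL1 hω, h.weightedBdd.2.weightedL1 hω⟩
  · intro h
    obtain ⟨h1, h2⟩ := jointBound_schwartz hω h
    refine ⟨u.integrable, u.smooth _, (fourierHat_schwartz u).1, fun lam hlam α => ?_,
      fun lam hlam α => ?_⟩
    · obtain ⟨C, -, hC⟩ := h1.exists_le hω hlam α
      exact ⟨C, hC⟩
    · obtain ⟨C, -, hC⟩ := h2.exists_le hω hlam α
      exact ⟨C, hC⟩

theorem JointBound.condA {ω : ℝ → ℝ} (hω : IsWeightFunction ω) {p q : ℝ≥0∞} (hp : 1 ≤ p)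
    (hq : 1 ≤ q) {u : 𝔼 → ℂ} (h1 : JointBound ω u) (h2 : JointBound ω (fourierHat u)) :
    CondA ω p q u :=
  ⟨fun _ hlam α => h1.exists_eLpNorm_exp_smul_multiD_le hω hp hlam α,
    fun _ hlam α => h2.exists_eLpNorm_exp_smul_multiD_le hω hq hlam α⟩

theorem JointBound.condB {ω : ℝ → ℝ} (hω : IsWeightFunction ω) {p q : ℝ≥0∞} (hp : 1 ≤ p)
    (hq : 1 ≤ q) {u : 𝔼 → ℂ} (h1 : JointBound ω u) (h2 : JointBound ω (fourierHat u)) :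
    CondB ω p q u :=
  ⟨fun _ hlam α => h1.exists_eLpNorm_exp_monom_smul_le hω hp hlam α,
    fun _ hlam α => h2.exists_eLpNorm_exp_monom_smul_le hω hq hlam α⟩

theorem theorem2p4 {d : ℕ} (ω : ℝ → ℝ) (hω : IsWeightFunction ω)
    (p q : ℝ≥0∞) (hp : 1 ≤ p) (hq : 1 ≤ q) (u : 𝓢(EuclideanSpace ℝ (Fin d), ℂ)) :
    (MemSOmega ω u ↔ CondA ω p q u) ∧
    (MemSOmega ω u ↔ CondB ω p q u) ∧
    (MemSOmega ω u ↔ CondC ω p q u) ∧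
    (MemSOmega ω u ↔ CondD ω p q u) ∧
    (MemSOmega ω u ↔ CondE ω p u) ∧
    (MemSOmega ω u ↔ CondF ω p u) ∧
    (MemSOmega ω u ↔ CondG ω p u) ∧
    (∀ ψ : EuclideanSpace ℝ (Fin d) → ℂ, MemSOmega ω ψ → ψ ≠ 0 →
      (MemSOmega ω u ↔ CondH ω p q ψ u)) := by
  have hub := memSOmega_iff_weightedL1 hω u
  have hj := fun h : MemSOmega ω u => jointBound_schwartz hω (hub.1 h)
  refine ⟨⟨fun h => (hj h).1.condA hω hp hq (hj h).2,
      fun h => hub.2 (h.condC.weightedL1 hω hp hq)⟩,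
    ⟨fun h => (hj h).1.condB hω hp hq (hj h).2,
      fun h => hub.2 (h.condC.weightedL1 hω hp hq)⟩,
    ⟨fun h => ((hj h).1.condA hω hp hq (hj h).2).condC,
      fun h => hub.2 (h.weightedL1 hω hp hq)⟩,
    ⟨fun h => (hj h).1.condD hω hp hq, fun h => hub.2 (h.weightedL1 hω hp hq)⟩,
    ⟨fun h => (hj h).1.condE hω hp, fun h => hub.2 (h.weightedL1 hω hp)⟩,
    ⟨fun h => (hj h).1.condF hω hp, fun h => hub.2 (h.weightedL1 hω hp)⟩,
    ⟨fun h => (hj h).1.condG hω hp, fun h => hub.2 (h.weightedL1 hω hp)⟩,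
    fun ψ hψ hψ0 => ⟨fun h => ?_, fun h => hub.2 (h.weightedL1 hω hp hq hψ hψ0)⟩⟩
  -- $(h)'$ follows from the hub through the decay of the Gabor transform, without `JointBound`.
  exact condH_of_weightedL1 hω u.integrable (hub.1 h).1 (hub.1 h).2 hψ.smooth.continuous
    hψ.weightedBdd.1 hψ.weightedBdd.2 hp hq
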